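/- Setting (Bayesian bandit). Let $\mathcal A$ be a set of actions and $(f_\theta)_\theta$ known mean-reward functions $\mathcal A\to\mathbb R$; the parameter $\theta$ is drawn from a known prior $q$. At time $t=1,2,\dots$ a (possibly random) nonempty set $\mathcal A_t\subseteq\mathcal A$ is revealed, where the process $(\mathcal A_t)$ is otherwise arbitrary; an action $A_t\in\mathcal A_t$ is played, and a reward is observed whose law, given $\theta$, the past and $A_t=a$, depends only on $(\theta,a)$ and has mean $f_\theta(a)$. Let $H_t$ be the history observed before $A_t$ is chosen (including $\mathcal A_t$), let $R_s$ be the reward observed at time $s$, and let $A_t^*(\theta)\in\arg\max_{a\in\mathcal A_t}f_\theta(a)$ be a (measurable) optimal action. For functions $\hat\mu_t(a)<U_t(a)$ of $H_t$ and $a$ put $\mathrm{radius}_t(a)=U_t(a)-\hat\mu_t(a)$. TS-UCB with $m\ge1$ samples draws, given $H_t$, independent samples $\tilde\theta_1,\dots,\tilde\theta_m$ from the posterior of $\theta$, sets $\tilde f_t=\frac1m\sum_{i=1}^m f_{\tilde\theta_i}(A_t^*(\tilde\theta_i))$, and plays an action $A_t\in\arg\min_{a\in\mathcal A_t}\frac{\tilde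 f_t-\hat\mu_t(a)}{\mathrm{radius}_t(a)}$ (assumed to exist, ties broken by any, possibly randomised, rule based on $H_t$ and the samples). Let $T,m\ge1$ and $0<r_{\min}\le r_{\max}$. (a) $K$-armed bandit. Let $K\le T$, $\mathcal A_t=\mathcal A=\{1,\dots,K\}$, $f_\theta(a)=\theta_a$ with $\theta\in[0,1]^K$, and rewards in $[0,1]$. Let $N_t(a)$ be the number of plays of $a$ before time $t$ and $$\hat\mu_t(a)=\frac1{N_t(a)}\sum_{s<t,\,A_s=a}R_s,\qquad U_t(a)=\hat\mu_t(a)+\sqrt{\frac{3\log T}{N_t(a)}}.$$ Suppose that each arm is pulled once in the first $K$ rounds, that TS-UCB is used from round $K+1$ on, and that almost surely $\mathrm{radius}_t(a)\in[r_{\min},r_{\max}]$ for all $a$ and $K<t\le T$. Then $$\sum_{t=K+1}^T\mathbb E[f_\theta(A_t^*)-f_\theta(A_t)]\le 2\sum_{t=K+1}^T\mathbb E[\mathrm{radius}_t(A_t)]+\frac{r_{\max}}{r_{\min}}\Big(1+\frac{2T}{\sqrt m}\Big)+T^{-2},$$ and the full Bayes regret $\sum_{t=1}^T\mathbb E[f_\theta(A_t^*)-f_\theta(A_t)]$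 is at most the same right-hand side plus $K$. (b) Linear bandit. Let $f_\theta(a)=\langle\theta,X(a)\rangle$ with known $X(a)\in\mathbb R^d$ ($X$ measurable), $\|\theta\|_2\le S\le\sqrt d$, $\|X(a)\|_2\le L$, $f_\theta(a)\in[-1,1]$, and let the reward minus its mean $f_\theta(a)$ be $r$-sub-Gaussian with $r\ge1$. With $n=t-1$ completed rounds and $X_s=X(A_s)$, let $V=I+\sum_{s=1}^{n}X_sX_s^\top$, $\hat\theta=V^{-1}\sum_{s=1}^{n}R_sX_s$, $\sqrt{\beta}=r\sqrt{d\log(T^2(1+nL))}+S$, and $$\hat\mu_t(a)=\langle X(a),\hat\theta\rangle,\qquad U_t(a)=\max\{\langle X(a),\rho\rangle:\ \sqrt{(\rho-\hat\theta)^\top V(\rho-\hat\theta)}\le\sqrt{\beta}\}.$$ Suppose that TS-UCB is used at all times, and that almost surely $\mathrm{radius}_t(a)\in[r_{\min},r_{\max}]$ for all $a\in\mathcal A$ and $1\le t\le T$. Then $$\sum_{t=1}^T\mathbb E[f_\theta(A_t^*)-f_\theta(A_t)]\le 2\sum_{t=1}^T\mathbb E[\mathrm{radius}_t(A_t)]+\frac{r_{\max}}{r_{\min}}\Big(1+\frac{2T}{\sqrt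 m}\Big)+T^{-2}.$$ -/

import Mathlib

open MeasureTheory ProbabilityTheory
open scoped NNReal Matrix

noncomputable section

namespace TSUCB

/-- What the agent knows when it chooses an action after `n` completed rounds: the observed triples
(context, action, reward) of these rounds, and the current context. The set of available actions
is a function of the context. Rounds are numbered from `0`. -/
abbrev Hist (C A : Type*) (n : ℕ) : Type _ := (Fin n → C × A × ℝ) × C

/-- The kernel that maps `x` to the law of `m` independent draws from `κ x`. -/
def iidKernel {α E : Type*} [MeasurableSpace α] [MeasurableSpace E] (m : ℕ)
    (κ : Kernel α E) [IsMarkovKernel κ] : Kernel α (Fin m → E) where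
  toFun x := Measure.pi fun _ => κ x
  measurable' := by
    refine Measurable.measure_of_isPiSystem_of_isProbabilityMeasure
      (S := Set.pi Set.univ '' Set.pi Set.univ fun _ : Fin m => {s : Set E | MeasurableSet s})
      generateFrom_pi.symm isPiSystem_pi ?_
    rintro _ ⟨s, hs, rfl⟩
    simp only [Measure.pi_pi]
    exact Finset.measurable_prod _ fun i _ => Kernel.measurable_coe κ (hs i (Set.mem_univ i))

/-- The random variables of a Bayesian bandit problem: the true parameter and, for each round, the
context, the `m` sampled parameters, the action played, and the observed reward. -/
structure Run (Ω C A E : Type*) (m : ℕ) where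
  param : Ω → E
  ctx : ℕ → Ω → C
  samp : ℕ → Ω → Fin m → E
  act : ℕ → Ω → A
  rew : ℕ → Ω → ℝ

variable {Ω C A E : Type*} {m : ℕ}

/-- The history available at round `n`. -/
def Run.hist (R : Run Ω C A E m) (n : ℕ) (ω : Ω) : Hist C A n :=
  (fun s => (R.ctx s ω, R.act s ω, R.rew s ω), R.ctx n ω)

/-- `R` is a run of the Bayesian bandit with prior `q` and reward kernel `ν`: the parameter has law
`q`, and, given the parameter, the history and the action `a` played, the reward has law
`ν (θ, a)`. -/
structure IsBanditRun [MeasurableSpace Ω] [MeasurableSpace C] [MeasurableSpace A]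
    [MeasurableSpace E] (P : Measure Ω) (q : Measure E) (ν : Kernel (E × A) ℝ)
    (R : Run Ω C A E m) : Prop where
  measurable_param : Measurable R.param
  measurable_ctx : ∀ n, Measurable (R.ctx n)
  measurable_samp : ∀ n, Measurable (R.samp n)
  measurable_act : ∀ n, Measurable (R.act n)
  measurable_rew : ∀ n, Measurable (R.rew n)
  law_param : HasLaw R.param q P
  law_rew : ∀ n, HasCondDistrib (R.rew n) (fun ω => (R.hist n ω, R.param ω, R.act n ω))
    (Kernel.prodMkLeft (Hist C A n) ν) P

/-- `opt n c θ` is, measurably, a best action at round `n` in the context `c` for the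
parameter `θ ∈ Θ`. -/
structure IsOptimal [MeasurableSpace C] [MeasurableSpace A] [MeasurableSpace E]
    (f : E → A → ℝ) (Θ : Set E) (avail : C → Set A) (opt : ℕ → C → E → A) : Prop where
  measurable : ∀ n, Measurable fun p : C × E => opt n p.1 p.2
  mem : ∀ n c, ∀ θ ∈ Θ, opt n c θ ∈ avail c
  le : ∀ n c, ∀ θ ∈ Θ, ∀ a ∈ avail c, f θ a ≤ f θ (opt n c θ)

/-- The average, over the sampled parameters, of the mean reward of the best action. -/
def fTilde (f : E → A → ℝ) (opt : ℕ → C → E → A) (R : Run Ω C A E m) (n : ℕ) (ω : Ω) : ℝ :=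
  (∑ i, f (R.samp n ω i) (opt n (R.ctx n ω) (R.samp n ω i))) / m

/-- The radius of the confidence interval. -/
def radius (muHat U : (n : ℕ) → Hist C A n → A → ℝ) {n : ℕ} (h : Hist C A n) (a : A) : ℝ :=
  U n h a - muHat n h a

/-- The ratio `Ψ` for the value `v` of the averaged optimal reward. -/
def ratio (muHat U : (n : ℕ) → Hist C A n → A → ℝ) {n : ℕ} (h : Hist C A n) (v : ℝ) (a : A) : ℝ :=
  (v - muHat n h a) / radius muHat U h a

/-- The actions of `R` are chosen by TS-UCB from round `n₀` on: given the history (and the true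
parameter), the samples are `m` independent draws from the posterior; the action is a, possibly
randomised, function of the history and the samples; from round `n₀` on it minimises the ratio
over the available actions. -/
structure IsTSUCB [MeasurableSpace Ω] [MeasurableSpace C] [MeasurableSpace A]
    [MeasurableSpace E] [StandardBorelSpace E] [Nonempty E]
    (P : Measure Ω) [IsProbabilityMeasure P] (f : E → A → ℝ) (avail : C → Set A)
    (opt : ℕ → C → E → A) (muHat U : (n : ℕ) → Hist C A n → A → ℝ) (n₀ : ℕ)
    (R : Run Ω C A E m) : Prop where
  law_samp : ∀ n, HasCondDistrib (R.samp n) (fun ω => (R.param ω, R.hist n ω))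
    (Kernel.prodMkLeft E (iidKernel m (condDistrib R.param (R.hist n) P))) P
  law_act : ∀ n, ∃ τ : Kernel (Hist C A n × (Fin m → E)) A, IsMarkovKernel τ ∧
    HasCondDistrib (R.act n) (fun ω => (R.param ω, R.hist n ω, R.samp n ω))
      (Kernel.prodMkLeft E τ) P
  argmin : ∀ n, n₀ ≤ n → ∀ᵐ ω ∂P, R.act n ω ∈ avail (R.ctx n ω) ∧
    ∀ a ∈ avail (R.ctx n ω),
      ratio muHat U (R.hist n ω) (fTilde f opt R n ω) (R.act n ω)
        ≤ ratio muHat U (R.hist n ω) (fTilde f opt R n ω) a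

/-- The Bayes regret accumulated over the rounds in `s`. -/
def bayesRegret [MeasurableSpace Ω] (P : Measure Ω) (f : E → A → ℝ) (opt : ℕ → C → E → A)
    (R : Run Ω C A E m) (s : Finset ℕ) : ℝ :=
  ∑ n ∈ s, ∫ ω, (f (R.param ω) (opt n (R.ctx n ω) (R.param ω)) - f (R.param ω) (R.act n ω)) ∂P

/-- The expected radii of the actions played, summed over the rounds in `s`. -/
def expRadius [MeasurableSpace Ω] (P : Measure Ω) (muHat U : (n : ℕ) → Hist C A n → A → ℝ)
    (R : Run Ω C A E m) (s : Finset ℕ) : ℝ :=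
  ∑ n ∈ s, ∫ ω, radius muHat U (R.hist n ω) (R.act n ω) ∂P

section KArmed

variable {K : ℕ}

/-- The mean reward of arm `a` is the coordinate `θ a`. -/
def armMean (θ : Fin K → ℝ) (a : Fin K) : ℝ := θ a

/-- The number of earlier plays of `a`. -/
def playCount {n : ℕ} (h : Hist Unit (Fin K) n) (a : Fin K) : ℕ :=
  (Finset.univ.filter fun s : Fin n => (h.1 s).2.1 = a).card

/-- The average reward of the earlier plays of `a`. -/
def armMuHat (n : ℕ) (h : Hist Unit (Fin K) n) (a : Fin K) : ℝ :=
  (∑ s : Fin n, if (h.1 s).2.1 = a then (h.1 s).2.2 else 0) / (playCount h a : ℝ)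

/-- The upper confidence bound of the `K`-armed bandit with horizon `T`. -/
def armU (T : ℕ) (n : ℕ) (h : Hist Unit (Fin K) n) (a : Fin K) : ℝ :=
  armMuHat n h a + √(3 * Real.log T / (playCount h a : ℝ))

end KArmed

section Linear

variable {d : ℕ}

/-- The mean reward `⟨θ, X a⟩`. -/
def linMean (X : A → EuclideanSpace ℝ (Fin d)) (θ : EuclideanSpace ℝ (Fin d)) (a : A) : ℝ :=
  inner ℝ θ (X a)

/-- The regularised design matrix `V = I + ∑ x xᵀ` over the completed rounds. -/
def designMatrix (X : A → EuclideanSpace ℝ (Fin d)) {n : ℕ} (h : Hist C A n) :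
    Matrix (Fin d) (Fin d) ℝ :=
  1 + ∑ s : Fin n, Matrix.vecMulVec (X (h.1 s).2.1).ofLp (X (h.1 s).2.1).ofLp

/-- The regularised least-squares estimate `V⁻¹ ∑ y x`. -/
def thetaHat (X : A → EuclideanSpace ℝ (Fin d)) {n : ℕ} (h : Hist C A n) : Fin d → ℝ :=
  (designMatrix X h)⁻¹ *ᵥ ∑ s : Fin n, (h.1 s).2.2 • (X (h.1 s).2.1).ofLp

/-- The square root of `β` after `n` completed rounds. -/
def sqrtBeta (d T : ℕ) (r S L : ℝ) (n : ℕ) : ℝ :=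
  r * √(d * Real.log ((T : ℝ) ^ 2 * (1 + n * L))) + S

/-- The confidence ellipsoid after `n` completed rounds. -/
def confSet (X : A → EuclideanSpace ℝ (Fin d)) (T : ℕ) (r S L : ℝ) {n : ℕ} (h : Hist C A n) :
    Set (Fin d → ℝ) :=
  {ρ | √((ρ - thetaHat X h) ⬝ᵥ (designMatrix X h *ᵥ (ρ - thetaHat X h))) ≤ sqrtBeta d T r S L n}

/-- The estimate `⟨X a, θ̂⟩` of the mean reward of `a`. -/
def linMuHat (X : A → EuclideanSpace ℝ (Fin d)) (n : ℕ) (h : Hist C A n) (a : A) : ℝ :=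
  (X a).ofLp ⬝ᵥ thetaHat X h

/-- The upper confidence bound of the linear bandit: the maximum of `⟨X a, ρ⟩` over the (compact,
nonempty) confidence ellipsoid. -/
def linU (X : A → EuclideanSpace ℝ (Fin d)) (T : ℕ) (r S L : ℝ) (n : ℕ) (h : Hist C A n)
    (a : A) : ℝ :=
  sSup ((fun ρ : Fin d → ℝ => (X a).ofLp ⬝ᵥ ρ) '' confSet X T r S L h)

end Linear

end TSUCB

end

/-! Fix a round. Let G be the posterior mean of the optimal value given the history, F the average
over the m posterior samples, and let mu and rad be the estimate and the radius of the action
played. The regret splits as (optimal value - G) + (G - F) + (F - mu) + (mu - mean reward). The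
first term has mean zero, even after multiplication by a function of history and action, because the
parameter and the action are conditionally independent given the history. The second costs 1/√m, the
standard deviation of a mean of m bounded draws. The last is rad, up to an "excess": the relative
amount by which mean rewards leave their confidence intervals. The third term is where the rule of
TS-UCB enters. The ratio Ψ = (F - mu)/rad is at most the ratio of the best action of any parameter
drawn from the posterior; if Ψ > 1, averaging this over the posterior gives (Ψ - 1) rmin ≤ F - G +
rmax · (posterior excess). Hence F - mu is at most rad plus rmax/rmin times (|F - G| + excess)
whenever rad ≤ 1; rounds with rad > 1 are free, since regret is at most 2. This is
`integral_regret_le`. After summation (`sum_regret_le`) it remains to see that the expected excesses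
add up to at most 1/2. Working with the expected excess instead of a failure event yields both
bounds even without the summand T^(-2). For K arms the excess is dominated by Hoeffding
supermartingales, one for each possible play count (`lintegral_armExcess_le`). For the linear bandit
it is dominated by the self-normalised mixture exp(Q/(2r²))/√det V (`lintegral_mixture_le`,
`linExcess_le_mixture`). The width contains log(1 + nL), whereas det V may grow with L², so large L
needs care. If rmax/rmin ≥ 2(T - 1), all rounds but the first are bounded trivially. Otherwise, for
d ≥ 2, the bounds on the radii limit the size of the design (`sum_norm_sq_le_of_radius`); for d = 1
two mixtures with different regularisation suffice (`lintegral_linExcess_fin_one_le`). -/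

namespace TSUCB

/-! ### Integration against conditional laws. -/

section Conditional

variable {Ω X Y : Type*} [MeasurableSpace Ω] [MeasurableSpace X] [MeasurableSpace Y]
  {P : Measure Ω} [IsProbabilityMeasure P] {U : Ω → X} {W : Ω → Y} {κ : Kernel X Y}
  [IsMarkovKernel κ]

theorem lintegral_of_hasCondDistrib (h : HasCondDistrib W U κ P) {F : X × Y → ENNReal}
    (hF : Measurable F) :
    ∫⁻ ω, F (U ω, W ω) ∂P = ∫⁻ ω, ∫⁻ y, F (U ω, y) ∂(κ (U ω)) ∂P := by
  rw [← lintegral_map' hF.aemeasurable h.aemeasurable, h.map_eq, Measure.lintegral_compProd hF,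
    lintegral_map' (hF.lintegral_kernel_prod_right').aemeasurable h.aemeasurable_fst]

omit [IsProbabilityMeasure P] [IsMarkovKernel κ] in
theorem integrable_map_compProd (h : HasCondDistrib W U κ P) {F : X × Y → ℝ}
    (hF : Measurable F) (hi : Integrable (fun ω => F (U ω, W ω)) P) :
    Integrable F ((P.map U) ⊗ₘ κ) := by
  rw [← h.map_eq]
  exact (integrable_map_measure hF.aestronglyMeasurable h.aemeasurable).2 hi

theorem integral_of_hasCondDistrib (h : HasCondDistrib W U κ P) {F : X × Y → ℝ}
    (hF : Measurable F) (hi : Integrable (fun ω => F (U ω, W ω)) P) :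
    ∫ ω, F (U ω, W ω) ∂P = ∫ ω, ∫ y, F (U ω, y) ∂(κ (U ω)) ∂P := by
  have hi' := integrable_map_compProd h hF hi
  have := integral_map h.aemeasurable (f := F) hF.aestronglyMeasurable
  rw [← this, h.map_eq, Measure.integral_compProd hi', integral_map h.aemeasurable_fst]
  exact (hF.stronglyMeasurable.integral_kernel_prod_right').aestronglyMeasurable

theorem integrable_integral_of_hasCondDistrib (h : HasCondDistrib W U κ P) {F : X × Y → ℝ}
    (hF : Measurable F) (hi : Integrable (fun ω => F (U ω, W ω)) P) :
    Integrable (fun ω => ∫ y, F (U ω, y) ∂(κ (U ω))) P := by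
  have hi' : Integrable (fun x => ∫ y, F (x, y) ∂(κ x)) (P.map U) :=
    (integrable_map_compProd h hF hi).integral_compProd
  rwa [integrable_map_measure (hF.stronglyMeasurable.integral_kernel_prod_right').aestronglyMeasurable
    h.aemeasurable_fst] at hi'

theorem ae_integrable_of_hasCondDistrib (h : HasCondDistrib W U κ P) {F : X × Y → ℝ}
    (hF : Measurable F) (hi : Integrable (fun ω => F (U ω, W ω)) P) :
    ∀ᵐ ω ∂P, Integrable (fun y => F (U ω, y)) (κ (U ω)) := by
  have hi' := integrable_map_compProd h hF hi
  have := (Measure.integrable_compProd_iff hF.aestronglyMeasurable).1 hi'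
  exact ae_of_ae_map h.aemeasurable_fst this.1

/-- Serves to carry membership in the parameter set from the prior to almost every posterior. -/
theorem ae_ae_of_hasCondDistrib (h : HasCondDistrib W U κ P) {s : Set Y}
    (hs : ∀ᵐ y ∂(P.map W), y ∈ s) : ∀ᵐ ω ∂P, ∀ᵐ y ∂(κ (U ω)), y ∈ s := by
  have h1 : ∀ᵐ p ∂((P.map U) ⊗ₘ κ), p.2 ∈ s := by
    rw [← h.map_eq]
    refine ae_of_ae_map (f := Prod.snd) measurable_snd.aemeasurable ?_
    rwa [AEMeasurable.map_map_of_aemeasurable measurable_snd.aemeasurable h.aemeasurable]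
  exact ae_of_ae_map h.aemeasurable_fst (Measure.ae_ae_of_ae_compProd h1)

theorem ae_of_hasCondDistrib (h : HasCondDistrib W U κ P) {s : Set (X × Y)}
    (hs : MeasurableSet s) (hae : ∀ᵐ ω ∂P, ∀ᵐ y ∂(κ (U ω)), (U ω, y) ∈ s) :
    ∀ᵐ ω ∂P, (U ω, W ω) ∈ s := by
  refine ae_of_ae_map h.aemeasurable ?_
  rw [h.map_eq, Measure.ae_compProd_iff (p := fun y => y ∈ s) hs, ae_map_iff h.aemeasurable_fst]
  · exact hae
  · have : Measurable fun x => κ x (Prod.mk x ⁻¹' sᶜ) :=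
      Kernel.measurable_kernel_prodMk_left hs.compl
    exact this (measurableSet_singleton 0)

end Conditional

/-! ### Independent draws and their Monte Carlo error. -/

theorem iidKernel_apply {α E : Type*} [MeasurableSpace α] [MeasurableSpace E] (m : ℕ)
    (κ : Kernel α E) [IsMarkovKernel κ] (x : α) :
    iidKernel m κ x = Measure.pi fun _ => κ x := rfl

instance {α E : Type*} [MeasurableSpace α] [MeasurableSpace E] (m : ℕ)
    (κ : Kernel α E) [IsMarkovKernel κ] : IsMarkovKernel (iidKernel m κ) :=
  ⟨fun x => by rw [iidKernel_apply]; infer_instance⟩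

/-- The mean of `m` independent bounded draws is at distance at most `1 / √m` from its expectation,
on average. -/
theorem integral_abs_mean_sub_le {E : Type*} [MeasurableSpace E] (μ : Measure E)
    [IsProbabilityMeasure μ] {G : E → ℝ} (hG : Measurable G) (hb : ∀ x, |G x| ≤ 1)
    {m : ℕ} (hm : 1 ≤ m) :
    ∫ s : Fin m → E, |(∑ i, G (s i)) / m - ∫ x, G x ∂μ| ∂(Measure.pi fun _ => μ) ≤ 1 / √m := by
  have hm0 : (0 : ℝ) < m := by exact_mod_cast hm
  set Q : Measure (Fin m → E) := Measure.pi fun _ => μ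
  set Y : (Fin m → E) → ℝ := fun s => (∑ i, G (s i)) / m with hY
  have hGL : MemLp G 2 μ := MemLp.of_bound hG.aestronglyMeasurable 1 (ae_of_all _ hb)
  have hYm : Measurable Y := by fun_prop
  have hYb : ∀ s, |Y s| ≤ 1 := fun s => by
    rw [hY, abs_div, Nat.abs_cast, div_le_one hm0]
    calc |∑ i, G (s i)| ≤ ∑ i, |G (s i)| := Finset.abs_sum_le_sum_abs _ _
      _ ≤ ∑ _i : Fin m, (1 : ℝ) := Finset.sum_le_sum fun i _ => hb _
      _ = m := by simp
  have hYL : MemLp Y 2 Q := MemLp.of_bound hYm.aestronglyMeasurable 1 (ae_of_all _ hYb)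
  have hmean : ∫ s, Y s ∂Q = ∫ x, G x ∂μ := by
    rw [hY, integral_div, integral_finsetSum]
    · have : ∀ i : Fin m, ∫ s, G (s i) ∂Q = ∫ x, G x ∂μ := fun i => by
        have h := measurePreserving_eval (fun _ : Fin m => μ) i
        conv_rhs => rw [← h.map_eq]
        exact (integral_map h.measurable.aemeasurable hG.aestronglyMeasurable).symm
      simp [this]
      field_simp
    · intro i _
      exact Integrable.of_bound
        (hG.comp (measurable_pi_apply i)).aestronglyMeasurable 1 (ae_of_all _ fun s => hb _)
  have hvar : Var[Y; Q] ≤ 1 / m := by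
    have h1 : Y = fun s => (1 / (m : ℝ)) * (∑ i : Fin m, fun s : Fin m → E => G (s i)) s := by
      funext s; simp [hY]; ring
    rw [h1, variance_const_mul, variance_sum_pi (X := fun _ : Fin m => G) fun _ => hGL]
    have h2 : Var[G; μ] ≤ 1 := by
      refine (variance_le_expectation_sq hG.aestronglyMeasurable).trans ?_
      calc ∫ x, (G ^ 2) x ∂μ ≤ ∫ _x, (1 : ℝ) ∂μ := by
            refine integral_mono hGL.integrable_sq (integrable_const _) fun x => ?_
            simpa using (sq_le_one_iff_abs_le_one _).2 (hb x)
        _ = 1 := by simp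
    calc (1 / (m : ℝ)) ^ 2 * ∑ _i : Fin m, Var[G; μ] ≤ (1 / (m : ℝ)) ^ 2 * ∑ _i : Fin m, (1 : ℝ) := by
          gcongr
      _ = 1 / (m : ℝ) := by simp; field_simp
  have hD : Measurable fun s => |Y s - ∫ x, G x ∂μ| := by fun_prop
  have hDL : MemLp (fun s => |Y s - ∫ x, G x ∂μ|) 2 Q :=
    (hYL.sub (memLp_const _)).norm
  -- Jensen's inequality, in the form that the variance of |Y - E Y| is nonnegative.
  have h3 : (∫ s, |Y s - ∫ x, G x ∂μ| ∂Q) ^ 2 ≤ 1 / m := by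
    have h4 := variance_nonneg (fun s => |Y s - ∫ x, G x ∂μ|) Q
    rw [variance_eq_sub hDL] at h4
    rw [variance_eq_integral hYm.aemeasurable, hmean] at hvar
    have h5 : ∫ s, ((fun s => |Y s - ∫ x, G x ∂μ|) ^ 2) s ∂Q
        = ∫ s, (Y s - ∫ x, G x ∂μ) ^ 2 ∂Q := by
      simp
    linarith
  rw [← Real.sqrt_one, ← Real.sqrt_div zero_le_one]
  exact Real.le_sqrt_of_sq_le h3

/-! ### The posterior of the optimal value. -/

section Round

theorem abs_sub_le_two {x y : ℝ} (hx : |x| ≤ 1) (hy : |y| ≤ 1) : |x - y| ≤ 2 := by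
  rw [abs_le] at *
  constructor <;> linarith

theorem abs_mean_le_one {m : ℕ} (hm : 1 ≤ m) {x : Fin m → ℝ} (hx : ∀ i, |x i| ≤ 1) :
    |(∑ i, x i) / m| ≤ 1 := by
  have hm0 : (0 : ℝ) < m := by exact_mod_cast hm
  rw [abs_div, Nat.abs_cast, div_le_one hm0]
  calc |∑ i, x i| ≤ ∑ i, |x i| := Finset.abs_sum_le_sum_abs _ _
    _ ≤ ∑ _i : Fin m, (1 : ℝ) := Finset.sum_le_sum fun i _ => hx i
    _ = m := by simp

variable {Ω C A E : Type*} [MeasurableSpace Ω] [MeasurableSpace C] [MeasurableSpace A]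
  [MeasurableSpace E] {m : ℕ}

theorem IsBanditRun.measurable_hist {P : Measure Ω} {q : Measure E} {ν : Kernel (E × A) ℝ}
    {R : Run Ω C A E m} (hR : IsBanditRun P q ν R) (n : ℕ) : Measurable (R.hist n) := by
  refine Measurable.prodMk (f := fun ω => (R.hist n ω).1) (measurable_pi_lambda _ fun s => ?_)
    (hR.measurable_ctx n)
  exact (hR.measurable_ctx s).prodMk ((hR.measurable_act s).prodMk (hR.measurable_rew s))

variable [StandardBorelSpace E] [Nonempty E] {P : Measure Ω} [IsProbabilityMeasure P]
  {q : Measure E} {ν : Kernel (E × A) ℝ} {f : E → A → ℝ} {Θ : Set E} {avail : C → Set A}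
  {opt : ℕ → C → E → A} {muHat U : (n : ℕ) → Hist C A n → A → ℝ} {n₀ : ℕ} {R : Run Ω C A E m}

/-- The value of the best action, truncated to `[-1, 1]`. -/
noncomputable def optValue (f : E → A → ℝ) (opt : ℕ → C → E → A) (n : ℕ) (p : Hist C A n × E) : ℝ :=
  max (-1) (min 1 (f p.2 (opt n p.1.2 p.2)))

omit [MeasurableSpace C] [MeasurableSpace A] [MeasurableSpace E] [StandardBorelSpace E]
  [Nonempty E] in
theorem abs_optValue_le (n : ℕ) (p : Hist C A n × E) : |optValue f opt n p| ≤ 1 :=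
  abs_le.2 ⟨le_max_left _ _, max_le (by norm_num) (min_le_left _ _)⟩

omit [MeasurableSpace C] [MeasurableSpace A] [MeasurableSpace E] [StandardBorelSpace E]
  [Nonempty E] in
theorem optValue_eq (hb : ∀ θ ∈ Θ, ∀ a, |f θ a| ≤ 1) (n : ℕ) (h : Hist C A n) {θ : E}
    (hθ : θ ∈ Θ) : optValue f opt n (h, θ) = f θ (opt n h.2 θ) := by
  have := abs_le.1 (hb θ hθ (opt n h.2 θ))
  rw [optValue, min_eq_right this.2, max_eq_right this.1]

omit [StandardBorelSpace E] [Nonempty E] in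
theorem measurable_optArg (hf : Measurable (Function.uncurry f))
    (hopt : IsOptimal f Θ avail opt) (n : ℕ) :
    Measurable fun p : Hist C A n × E => f p.2 (opt n p.1.2 p.2) := by
  have h1 : Measurable fun p : Hist C A n × E => opt n p.1.2 p.2 :=
    (hopt.measurable n).comp ((measurable_snd.comp measurable_fst).prodMk measurable_snd)
  exact hf.comp (measurable_snd.prodMk h1)

omit [StandardBorelSpace E] [Nonempty E] in
theorem measurable_optValue (hf : Measurable (Function.uncurry f))
    (hopt : IsOptimal f Θ avail opt) (n : ℕ) :
    Measurable (optValue f opt n : Hist C A n × E → ℝ) :=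
  measurable_const.max (measurable_const.min (measurable_optArg hf hopt n))

theorem hasCondDistrib_posterior (hR : IsBanditRun P q ν R) (n : ℕ) :
    HasCondDistrib R.param (R.hist n) (condDistrib R.param (R.hist n) P) P where
  aemeasurable := ((hR.measurable_hist n).prodMk hR.measurable_param).aemeasurable
  map_eq := (compProd_map_condDistrib hR.measurable_param.aemeasurable).symm

/-- The posterior mean of the truncated value of the best action. -/
noncomputable def postMean (P : Measure Ω) [IsProbabilityMeasure P] (f : E → A → ℝ) (opt : ℕ → C → E → A)
    (R : Run Ω C A E m) (n : ℕ) (h : Hist C A n) : ℝ :=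
  ∫ θ, optValue f opt n (h, θ) ∂(condDistrib R.param (R.hist n) P h)

theorem measurable_postMean (hf : Measurable (Function.uncurry f))
    (hopt : IsOptimal f Θ avail opt) (n : ℕ) : Measurable (postMean P f opt R n) :=
  ((measurable_optValue hf hopt n).stronglyMeasurable.integral_kernel_prod_right').measurable

theorem abs_postMean_le (n : ℕ) (h : Hist C A n) : |postMean P f opt R n h| ≤ 1 := by
  have := norm_integral_le_of_norm_le_const
    (μ := condDistrib R.param (R.hist n) P h) (f := fun θ => optValue f opt n (h, θ)) (C := 1)
    (ae_of_all _ fun θ => abs_optValue_le n (h, θ))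
  simpa [postMean] using this

/-- Given the history every sample has the posterior law, and almost every posterior is carried by
Θ, where the truncation in `optValue` has no effect. Truncated values are bounded everywhere, which
makes later integrability questions trivial. -/
theorem fTilde_eq_ae (hf : Measurable (Function.uncurry f)) (hopt : IsOptimal f Θ avail opt)
    (hb : ∀ θ ∈ Θ, ∀ a, |f θ a| ≤ 1) (hR : IsBanditRun P q ν R)
    (hΘ : ∀ᵐ θ ∂(P.map R.param), θ ∈ Θ) (hTS : IsTSUCB P f avail opt muHat U n₀ R) (n : ℕ) :
    ∀ᵐ ω ∂P, fTilde f opt R n ω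
      = (∑ i, optValue f opt n (R.hist n ω, R.samp n ω i)) / m := by
  have hpost := ae_ae_of_hasCondDistrib (hasCondDistrib_posterior hR n) hΘ
  have key := ae_of_hasCondDistrib (hTS.law_samp n)
    (s := {p : (E × Hist C A n) × (Fin m → E) | ∀ i,
      optValue f opt n (p.1.2, p.2 i) = f (p.2 i) (opt n p.1.2.2 (p.2 i))}) ?_ ?_
  · filter_upwards [key] with ω hω
    rw [fTilde]
    congr 1
    exact Finset.sum_congr rfl fun i _ => (hω i).symm
  · rw [Set.ofPred_forall]
    refine MeasurableSet.iInter fun i => ?_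
    have h1 : Measurable fun p : (E × Hist C A n) × (Fin m → E) => (p.1.2, p.2 i) := by fun_prop
    exact measurableSet_eq_fun ((measurable_optValue hf hopt n).comp h1)
      ((measurable_optArg hf hopt n).comp h1)
  · filter_upwards [hpost] with ω hω
    rw [Kernel.prodMkLeft_apply, iidKernel_apply]
    have : ∀ i : Fin m, ∀ᵐ s ∂(Measure.pi fun _ : Fin m =>
        condDistrib R.param (R.hist n) P (R.hist n ω)), s i ∈ Θ := fun i =>
      (Measure.quasiMeasurePreserving_eval _ i).ae hω
    filter_upwards [ae_all_iff.2 this] with s hs i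
    exact optValue_eq hb n _ (hs i)

/-- Conditionally on the history the samples are i.i.d. with expectation `postMean`, so the bound
for a fixed measure applies under the kernel. -/
theorem integral_abs_sampleMean_sub_le (hm : 1 ≤ m) (hf : Measurable (Function.uncurry f))
    (hopt : IsOptimal f Θ avail opt) (hTS : IsTSUCB P f avail opt muHat U n₀ R)
    (hR : IsBanditRun P q ν R) (n : ℕ) :
    ∫ ω, |(∑ i, optValue f opt n (R.hist n ω, R.samp n ω i)) / m
      - postMean P f opt R n (R.hist n ω)| ∂P ≤ 1 / √m := by
  have hG := measurable_optValue hf hopt n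
  have hgb := measurable_postMean (P := P) (R := R) hf hopt n
  have hF : Measurable fun p : (E × Hist C A n) × (Fin m → E) =>
      |(∑ i, optValue f opt n (p.1.2, p.2 i)) / m - postMean P f opt R n p.1.2| := by
    have h1 : ∀ i, Measurable fun p : (E × Hist C A n) × (Fin m → E) =>
        optValue f opt n (p.1.2, p.2 i) := fun i => hG.comp (by fun_prop)
    have h2 : Measurable fun p : (E × Hist C A n) × (Fin m → E) =>
        postMean P f opt R n p.1.2 := hgb.comp (by fun_prop)
    exact (((Finset.measurable_sum _ fun i _ => h1 i).div_const _).sub h2).abs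
  have hbd : ∀ p : (E × Hist C A n) × (Fin m → E),
      ‖|(∑ i, optValue f opt n (p.1.2, p.2 i)) / m - postMean P f opt R n p.1.2|‖ ≤ 2 := by
    intro p
    rw [Real.norm_eq_abs, abs_abs]
    exact abs_sub_le_two (abs_mean_le_one hm fun i => abs_optValue_le _ _) (abs_postMean_le n _)
  have hmeas : Measurable fun ω => ((R.param ω, R.hist n ω), R.samp n ω) :=
    (hR.measurable_param.prodMk (hR.measurable_hist n)).prodMk (hR.measurable_samp n)
  have hi : Integrable (fun ω => |(∑ i, optValue f opt n (R.hist n ω, R.samp n ω i)) / m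
      - postMean P f opt R n (R.hist n ω)|) P :=
    Integrable.of_bound (hF.comp hmeas).aestronglyMeasurable 2 (ae_of_all _ fun ω =>
      hbd ((R.param ω, R.hist n ω), R.samp n ω))
  have h := integral_of_hasCondDistrib (hTS.law_samp n) hF hi
  have h' := integrable_integral_of_hasCondDistrib (hTS.law_samp n) hF hi
  have hle : ∀ ω, ∫ s, |(∑ i, optValue f opt n (R.hist n ω, s i)) / m
      - postMean P f opt R n (R.hist n ω)| ∂(iidKernel m (condDistrib R.param (R.hist n) P)
        (R.hist n ω)) ≤ 1 / √(m : ℝ) := fun ω =>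
    integral_abs_mean_sub_le (condDistrib R.param (R.hist n) P (R.hist n ω))
      (G := fun θ => optValue f opt n (R.hist n ω, θ))
      (hG.comp measurable_prodMk_left) (fun θ => abs_optValue_le _ _) hm
  simp only [Kernel.prodMkLeft_apply] at h h'
  rw [h]
  calc _ ≤ ∫ _ω, 1 / √(m : ℝ) ∂P := integral_mono h' (integrable_const _) hle
    _ = 1 / √m := by simp

/-- The true parameter is independent of the action given the history. -/
theorem integral_optValue_sub_postMean_mul (hf : Measurable (Function.uncurry f))
    (hopt : IsOptimal f Θ avail opt) (hTS : IsTSUCB P f avail opt muHat U n₀ R)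
    (hR : IsBanditRun P q ν R) (n : ℕ) {w : Hist C A n × A → ℝ} (hw : Measurable w)
    (hw1 : ∀ p, |w p| ≤ 1) :
    ∫ ω, (optValue f opt n (R.hist n ω, R.param ω) - postMean P f opt R n (R.hist n ω))
      * w (R.hist n ω, R.act n ω) ∂P = 0 := by
  obtain ⟨τ, hτ, hact⟩ := hTS.law_act n
  have hH := hR.measurable_hist n
  have hp := hR.measurable_param
  have hs := hR.measurable_samp n
  have ha := hR.measurable_act n
  set κ := condDistrib R.param (R.hist n) P
  set D : Hist C A n × E → ℝ := fun p => optValue f opt n p - postMean P f opt R n p.1 with hD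
  have hDm : Measurable D := (measurable_optValue hf hopt n).sub
    ((measurable_postMean hf hopt n).comp measurable_fst)
  have hDb : ∀ p, |D p| ≤ 2 := fun p => by
    have h1 := abs_optValue_le (f := f) (opt := opt) n p
    have h2 := abs_postMean_le (P := P) (f := f) (opt := opt) (R := R) n p.1
    exact abs_sub_le_two h1 h2
  have bound : ∀ (p : Hist C A n × E) (x : ℝ), |x| ≤ 1 → ‖D p * x‖ ≤ 2 := fun p x hx => by
    rw [Real.norm_eq_abs, abs_mul]
    calc |D p| * |x| ≤ 2 * 1 := by gcongr; exact hDb p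
      _ = 2 := by norm_num
  set u : Hist C A n × (Fin m → E) → ℝ := fun p => ∫ a, w (p.1, a) ∂(τ p) with hu
  have hum : Measurable u := by
    have : Measurable fun p : (Hist C A n × (Fin m → E)) × A => w (p.1.1, p.2) :=
      hw.comp (by fun_prop)
    exact (this.stronglyMeasurable.integral_kernel_prod_right').measurable
  have hu1 : ∀ p, |u p| ≤ 1 := fun p => by
    have := norm_integral_le_of_norm_le_const (μ := τ p) (f := fun a => w (p.1, a)) (C := 1)
      (ae_of_all _ fun a => hw1 _)
    simpa using this
  set v : Hist C A n → ℝ := fun h => ∫ s, u (h, s) ∂(iidKernel m κ h) with hv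
  have hvm : Measurable v := (hum.stronglyMeasurable.integral_kernel_prod_right').measurable
  have hv1 : ∀ h, |v h| ≤ 1 := fun h => by
    have := norm_integral_le_of_norm_le_const (μ := iidKernel m κ h) (f := fun s => u (h, s))
      (C := 1) (ae_of_all _ fun a => hu1 _)
    simpa using this
  -- The action, then the samples, then the parameter are integrated out. The kernels of the first
  -- two ignore the parameter, so `D` factors out; its posterior mean is zero.
  have e1 : ∫ ω, D (R.hist n ω, R.param ω) * w (R.hist n ω, R.act n ω) ∂P
      = ∫ ω, D (R.hist n ω, R.param ω) * u (R.hist n ω, R.samp n ω) ∂P := by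
    have hF : Measurable fun p : (E × Hist C A n × (Fin m → E)) × A =>
        D (p.1.2.1, p.1.1) * w (p.1.2.1, p.2) :=
      (hDm.comp (by fun_prop)).mul (hw.comp (by fun_prop))
    have hmeas : Measurable fun ω => ((R.param ω, R.hist n ω, R.samp n ω), R.act n ω) := by
      fun_prop
    rw [integral_of_hasCondDistrib hact hF (Integrable.of_bound
      (hF.comp hmeas).aestronglyMeasurable 2 (ae_of_all _ fun ω => bound _ _ (hw1 _)))]
    refine integral_congr_ae (ae_of_all _ fun ω => ?_)
    simp only [hu, Kernel.prodMkLeft_apply]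
    rw [integral_const_mul]
  have e2 : ∫ ω, D (R.hist n ω, R.param ω) * u (R.hist n ω, R.samp n ω) ∂P
      = ∫ ω, D (R.hist n ω, R.param ω) * v (R.hist n ω) ∂P := by
    have hF : Measurable fun p : (E × Hist C A n) × (Fin m → E) =>
        D (p.1.2, p.1.1) * u (p.1.2, p.2) :=
      (hDm.comp (by fun_prop)).mul (hum.comp (by fun_prop))
    have hmeas : Measurable fun ω => ((R.param ω, R.hist n ω), R.samp n ω) := by
      fun_prop
    rw [integral_of_hasCondDistrib (hTS.law_samp n) hF (Integrable.of_bound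
      (hF.comp hmeas).aestronglyMeasurable 2 (ae_of_all _ fun ω => bound _ _ (hu1 _)))]
    refine integral_congr_ae (ae_of_all _ fun ω => ?_)
    simp only [hv, Kernel.prodMkLeft_apply]
    rw [integral_const_mul]
  have e3 : ∫ ω, D (R.hist n ω, R.param ω) * v (R.hist n ω) ∂P = 0 := by
    have hF : Measurable fun p : Hist C A n × E => D p * v p.1 :=
      hDm.mul (hvm.comp measurable_fst)
    have hmeas : Measurable fun ω => (R.hist n ω, R.param ω) := by fun_prop
    have := integral_of_hasCondDistrib (hasCondDistrib_posterior hR n) hF (Integrable.of_bound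
      (hF.comp hmeas).aestronglyMeasurable 2 (ae_of_all _ fun ω => bound _ _ (hv1 _)))
    rw [this]
    refine integral_eq_zero_of_ae (ae_of_all _ fun ω => ?_)
    simp only [Pi.zero_apply]
    rw [integral_mul_const]
    have hz : ∫ θ, D (R.hist n ω, θ) ∂(κ (R.hist n ω)) = 0 := by
      simp only [hD]
      rw [integral_sub, integral_const]
      · simp [postMean, κ]
      · exact Integrable.of_bound ((measurable_optValue hf hopt n).comp
          measurable_prodMk_left).aestronglyMeasurable 1 (ae_of_all _ fun θ => abs_optValue_le _ _)
      · exact integrable_const _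
    rw [hz, zero_mul]
  exact e1.trans (e2.trans e3)

end Round

/-! ### The regret of a single round. -/

section Round

variable {Ω C A E : Type*} [MeasurableSpace Ω] [MeasurableSpace C] [MeasurableSpace A]
  [MeasurableSpace E] {m : ℕ}
  [StandardBorelSpace E] [Nonempty E] {P : Measure Ω} [IsProbabilityMeasure P]
  {q : Measure E} {ν : Kernel (E × A) ℝ} {f : E → A → ℝ} {Θ : Set E} {avail : C → Set A}
  {opt : ℕ → C → E → A} {muHat U : (n : ℕ) → Hist C A n → A → ℝ} {n₀ : ℕ} {R : Run Ω C A E m}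

/-- The numerical core of the analysis of TS-UCB: `F` is the sampled value, `G` its posterior mean,
`rad` and `mu` are the radius and the estimate of the action played, `x` is the posterior mean of
the excess. -/
theorem sampled_sub_estimate_le {F G mu rad rmin rmax x : ℝ} (hrmin : 0 < rmin)
    (hrad : rad ∈ Set.Icc rmin rmax) (hrad1 : rad ≤ 1) (hx : 0 ≤ x)
    (h : rad < F - mu → ((F - mu) / rad - 1) * rmin ≤ F - G + rmax * x) :
    F - mu ≤ rad + rmax / rmin * (|F - G| + x) := by
  have hr : 0 < rad := hrmin.trans_le hrad.1
  have hmax : 0 < rmax := hr.trans_le hrad.2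
  by_cases hc : rad < F - mu
  · have h1 := h hc
    have h2 : F - mu - rad = ((F - mu) / rad - 1) * rmin * (rad / rmin) := by
      field_simp
    have h3 : ((F - mu) / rad - 1) * rmin * (rad / rmin) ≤ (|F - G| + rmax * x) * (rad / rmin) := by
      have := le_abs_self (F - G)
      gcongr
      linarith
    -- The two summands use different bounds on the radius: `rad ≤ rmax` for the sampling error,
    -- `rad ≤ 1` for the excess.
    have h4 : (|F - G| + rmax * x) * (rad / rmin) ≤ rmax / rmin * (|F - G| + x) := by
      have e : (|F - G| + rmax * x) * (rad / rmin) = |F - G| * rad / rmin + rmax * x * rad / rmin := by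
        ring
      have e' : rmax / rmin * (|F - G| + x) = |F - G| * rmax / rmin + rmax * x * 1 / rmin := by ring
      rw [e, e']
      have := hrad.2
      gcongr
    linarith
  · have : 0 ≤ rmax / rmin * (|F - G| + x) := by positivity
    linarith

/-- The estimates are abstracted to a nonnegative function `exc` by which all confidence intervals
must be inflated. Its conditional expectation `ex` comes from the comparison of ratios under the
posterior; `exc` itself comes from the deviation at the action played. -/
theorem integral_regret_le (hm : 1 ≤ m) {rmin rmax : ℝ} (hrmin : 0 < rmin) (hr : rmin ≤ rmax)
    (hf : Measurable (Function.uncurry f)) (hopt : IsOptimal f Θ avail opt)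
    (hb : ∀ θ ∈ Θ, ∀ a, |f θ a| ≤ 1) (hR : IsBanditRun P q ν R)
    (hΘ : ∀ᵐ θ ∂(P.map R.param), θ ∈ Θ) (hTS : IsTSUCB P f avail opt muHat U n₀ R) {n : ℕ}
    (hn : n₀ ≤ n) (hradm : Measurable fun p : Hist C A n × A => radius muHat U p.1 p.2)
    (hrad : ∀ᵐ ω ∂P, ∀ a, radius muHat U (R.hist n ω) a ∈ Set.Icc rmin rmax)
    {exc : Hist C A n × E → ℝ} (hexcm : Measurable exc) (hexc0 : ∀ p, 0 ≤ exc p)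
    (hexci : Integrable (fun ω => exc (R.hist n ω, R.param ω)) P)
    (hexc : ∀ h, ∀ θ ∈ Θ, (∀ a, radius muHat U h a ∈ Set.Icc rmin rmax) →
      ∀ a, |f θ a - muHat n h a| ≤ (1 + exc (h, θ)) * radius muHat U h a) :
    ∫ ω, (f (R.param ω) (opt n (R.ctx n ω) (R.param ω)) - f (R.param ω) (R.act n ω)) ∂P
      ≤ 2 * ∫ ω, radius muHat U (R.hist n ω) (R.act n ω) ∂P
        + (1 + rmax / rmin) * (1 / √m + ∫ ω, exc (R.hist n ω, R.param ω) ∂P) := by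
  have hH := hR.measurable_hist n
  have hp := hR.measurable_param
  have hs := hR.measurable_samp n
  have ha := hR.measurable_act n
  have hG := measurable_optValue hf hopt n
  have hgm := measurable_postMean (P := P) (R := R) hf hopt n
  have hpost := hasCondDistrib_posterior hR n
  set κ := condDistrib R.param (R.hist n) P with hκ
  set F : Ω → ℝ := fun ω => (∑ i, optValue f opt n (R.hist n ω, R.samp n ω i)) / m with hF
  set G : Ω → ℝ := fun ω => postMean P f opt R n (R.hist n ω) with hGdef
  set rad : Ω → ℝ := fun ω => radius muHat U (R.hist n ω) (R.act n ω) with hraddef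
  set ex : Ω → ℝ := fun ω => ∫ θ, exc (R.hist n ω, θ) ∂(κ (R.hist n ω)) with hex
  -- The decomposition is used only where the radius is at most 1. This restriction depends on
  -- history and action alone, so the centred term keeps mean zero.
  set w : Hist C A n × A → ℝ := fun p => if radius muHat U p.1 p.2 ≤ 1 then 1 else 0 with hw
  have hwm : Measurable w :=
    Measurable.ite (measurableSet_le hradm measurable_const) measurable_const measurable_const
  have hw1 : ∀ p, |w p| ≤ 1 := fun p => by
    simp only [hw]; split_ifs <;> simp
  have hFm : Measurable F := by
    have h1 : ∀ i, Measurable fun ω => optValue f opt n (R.hist n ω, R.samp n ω i) :=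
      fun i => hG.comp (hH.prodMk ((measurable_pi_apply i).comp hs))
    exact (Finset.measurable_sum _ fun i _ => h1 i).div_const _
  have hF1 : ∀ ω, |F ω| ≤ 1 := fun ω => abs_mean_le_one hm fun i => abs_optValue_le _ _
  have hGm : Measurable G := hgm.comp hH
  have hG1 : ∀ ω, |G ω| ≤ 1 := fun ω => abs_postMean_le n _
  have hradM : Measurable rad := hradm.comp (hH.prodMk ha)
  have hradI : Integrable rad P := by
    refine Integrable.of_bound hradM.aestronglyMeasurable rmax ?_
    filter_upwards [hrad] with ω hω
    rw [Real.norm_eq_abs, abs_of_pos (hrmin.trans_le (hω _).1)]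
    exact (hω _).2
  have hFGI : Integrable (fun ω => |F ω - G ω|) P :=
    Integrable.of_bound (hFm.sub hGm).abs.aestronglyMeasurable 2 (ae_of_all _ fun ω => by
      rw [Real.norm_eq_abs, abs_abs]
      exact abs_sub_le_two (hF1 ω) (hG1 ω))
  have hexI : Integrable ex P := integrable_integral_of_hasCondDistrib hpost hexcm hexci
  have hexE : ∫ ω, exc (R.hist n ω, R.param ω) ∂P = ∫ ω, ex ω ∂P :=
    integral_of_hasCondDistrib hpost hexcm hexci
  have hparam : ∀ᵐ ω ∂P, R.param ω ∈ Θ := ae_of_ae_map hp.aemeasurable hΘ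
  set D : Ω → ℝ := fun ω => (optValue f opt n (R.hist n ω, R.param ω) - G ω)
    * w (R.hist n ω, R.act n ω) with hD
  have hDI : Integrable D P := by
    refine Integrable.of_bound (((hG.comp (hH.prodMk hp)).sub hGm).mul
      (hwm.comp (hH.prodMk ha))).aestronglyMeasurable 2 (ae_of_all _ fun ω => ?_)
    rw [Real.norm_eq_abs, abs_mul]
    calc _ ≤ (2 : ℝ) * 1 := by
          gcongr
          · exact abs_sub_le_two (abs_optValue_le _ _) (hG1 ω)
          · exact hw1 _
      _ = 2 := by norm_num
  have hD0 : ∫ ω, D ω ∂P = 0 := integral_optValue_sub_postMean_mul hf hopt hTS hR n hwm hw1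
  have hpt : ∀ᵐ ω ∂P,
      f (R.param ω) (opt n (R.ctx n ω) (R.param ω)) - f (R.param ω) (R.act n ω)
        ≤ D ω + (1 + rmax / rmin) * |F ω - G ω| + 2 * rad ω + rmax / rmin * ex ω
          + exc (R.hist n ω, R.param ω) := by
    filter_upwards [hrad, hparam, hTS.argmin n hn, fTilde_eq_ae hf hopt hb hR hΘ hTS n,
      ae_ae_of_hasCondDistrib hpost hΘ, ae_integrable_of_hasCondDistrib hpost hexcm hexci]
      with ω h1 h2 h3 h4 h5 h6
    have hρ : 0 < rmax / rmin := div_pos (hrmin.trans_le hr) hrmin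
    have hex0 : 0 ≤ ex ω := integral_nonneg fun θ => hexc0 _
    have hr0 : 0 < rad ω := hrmin.trans_le (h1 _).1
    have hv : optValue f opt n (R.hist n ω, R.param ω)
      = f (R.param ω) (opt n (R.ctx n ω) (R.param ω)) := optValue_eq hb n _ h2
    by_cases hrad1 : rad ω ≤ 1
    · have hw' : w (R.hist n ω, R.act n ω) = 1 := if_pos hrad1
      have key := sampled_sub_estimate_le (F := F ω) (G := G ω)
        (mu := muHat n (R.hist n ω) (R.act n ω)) (x := ex ω) hrmin (h1 (R.act n ω)) hrad1 hex0 ?_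
      · have h7 := (abs_le.1 (hexc _ _ h2 h1 (R.act n ω))).1
        have h8 : (1 + exc (R.hist n ω, R.param ω)) * rad ω
            ≤ rad ω + exc (R.hist n ω, R.param ω) := by
          have := mul_le_mul_of_nonneg_left hrad1 (hexc0 (R.hist n ω, R.param ω))
          linarith
        have h9 := neg_abs_le (F ω - G ω)
        simp only [hD, hw', hv]
        change -((1 + exc (R.hist n ω, R.param ω)) * rad ω) ≤ _ at h7
        change _ ≤ rad ω + _ at key
        linarith
      · intro hc
        set Ψ := (F ω - muHat n (R.hist n ω) (R.act n ω)) / radius muHat U (R.hist n ω) (R.act n ω)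
          with hΨ
        have hΨ1 : 0 ≤ Ψ - 1 := by
          rw [hΨ, sub_nonneg, le_div_iff₀ (hrmin.trans_le (h1 _).1)]
          linarith
        -- The argmin property is tested against the best action of a parameter drawn from the
        -- posterior; `0 ≤ Ψ - 1` allows the radius of that action to be replaced by `rmin`.
        have hae : ∀ᵐ θ ∂(κ (R.hist n ω)), (Ψ - 1) * rmin
            ≤ F ω - optValue f opt n (R.hist n ω, θ) + rmax * exc (R.hist n ω, θ) := by
          filter_upwards [h5] with θ hθ
          have hmem := hopt.mem n (R.ctx n ω) θ hθ
          have h7 := h3.2 _ hmem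
          rw [h4] at h7
          set a := opt n (R.ctx n ω) θ
          have h8 := (abs_le.1 (hexc _ _ hθ h1 a)).2
          have h9 : optValue f opt n (R.hist n ω, θ) = f θ a := optValue_eq hb n _ hθ
          have ha0 := hrmin.trans_le (h1 a).1
          change Ψ ≤ (F ω - muHat n (R.hist n ω) a) / radius muHat U (R.hist n ω) a at h7
          rw [le_div_iff₀ ha0] at h7
          rw [h9]
          have h10 : (Ψ - 1) * rmin ≤ (Ψ - 1) * radius muHat U (R.hist n ω) a :=
            mul_le_mul_of_nonneg_left (h1 a).1 hΨ1
          have h11 := mul_le_mul_of_nonneg_left (h1 a).2 (hexc0 (R.hist n ω, θ))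
          linarith
        have hi0 : Integrable (fun θ => optValue f opt n (R.hist n ω, θ)) (κ (R.hist n ω)) :=
          Integrable.of_bound (hG.comp measurable_prodMk_left).aestronglyMeasurable 1
            (ae_of_all _ fun θ => abs_optValue_le _ _)
        have hi1 : Integrable (fun θ => F ω - optValue f opt n (R.hist n ω, θ))
            (κ (R.hist n ω)) :=
          (integrable_const _).sub hi0
        have hi2 : Integrable (fun θ => rmax * exc (R.hist n ω, θ)) (κ (R.hist n ω)) :=
          h6.const_mul _
        have := integral_mono_ae (integrable_const _) (hi1.add hi2) hae
        rw [integral_const] at this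
        simp only [probReal_univ, one_smul] at this
        refine this.trans_eq ?_
        change ∫ θ, ((F ω - optValue f opt n (R.hist n ω, θ)) + rmax * exc (R.hist n ω, θ))
          ∂(κ (R.hist n ω)) = _
        rw [integral_add hi1 hi2, integral_const_mul, integral_sub (integrable_const _) hi0,
          integral_const]
        simp only [probReal_univ, one_smul]
        rfl
    -- With radius above 1, the trivial bound 2 on the regret is below twice the radius.
    · have hw' : w (R.hist n ω, R.act n ω) = 0 := if_neg hrad1
      simp only [hD, hw', mul_zero]
      have h7 := (abs_le.1 (hb _ h2 (opt n (R.ctx n ω) (R.param ω)))).2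
      have h8 := (abs_le.1 (hb _ h2 (R.act n ω))).1
      have h9 : 0 ≤ (1 + rmax / rmin) * |F ω - G ω| := by positivity
      have h10 : 0 ≤ rmax / rmin * ex ω := by positivity
      have h11 := hexc0 (R.hist n ω, R.param ω)
      push Not at hrad1
      linarith
  have hregI : Integrable (fun ω => f (R.param ω) (opt n (R.ctx n ω) (R.param ω))
      - f (R.param ω) (R.act n ω)) P := by
    have m1 : Measurable fun ω => f (R.param ω) (opt n (R.ctx n ω) (R.param ω)) :=
      (measurable_optArg hf hopt n).comp (hH.prodMk hp)
    have m2 : Measurable fun ω => f (R.param ω) (R.act n ω) := hf.comp (hp.prodMk ha)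
    refine Integrable.of_bound (m1.sub m2).aestronglyMeasurable 2 ?_
    filter_upwards [hparam] with ω hω
    exact abs_sub_le_two (hb _ hω _) (hb _ hω _)
  have hFG := integral_abs_sampleMean_sub_le hm hf hopt hTS hR n
  have hi12 : Integrable (fun ω => D ω + (1 + rmax / rmin) * |F ω - G ω|) P := hDI.add (hFGI.const_mul (1 + rmax / rmin))
  have hi123 : Integrable (fun ω => D ω + (1 + rmax / rmin) * |F ω - G ω| + 2 * rad ω) P :=
    hi12.add (hradI.const_mul 2)
  have hi1234 : Integrable (fun ω => D ω + (1 + rmax / rmin) * |F ω - G ω| + 2 * rad ω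
      + rmax / rmin * ex ω) P := hi123.add (hexI.const_mul (rmax / rmin))
  have hfin := integral_mono_ae hregI (hi1234.add hexci) hpt
  have e : ∫ ω, (D ω + (1 + rmax / rmin) * |F ω - G ω| + 2 * rad ω + rmax / rmin * ex ω
          + exc (R.hist n ω, R.param ω)) ∂P = ∫ ω, D ω ∂P + (1 + rmax / rmin) * ∫ ω, |F ω - G ω| ∂P
      + 2 * ∫ ω, rad ω ∂P + rmax / rmin * ∫ ω, ex ω ∂P
      + ∫ ω, exc (R.hist n ω, R.param ω) ∂P := by
    rw [← integral_const_mul, ← integral_const_mul, ← integral_const_mul,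
      ← integral_add hDI (hFGI.const_mul (1 + rmax / rmin)),
      ← integral_add hi12 (hradI.const_mul 2),
      ← integral_add hi123 (hexI.const_mul (rmax / rmin)), ← integral_add hi1234 hexci]
  refine hfin.trans ((le_of_eq e).trans ?_)
  rw [hD0, ← hexE]
  have hρ : 0 < rmax / rmin := div_pos (hrmin.trans_le hr) hrmin
  have hm' : (1 + rmax / rmin) * ∫ ω, |F ω - G ω| ∂P ≤ (1 + rmax / rmin) * (1 / √m) :=
    mul_le_mul_of_nonneg_left hFG (by positivity)
  linarith

end Round

/-! ### Exponential moments as extended nonnegative integrals. -/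

theorem lintegral_exp_mul_le {μ : Measure ℝ} {X : ℝ → ℝ} {c : ℝ≥0}
    (h : HasSubgaussianMGF X c μ) (t : ℝ) :
    ∫⁻ y, ENNReal.ofReal (Real.exp (t * X y)) ∂μ ≤ ENNReal.ofReal (Real.exp (c * t ^ 2 / 2)) := by
  rw [← ofReal_integral_eq_lintegral_ofReal (h.integrable_exp_mul t)
    (ae_of_all _ fun _ => (Real.exp_pos _).le)]
  exact ENNReal.ofReal_le_ofReal (h.mgf_le t)

theorem integrable_and_integral_le_of_lintegral_le {Ω : Type*} [MeasurableSpace Ω]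
    {P : Measure Ω} {X : Ω → ℝ} (hX : Measurable X) (h0 : ∀ ω, 0 ≤ X ω) {c : ℝ} (hc : 0 ≤ c)
    (h : ∫⁻ ω, ENNReal.ofReal (X ω) ∂P ≤ ENNReal.ofReal c) :
    Integrable X P ∧ ∫ ω, X ω ∂P ≤ c := by
  have hi : Integrable X P := by
    refine ⟨hX.aestronglyMeasurable, ?_⟩
    rw [hasFiniteIntegral_iff_ofReal (ae_of_all _ h0)]
    exact h.trans_lt ENNReal.ofReal_lt_top
  refine ⟨hi, ?_⟩
  rw [← ofReal_integral_eq_lintegral_ofReal hi (ae_of_all _ h0)] at h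
  exact (ENNReal.ofReal_le_ofReal_iff hc).1 h

/-! ### The Hoeffding supermartingale of an arm. -/

section KArmed

variable {K : ℕ} {n : ℕ}

/-- The accumulated deviation of the rewards of arm `a` from their mean. -/
def armDev (h : Hist Unit (Fin K) n) (θ : Fin K → ℝ) (a : Fin K) : ℝ :=
  ∑ s : Fin n, if (h.1 s).2.1 = a then (h.1 s).2.2 - θ a else 0

theorem playCount_cast (h : Hist Unit (Fin K) n) (a : Fin K) :
    (playCount h a : ℝ) = ∑ s : Fin n, if (h.1 s).2.1 = a then (1 : ℝ) else 0 := by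
  simp [playCount]

theorem playCount_le (h : Hist Unit (Fin K) n) (a : Fin K) : playCount h a ≤ n := by
  refine (Finset.card_filter_le _ _).trans ?_
  simp

theorem measurable_action_eq (s : Fin n) (a : Fin K) :
    MeasurableSet {h : Hist Unit (Fin K) n | (h.1 s).2.1 = a} :=
  measurableSet_eq_fun (by fun_prop) measurable_const

theorem measurable_playCount (a : Fin K) :
    Measurable fun h : Hist Unit (Fin K) n => (playCount h a : ℝ) := by
  simp_rw [playCount_cast]
  exact Finset.measurable_sum _ fun s _ =>
    Measurable.ite (measurable_action_eq s a) measurable_const measurable_const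

theorem measurable_armDev (a : Fin K) :
    Measurable fun p : Hist Unit (Fin K) n × (Fin K → ℝ) => armDev p.1 p.2 a :=
  Finset.measurable_sum _ fun s _ =>
    Measurable.ite (measurable_fst (measurable_action_eq s a)) (by fun_prop) measurable_const

theorem measurable_armMuHat (a : Fin K) :
    Measurable fun h : Hist Unit (Fin K) n => armMuHat n h a := by
  refine Measurable.div (Finset.measurable_sum _ fun s _ => ?_) (measurable_playCount a)
  exact Measurable.ite (measurable_action_eq s a) (by fun_prop) measurable_const

theorem armDev_eq (h : Hist Unit (Fin K) n) (θ : Fin K → ℝ) (a : Fin K)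
    (hN : playCount h a ≠ 0) :
    armDev h θ a = playCount h a * (armMuHat n h a - θ a) := by
  have hN' : (playCount h a : ℝ) ≠ 0 := by exact_mod_cast hN
  rw [armMuHat, mul_sub, mul_div_cancel₀ _ hN', playCount_cast, Finset.sum_mul, armDev,
    ← Finset.sum_sub_distrib]
  refine Finset.sum_congr rfl fun s _ => ?_
  split_ifs <;> simp

variable {Ω : Type*} [MeasurableSpace Ω] {m : ℕ} {P : Measure Ω} [IsProbabilityMeasure P]
  {q : Measure (Fin K → ℝ)} {ν : Kernel ((Fin K → ℝ) × Fin K) ℝ} [IsMarkovKernel ν]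
  {R : Run Ω Unit (Fin K) (Fin K → ℝ) m}

omit [MeasurableSpace Ω] in
theorem armDev_succ (ω : Ω) (θ : Fin K → ℝ) (a : Fin K) :
    armDev (R.hist (n + 1) ω) θ a = armDev (R.hist n ω) θ a
      + if R.act n ω = a then R.rew n ω - θ a else 0 := by
  rw [armDev, Fin.sum_univ_castSucc]; rfl

omit [MeasurableSpace Ω] in
theorem playCount_succ (ω : Ω) (a : Fin K) :
    (playCount (R.hist (n + 1) ω) a : ℝ) = playCount (R.hist n ω) a
      + if R.act n ω = a then (1 : ℝ) else 0 := by
  rw [playCount_cast, playCount_cast, Fin.sum_univ_castSucc]; rfl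

theorem measurable_exp_armDev_step (a : Fin K) (t : ℝ) :
    Measurable fun p : (Hist Unit (Fin K) n × (Fin K → ℝ) × Fin K) × ℝ =>
      Real.exp (t * (armDev p.1.1 p.1.2.1 a + if p.1.2.2 = a then p.2 - p.1.2.1 a else 0)
        - t ^ 2 / 8 * (playCount p.1.1 a + if p.1.2.2 = a then (1 : ℝ) else 0)) := by
  have m1 : Measurable fun p : (Hist Unit (Fin K) n × (Fin K → ℝ) × Fin K) × ℝ => p.1.1 :=
    measurable_fst.comp measurable_fst
  have m2 : Measurable fun p : (Hist Unit (Fin K) n × (Fin K → ℝ) × Fin K) × ℝ => p.1.2.1 :=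
    measurable_fst.comp (measurable_snd.comp measurable_fst)
  have m3 : Measurable fun p : (Hist Unit (Fin K) n × (Fin K → ℝ) × Fin K) × ℝ => p.1.2.2 :=
    measurable_snd.comp (measurable_snd.comp measurable_fst)
  have h1 : Measurable fun p : (Hist Unit (Fin K) n × (Fin K → ℝ) × Fin K) × ℝ =>
      armDev p.1.1 p.1.2.1 a := (measurable_armDev a).comp (m1.prodMk m2)
  have h2 : Measurable fun p : (Hist Unit (Fin K) n × (Fin K → ℝ) × Fin K) × ℝ =>
      (playCount p.1.1 a : ℝ) := (measurable_playCount a).comp m1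
  have h3 : MeasurableSet {p : (Hist Unit (Fin K) n × (Fin K → ℝ) × Fin K) × ℝ |
      p.1.2.2 = a} := m3 (measurableSet_singleton a)
  have h4 : Measurable fun p : (Hist Unit (Fin K) n × (Fin K → ℝ) × Fin K) × ℝ =>
      if p.1.2.2 = a then p.2 - p.1.2.1 a else 0 :=
    Measurable.ite h3 (measurable_snd.sub ((measurable_pi_apply a).comp m2)) measurable_const
  have h5 : Measurable fun p : (Hist Unit (Fin K) n × (Fin K → ℝ) × Fin K) × ℝ =>
      if p.1.2.2 = a then (1 : ℝ) else 0 :=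
    Measurable.ite h3 measurable_const measurable_const
  exact Real.measurable_exp.comp (((h1.add h4).const_mul t).sub ((h2.add h5).const_mul _))

/-- By Hoeffding's lemma a reward in [0, 1] has variance proxy 1/4, so a play of `a` multiplies the
exponential by a factor of conditional mean at most 1; a play of another arm leaves it unchanged. -/
theorem lintegral_exp_armDev_le (hR : IsBanditRun P q ν R)
    (hΘ : ∀ᵐ ω ∂P, ∀ a, R.param ω a ∈ Set.Icc (0 : ℝ) 1)
    (hν : ∀ θ : Fin K → ℝ, (∀ a, θ a ∈ Set.Icc (0 : ℝ) 1) → ∀ a,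
        (∀ᵐ y ∂(ν (θ, a)), y ∈ Set.Icc (0 : ℝ) 1) ∧ ∫ y, y ∂(ν (θ, a)) = θ a)
    (a : Fin K) (t : ℝ) (n : ℕ) :
    ∫⁻ ω, ENNReal.ofReal (Real.exp (t * armDev (R.hist n ω) (R.param ω) a
      - t ^ 2 / 8 * playCount (R.hist n ω) a)) ∂P ≤ 1 := by
  induction n with
  | zero => simp [armDev, playCount]
  | succ n ih =>
    refine le_trans ?_ ih
    set F : (Hist Unit (Fin K) n × (Fin K → ℝ) × Fin K) × ℝ → ENNReal := fun p =>
      ENNReal.ofReal (Real.exp (t * (armDev p.1.1 p.1.2.1 a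
        + if p.1.2.2 = a then p.2 - p.1.2.1 a else 0)
      - t ^ 2 / 8 * (playCount p.1.1 a + if p.1.2.2 = a then (1 : ℝ) else 0))) with hF
    have hFm : Measurable F := (measurable_exp_armDev_step a t).ennreal_ofReal
    have e := lintegral_of_hasCondDistrib (hR.law_rew n) hFm
    have e' : ∫⁻ ω, ENNReal.ofReal (Real.exp (t * armDev (R.hist (n + 1) ω) (R.param ω) a
      - t ^ 2 / 8 * playCount (R.hist (n + 1) ω) a)) ∂P
        = ∫⁻ ω, F ((R.hist n ω, R.param ω, R.act n ω), R.rew n ω) ∂P := by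
      refine lintegral_congr fun ω => ?_
      rw [armDev_succ, playCount_succ]
    rw [e', e]
    refine lintegral_mono_ae ?_
    filter_upwards [hΘ] with ω hω
    rw [Kernel.prodMkLeft_apply]
    simp only [hF]
    by_cases hc : R.act n ω = a
    · simp only [hc, if_true]
      have hb := hν _ hω a
      have hs := hasSubgaussianMGF_of_mem_Icc (X := fun y : ℝ => y) (μ := ν (R.param ω, a))
        aemeasurable_id hb.1
      have := lintegral_exp_mul_le hs t
      rw [hb.2] at this
      have hsplit : ∀ y : ℝ, ENNReal.ofReal (Real.exp (t * (armDev (R.hist n ω) (R.param ω) a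
            + (y - R.param ω a)) - t ^ 2 / 8 * (playCount (R.hist n ω) a + 1)))
          = ENNReal.ofReal (Real.exp (t * armDev (R.hist n ω) (R.param ω) a
            - t ^ 2 / 8 * playCount (R.hist n ω) a)) * ENNReal.ofReal (Real.exp (-(t ^ 2 / 8)))
            * ENNReal.ofReal (Real.exp (t * (y - R.param ω a))) := fun y => by
        rw [← ENNReal.ofReal_mul (Real.exp_pos _).le, ← ENNReal.ofReal_mul (by positivity),
          ← Real.exp_add, ← Real.exp_add]
        congr 2
        ring
      simp_rw [hsplit]
      rw [lintegral_const_mul _ (by fun_prop), mul_assoc]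
      refine mul_le_of_le_one_right' ?_
      refine (mul_le_mul_right this _).trans ?_
      rw [← ENNReal.ofReal_mul (Real.exp_pos _).le, ← Real.exp_add]
      refine ENNReal.ofReal_le_one.2 (Real.exp_le_one_iff.2 (le_of_eq ?_))
      simp
      ring
    · simp only [hc, if_false, add_zero]
      simp

end KArmed

/-! ### The expected excess of the arms. -/

section KArmed

variable {K : ℕ} {n : ℕ}

theorem radius_arm (T : ℕ) (h : Hist Unit (Fin K) n) (a : Fin K) :
    radius armMuHat (armU T) h a = √(3 * Real.log T / (playCount h a : ℝ)) :=
  add_sub_cancel_left _ _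

theorem measurable_radius_arm (T : ℕ) :
    Measurable fun p : Hist Unit (Fin K) n × Fin K => radius armMuHat (armU T) p.1 p.2 := by
  refine measurable_from_prod_countable_left fun a => ?_
  simp_rw [radius_arm]
  exact (measurable_const.div (measurable_playCount a)).sqrt

/-- The relative amount by which the mean rewards leave the confidence intervals. -/
noncomputable def armExcess (T : ℕ) (p : Hist Unit (Fin K) n × (Fin K → ℝ)) : ℝ :=
  ∑ a, max 0 (|p.2 a - armMuHat n p.1 a| / radius armMuHat (armU T) p.1 a - 1)

theorem armExcess_nonneg (T : ℕ) (p : Hist Unit (Fin K) n × (Fin K → ℝ)) : 0 ≤ armExcess T p :=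
  Finset.sum_nonneg fun _ _ => le_max_left _ _

theorem measurable_armExcess (T : ℕ) :
    Measurable (armExcess T : Hist Unit (Fin K) n × (Fin K → ℝ) → ℝ) := by
  refine Finset.measurable_sum _ fun a _ => measurable_const.max (Measurable.sub ?_ measurable_const)
  have h1 : Measurable fun p : Hist Unit (Fin K) n × (Fin K → ℝ) =>
      radius armMuHat (armU T) p.1 a := by
    simp_rw [radius_arm]
    exact (measurable_const.div ((measurable_playCount a).comp measurable_fst)).sqrt
  have h2 : Measurable fun p : Hist Unit (Fin K) n × (Fin K → ℝ) => p.2 a :=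
    (measurable_pi_apply a).comp measurable_snd
  exact (h2.sub ((measurable_armMuHat a).comp measurable_fst)).abs.div h1

theorem abs_sub_armMuHat_le (T : ℕ) (h : Hist Unit (Fin K) n) (θ : Fin K → ℝ) (a : Fin K)
    (hr : 0 < radius armMuHat (armU T) h a) :
    |θ a - armMuHat n h a| ≤ (1 + armExcess T (h, θ)) * radius armMuHat (armU T) h a := by
  have h1 : |θ a - armMuHat n h a| / radius armMuHat (armU T) h a - 1 ≤ armExcess T (h, θ) :=
    (le_max_right _ _).trans (Finset.single_le_sum
      (f := fun a => max 0 (|θ a - armMuHat n h a| / radius armMuHat (armU T) h a - 1))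
      (fun _ _ => le_max_left _ _) (Finset.mem_univ a))
  rw [← div_le_iff₀ hr]
  linarith

/-- Let ρ be the radius, so k ρ² = 3 log T, and write |x| = ρ(1 + y). With slope 4ρ the exponent for
|x| is 12 y log T + 6 log T, and z ≤ exp z at z = 12 y log T gives the bound. The two exponentials
take care of the sign of x. -/
theorem excess_le_exp {T k : ℕ} (hT : 2 ≤ T) (hk : 1 ≤ k) {x : ℝ} :
    max 0 (|x| / √(3 * Real.log T / k) - 1) ≤ Real.exp (-(6 * Real.log T)) / (12 * Real.log T) *
      (Real.exp (4 * √(3 * Real.log T / k) * (k * x) - (4 * √(3 * Real.log T / k)) ^ 2 / 8 * k)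
      + Real.exp (-(4 * √(3 * Real.log T / k)) * (k * x)
        - (-(4 * √(3 * Real.log T / k))) ^ 2 / 8 * k)) := by
  have hl : 0 < Real.log T := Real.log_pos (by exact_mod_cast hT)
  have hk0 : (0 : ℝ) < k := by exact_mod_cast hk
  set ρ := √(3 * Real.log T / k) with hρ
  have hρ0 : 0 < ρ := Real.sqrt_pos.2 (by positivity)
  have hρ2 : ρ ^ 2 * k = 3 * Real.log T := by
    rw [hρ, Real.sq_sqrt (by positivity)]
    field_simp
  refine max_le (by positivity) ?_
  set y := |x| / ρ - 1 with hy
  have hxy : |x| = ρ * (1 + y) := by rw [hy]; field_simp; ring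
  have h1 : 12 * Real.log T * y ≤ Real.exp (12 * Real.log T * y) := by
    have := Real.add_one_le_exp (12 * Real.log T * y)
    linarith
  have h2 : Real.exp (12 * Real.log T * y) = Real.exp (-(6 * Real.log T))
      * Real.exp (4 * ρ * (k * |x|) - (4 * ρ) ^ 2 / 8 * k) := by
    rw [← Real.exp_add]
    congr 1
    have e1 : 4 * ρ * (k * |x|) = 4 * (ρ ^ 2 * k) * (1 + y) := by rw [hxy]; ring
    have e2 : (4 * ρ) ^ 2 / 8 * k = 2 * (ρ ^ 2 * k) := by ring
    rw [e1, e2, hρ2]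
    ring
  have h3 : Real.exp (4 * ρ * (k * |x|) - (4 * ρ) ^ 2 / 8 * k)
      ≤ Real.exp (4 * ρ * (k * x) - (4 * ρ) ^ 2 / 8 * k)
      + Real.exp (-(4 * ρ) * (k * x) - (-(4 * ρ)) ^ 2 / 8 * k) := by
    rcases abs_cases x with ⟨h, _⟩ | ⟨h, _⟩
    · rw [h]
      exact le_add_of_nonneg_right (Real.exp_pos _).le
    · rw [h]
      refine le_trans (le_of_eq ?_) (le_add_of_nonneg_left (Real.exp_pos _).le)
      congr 1
      ring
  rw [div_mul_eq_mul_div, le_div_iff₀ (by positivity)]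
  calc y * (12 * Real.log T) = 12 * Real.log T * y := by ring
    _ ≤ _ := h1.trans_eq h2
    _ ≤ _ := by gcongr

variable {Ω : Type*} [MeasurableSpace Ω] {m : ℕ} {P : Measure Ω} [IsProbabilityMeasure P]
  {q : Measure (Fin K → ℝ)} {ν : Kernel ((Fin K → ℝ) × Fin K) ℝ} [IsMarkovKernel ν]
  {R : Run Ω Unit (Fin K) (Fin K → ℝ) m}

theorem lintegral_armExcess_le {T : ℕ} (hT : 2 ≤ T) (hR : IsBanditRun P q ν R)
    (hΘ : ∀ᵐ ω ∂P, ∀ a, R.param ω a ∈ Set.Icc (0 : ℝ) 1)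
    (hν : ∀ θ : Fin K → ℝ, (∀ a, θ a ∈ Set.Icc (0 : ℝ) 1) → ∀ a,
        (∀ᵐ y ∂(ν (θ, a)), y ∈ Set.Icc (0 : ℝ) 1) ∧ ∫ y, y ∂(ν (θ, a)) = θ a) (n : ℕ) :
    ∫⁻ ω, ENNReal.ofReal (armExcess T (R.hist n ω, R.param ω)) ∂P
      ≤ ENNReal.ofReal (K * (n * (Real.exp (-(6 * Real.log T)) / (12 * Real.log T) * 2))) := by
  have hl : 0 < Real.log T := Real.log_pos (by exact_mod_cast hT)
  set B := Real.exp (-(6 * Real.log T)) / (12 * Real.log T) with hB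
  have hB0 : 0 ≤ B := by positivity
  set M : Fin K → ℝ → Ω → ℝ := fun a t ω => Real.exp (t * armDev (R.hist n ω) (R.param ω) a
      - t ^ 2 / 8 * playCount (R.hist n ω) a) with hM
  set t : ℕ → ℝ := fun k => 4 * √(3 * Real.log T / k) with ht
  have hMm : ∀ a t, Measurable fun ω => ENNReal.ofReal (M a t ω) := fun a t => by
    have h1 : Measurable fun ω => armDev (R.hist n ω) (R.param ω) a :=
      (measurable_armDev a).comp ((hR.measurable_hist n).prodMk hR.measurable_param)
    have h2 : Measurable fun ω => (playCount (R.hist n ω) a : ℝ) :=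
      (measurable_playCount a).comp (hR.measurable_hist n)
    exact (Real.measurable_exp.comp ((h1.const_mul t).sub (h2.const_mul _))).ennreal_ofReal
  -- The best slope depends on the play count, which is random; summing over all counts from 1 to
  -- `n` makes each slope deterministic.
  have hpt : ∀ ω, ENNReal.ofReal (armExcess T (R.hist n ω, R.param ω))
      ≤ ∑ a : Fin K, ∑ k ∈ Finset.Icc 1 n, ENNReal.ofReal B *
        (ENNReal.ofReal (M a (t k) ω) + ENNReal.ofReal (M a (-t k) ω)) := by
    intro ω
    rw [armExcess, ENNReal.ofReal_sum_of_nonneg fun _ _ => le_max_left _ _]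
    refine Finset.sum_le_sum fun a _ => ?_
    set N := playCount (R.hist n ω) a with hN
    -- For an arm never played, division by zero makes both the radius and the quotient zero, so the
    -- term is max 0 (-1) = 0.
    rcases Nat.eq_zero_or_pos N with h0 | hpos
    · have : radius armMuHat (armU T) (R.hist n ω) a = 0 := by
        rw [radius_arm, ← hN, h0]; simp
      simp [this]
    · refine le_trans ?_ (Finset.single_le_sum (f := fun k => ENNReal.ofReal B *
        (ENNReal.ofReal (M a (t k) ω) + ENNReal.ofReal (M a (-t k) ω))) (fun _ _ => zero_le)
        (Finset.mem_Icc.2 ⟨hpos, playCount_le _ _⟩))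
      simp only []
      rw [← ENNReal.ofReal_add (Real.exp_pos _).le (Real.exp_pos _).le, ← ENNReal.ofReal_mul hB0]
      refine ENNReal.ofReal_le_ofReal ?_
      have := excess_le_exp (T := T) (k := N) hT hpos
        (x := armMuHat n (R.hist n ω) a - R.param ω a)
      rw [← armDev_eq _ _ _ hpos.ne'] at this
      rw [radius_arm, abs_sub_comm]
      exact this
  have hmt : ∀ a k, Measurable fun ω => ENNReal.ofReal B *
      (ENNReal.ofReal (M a (t k) ω) + ENNReal.ofReal (M a (-t k) ω)) := fun a k =>
    ((hMm a (t k)).add (hMm a (-t k))).const_mul _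
  refine (lintegral_mono hpt).trans ?_
  rw [lintegral_finsetSum _ fun a _ => Finset.measurable_sum _ fun k _ => hmt a k]
  have hterm : ∀ a k, ∫⁻ ω, ENNReal.ofReal B *
        (ENNReal.ofReal (M a (t k) ω) + ENNReal.ofReal (M a (-t k) ω)) ∂P
      ≤ ENNReal.ofReal (B * 2) := fun a k => by
    have hadd : Measurable fun ω => ENNReal.ofReal (M a (t k) ω) + ENNReal.ofReal (M a (-t k) ω) :=
      (hMm a (t k)).add (hMm a (-t k))
    rw [lintegral_const_mul _ hadd, lintegral_add_left (hMm a (t k)),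
      ENNReal.ofReal_mul hB0]
    refine mul_le_mul_right ?_ _
    calc _ ≤ (1 : ENNReal) + 1 := add_le_add (lintegral_exp_armDev_le hR hΘ hν a _ n)
          (lintegral_exp_armDev_le hR hΘ hν a _ n)
      _ = ENNReal.ofReal 2 := by norm_num
  calc _ ≤ ∑ _a : Fin K, ∑ _k ∈ Finset.Icc 1 n, ENNReal.ofReal (B * 2) := by
        refine Finset.sum_le_sum fun a _ => ?_
        rw [lintegral_finsetSum _ fun k _ => hmt a k]
        exact Finset.sum_le_sum fun k _ => hterm a k
    _ = _ := by
        rw [ENNReal.ofReal_mul (p := (K : ℝ)) (by positivity),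
          ENNReal.ofReal_mul (p := (n : ℝ)) (by positivity), ENNReal.ofReal_natCast,
          ENNReal.ofReal_natCast]
        simp

/-- The product is in fact of order T^(-4); 1/(2T) is what makes at most T rounds contribute at most
1/2. -/
theorem armExcess_bound {T K n : ℕ} (hT : 2 ≤ T) (hK : K ≤ T) (hn : n ≤ T) :
    (K : ℝ) * (n * (Real.exp (-(6 * Real.log T)) / (12 * Real.log T) * 2)) ≤ 1 / (2 * T) := by
  have hT2 : (2 : ℝ) ≤ T := by exact_mod_cast hT
  have hT0 : (0 : ℝ) < T := by linarith
  have hl : 1 / 2 ≤ Real.log T := by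
    have h1 := Real.log_two_gt_d9
    have h2 := Real.log_le_log (by norm_num) hT2
    linarith
  have he : Real.exp (-(6 * Real.log T)) = 1 / (T : ℝ) ^ 6 := by
    rw [Real.exp_neg, mul_comm, Real.exp_mul, Real.exp_log hT0, one_div]
    norm_cast
  have hK' : (K : ℝ) ≤ T := by exact_mod_cast hK
  have hn' : (n : ℝ) ≤ T := by exact_mod_cast hn
  rw [he]
  calc (K : ℝ) * (n * (1 / (T : ℝ) ^ 6 / (12 * Real.log T) * 2))
      ≤ T * (T * (1 / (T : ℝ) ^ 6 / (12 * (1 / 2)) * 2)) := by gcongr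
    _ = 1 / (3 * (T : ℝ) ^ 4) := by field_simp; norm_num
    _ ≤ 1 / (2 * T) := by
        apply one_div_le_one_div_of_le (by positivity)
        have : (1 : ℝ) ≤ T ^ 3 := one_le_pow₀ (by linarith)
        nlinarith

end KArmed

/-! ### Summation over the rounds, and the K-armed bandit. -/

/-- Summation of the bounds for the single rounds. -/
theorem sum_regret_le {s : Finset ℕ} {T m : ℕ} {reg rad x : ℕ → ℝ} {rmin rmax : ℝ}
    (hrmin : 0 < rmin) (hr : rmin ≤ rmax) (hs : s.card ≤ T)
    (h : ∀ n ∈ s, reg n ≤ 2 * rad n + (1 + rmax / rmin) * (1 / √m + x n))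
    (hx : ∑ n ∈ s, x n ≤ 1 / 2) :
    ∑ n ∈ s, reg n ≤ 2 * ∑ n ∈ s, rad n + rmax / rmin * (1 + 2 * T / √m) := by
  have hρ : 1 ≤ rmax / rmin := (one_le_div hrmin).2 hr
  have hs' : (s.card : ℝ) ≤ T := by exact_mod_cast hs
  have hm0 : 0 ≤ 1 / √(m : ℝ) := by positivity
  calc ∑ n ∈ s, reg n ≤ ∑ n ∈ s, (2 * rad n + (1 + rmax / rmin) * (1 / √m + x n)) :=
        Finset.sum_le_sum h
    _ = 2 * ∑ n ∈ s, rad n + (1 + rmax / rmin) * (s.card * (1 / √m))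
        + (1 + rmax / rmin) * ∑ n ∈ s, x n := by
        rw [Finset.sum_add_distrib, ← Finset.mul_sum, ← Finset.mul_sum, Finset.sum_add_distrib,
          Finset.sum_const, nsmul_eq_mul]
        ring
    _ ≤ 2 * ∑ n ∈ s, rad n + (1 + rmax / rmin) * (s.card * (1 / √m))
        + (1 + rmax / rmin) * (1 / 2) := by gcongr
    -- Replacing 1 by `rmax / rmin` doubles the ratio: hence the factor 2 in front of T/√m, while
    -- 1/2 becomes 1.
    _ ≤ 2 * ∑ n ∈ s, rad n + (rmax / rmin + rmax / rmin) * (T * (1 / √m))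
        + (rmax / rmin + rmax / rmin) * (1 / 2) := by
        gcongr
    _ = _ := by ring

theorem bayesRegret_armMean_le {m T K : ℕ} (hm : 1 ≤ m) {rmin rmax : ℝ} (hrmin : 0 < rmin)
    (hr : rmin ≤ rmax) (hKT : K ≤ T)
    {Ω : Type*} [MeasurableSpace Ω] {P : Measure Ω} [IsProbabilityMeasure P]
    {q : Measure (Fin K → ℝ)} {ν : Kernel ((Fin K → ℝ) × Fin K) ℝ} [IsMarkovKernel ν]
    (hq : ∀ᵐ θ ∂q, ∀ a, θ a ∈ Set.Icc (0 : ℝ) 1)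
    (hν : ∀ θ : Fin K → ℝ, (∀ a, θ a ∈ Set.Icc (0 : ℝ) 1) → ∀ a,
        (∀ᵐ y ∂(ν (θ, a)), y ∈ Set.Icc (0 : ℝ) 1) ∧ ∫ y, y ∂(ν (θ, a)) = θ a)
    {opt : ℕ → Unit → (Fin K → ℝ) → Fin K}
    (hopt : IsOptimal armMean {θ | ∀ a, θ a ∈ Set.Icc (0 : ℝ) 1} (fun _ => Set.univ) opt)
    {R : Run Ω Unit (Fin K) (Fin K → ℝ) m} (hR : IsBanditRun P q ν R)
    (hTS : IsTSUCB P armMean (fun _ => Set.univ) opt armMuHat (armU T) K R)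
    (hrad : ∀ n, K ≤ n → n < T → ∀ᵐ ω ∂P, ∀ a,
        radius armMuHat (armU T) (R.hist n ω) a ∈ Set.Icc rmin rmax) :
    bayesRegret P armMean opt R (Finset.Ico K T)
      ≤ 2 * expRadius P armMuHat (armU T) R (Finset.Ico K T)
        + rmax / rmin * (1 + 2 * T / √m) := by
  have hΘ : ∀ᵐ θ ∂(P.map R.param), θ ∈ {θ : Fin K → ℝ | ∀ a, θ a ∈ Set.Icc (0 : ℝ) 1} := by
    rw [hR.law_param.map_eq]; exact hq
  have hparam : ∀ᵐ ω ∂P, ∀ a, R.param ω a ∈ Set.Icc (0 : ℝ) 1 :=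
    ae_of_ae_map hR.measurable_param.aemeasurable hΘ
  have hf : Measurable (Function.uncurry (armMean : (Fin K → ℝ) → Fin K → ℝ)) :=
    measurable_from_prod_countable_left fun a => measurable_pi_apply a
  -- If T = 1 then log T = 0 and every radius vanishes, against `0 < rmin`.
  have hT2 : ∀ n ∈ Finset.Ico K T, 2 ≤ T := by
    intro n hn
    rw [Finset.mem_Ico] at hn
    by_contra hT
    obtain ⟨ω, hω⟩ := (hrad n hn.1 hn.2).exists
    have h1 := hrmin.trans_le (hω (R.act n ω)).1
    have hT1 : T = 1 := by omega
    rw [radius_arm, hT1] at h1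
    simp at h1
  have key : ∀ n ∈ Finset.Ico K T,
      ∫ ω, (armMean (R.param ω) (opt n (R.ctx n ω) (R.param ω))
        - armMean (R.param ω) (R.act n ω)) ∂P
      ≤ 2 * ∫ ω, radius armMuHat (armU T) (R.hist n ω) (R.act n ω) ∂P
        + (1 + rmax / rmin) * (1 / √m + 1 / (2 * T)) := by
    intro n hn
    have hT := hT2 n hn
    rw [Finset.mem_Ico] at hn
    have hexm := measurable_armExcess (K := K) (n := n) T
    obtain ⟨hi, hb⟩ := integrable_and_integral_le_of_lintegral_le
      (X := fun ω => armExcess T (R.hist n ω, R.param ω))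
      (hexm.comp ((hR.measurable_hist n).prodMk hR.measurable_param))
      (fun ω => armExcess_nonneg T _)
      (by have : 0 < Real.log T := Real.log_pos (by exact_mod_cast hT)
          positivity) (lintegral_armExcess_le hT hR hparam hν n)
    have := integral_regret_le hm hrmin hr hf hopt (fun θ hθ a => abs_le.2
      ⟨by have := (hθ a).1; simp only [armMean]; linarith, (hθ a).2⟩) hR hΘ hTS hn.1
      (measurable_radius_arm T) (hrad n hn.1 hn.2) hexm (armExcess_nonneg T) hi
      (fun h θ _ hrad a => abs_sub_armMuHat_le T h θ a (hrmin.trans_le (hrad a).1))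
    refine this.trans ?_
    have hb' := hb.trans (armExcess_bound hT hKT hn.2.le)
    have hρ : 0 < rmax / rmin := div_pos (hrmin.trans_le hr) hrmin
    gcongr
  rcases (Finset.Ico K T).eq_empty_or_nonempty with he | ⟨n, hn⟩
  · simp only [bayesRegret, expRadius, he, Finset.sum_empty]
    have : 0 < rmax / rmin := div_pos (hrmin.trans_le hr) hrmin
    positivity
  · have hT0 : (0 : ℝ) < T := by exact_mod_cast (by have := hT2 n hn; omega : 0 < T)
    have hcard : (Finset.Ico K T).card ≤ T := by simp
    refine sum_regret_le hrmin hr hcard key ?_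
    rw [Finset.sum_const, nsmul_eq_mul]
    have : ((Finset.Ico K T).card : ℝ) ≤ T := by exact_mod_cast hcard
    calc ((Finset.Ico K T).card : ℝ) * (1 / (2 * T)) ≤ T * (1 / (2 * T)) := by gcongr
      _ = 1 / 2 := by field_simp

/-- The regret of a single round is at most `1` when the mean rewards are in `[0, 1]`. -/
theorem bayesRegret_armMean_range_le {m T K : ℕ} (hKT : K ≤ T)
    {Ω : Type*} [MeasurableSpace Ω] {P : Measure Ω} [IsProbabilityMeasure P]
    {q : Measure (Fin K → ℝ)} {ν : Kernel ((Fin K → ℝ) × Fin K) ℝ}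
    (hq : ∀ᵐ θ ∂q, ∀ a, θ a ∈ Set.Icc (0 : ℝ) 1) {opt : ℕ → Unit → (Fin K → ℝ) → Fin K}
    {R : Run Ω Unit (Fin K) (Fin K → ℝ) m} (hR : IsBanditRun P q ν R) :
    bayesRegret P armMean opt R (Finset.range T)
      ≤ K + bayesRegret P armMean opt R (Finset.Ico K T) := by
  rw [← hR.law_param.map_eq] at hq
  have hparam : ∀ᵐ ω ∂P, ∀ a, R.param ω a ∈ Set.Icc (0 : ℝ) 1 :=
    ae_of_ae_map hR.measurable_param.aemeasurable hq
  rw [bayesRegret, bayesRegret, ← Finset.sum_range_add_sum_Ico _ hKT]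
  refine add_le_add_left ?_ _
  calc _ ≤ ∑ _n ∈ Finset.range K, (1 : ℝ) := by
        refine Finset.sum_le_sum fun n _ => ?_
        have h1 := norm_integral_le_of_norm_le_const (μ := P) (C := 1)
          (f := fun ω => armMean (R.param ω) (opt n (R.ctx n ω) (R.param ω))
            - armMean (R.param ω) (R.act n ω)) ?_
        · simp only [probReal_univ, mul_one] at h1
          exact (le_abs_self _).trans h1
        · filter_upwards [hparam] with ω hω
          have h1 := hω (opt n (R.ctx n ω) (R.param ω))
          have h2 := hω (R.act n ω)
          rw [Real.norm_eq_abs, abs_le]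
          simp only [armMean]
          constructor <;> linarith [h1.1, h1.2, h2.1, h2.2]
    _ = K := by simp

/-! ### Positive definite forms and rank-one updates. -/

section LinearAlgebra

variable {d : ℕ} {V : Matrix (Fin d) (Fin d) ℝ}

theorem posDef_dotProduct_pos (hV : V.PosDef) {x : Fin d → ℝ} (hx : x ≠ 0) :
    0 < x ⬝ᵥ (V *ᵥ x) := by
  simpa using hV.dotProduct_mulVec_pos hx

theorem posDef_dotProduct_nonneg (hV : V.PosDef) (x : Fin d → ℝ) : 0 ≤ x ⬝ᵥ (V *ᵥ x) := by
  simpa using hV.posSemidef.dotProduct_mulVec_nonneg x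

theorem posDef_dotProduct_comm (hV : V.PosDef) (x y : Fin d → ℝ) :
    x ⬝ᵥ (V *ᵥ y) = y ⬝ᵥ (V *ᵥ x) := by
  rw [Matrix.dotProduct_mulVec, ← Matrix.mulVec_transpose, dotProduct_comm]
  congr 2
  simpa using hV.isHermitian.eq

theorem posDef_isUnit_det (hV : V.PosDef) : IsUnit V.det := hV.det_pos.ne'.isUnit

theorem mulVec_inv_mulVec (hV : V.PosDef) (x : Fin d → ℝ) : V *ᵥ (V⁻¹ *ᵥ x) = x := by
  rw [Matrix.mulVec_mulVec, Matrix.mul_nonsing_inv _ (posDef_isUnit_det hV), Matrix.one_mulVec]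

theorem inv_mulVec_mulVec (hV : V.PosDef) (x : Fin d → ℝ) : V⁻¹ *ᵥ (V *ᵥ x) = x := by
  rw [Matrix.mulVec_mulVec, Matrix.nonsing_inv_mul _ (posDef_isUnit_det hV), Matrix.one_mulVec]

theorem posSemidef_vecMulVec (x : Fin d → ℝ) : (Matrix.vecMulVec x x).PosSemidef := by
  simpa using Matrix.posSemidef_vecMulVec_self_star x

theorem posDef_add_vecMulVec (hV : V.PosDef) (x : Fin d → ℝ) :
    (V + Matrix.vecMulVec x x).PosDef := hV.add_posSemidef (posSemidef_vecMulVec x)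

theorem add_vecMulVec_mulVec (x z : Fin d → ℝ) :
    (V + Matrix.vecMulVec x x) *ᵥ z = V *ᵥ z + (x ⬝ᵥ z) • x := by
  rw [Matrix.add_mulVec, Matrix.vecMulVec_mulVec]
  simp

/-- The matrix determinant lemma, with the rank-one matrix written as a column times a row. -/
theorem det_add_vecMulVec (hV : V.PosDef) (x : Fin d → ℝ) :
    (V + Matrix.vecMulVec x x).det = V.det * (1 + x ⬝ᵥ (V⁻¹ *ᵥ x)) := by
  rw [Matrix.vecMulVec_eq Unit, Matrix.det_add_replicateCol_mul_replicateRow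
    (posDef_isUnit_det hV)]
  congr 1
  rw [Matrix.det_unique, Matrix.add_apply, Matrix.one_apply_eq, Matrix.mul_assoc,
    ← Matrix.replicateCol_mulVec, Matrix.replicateRow_mul_replicateCol_apply]

/-- The quadratic form of the inverse after a rank-one update. -/
theorem inv_quadratic_add_vecMulVec (hV : V.PosDef) (x z : Fin d → ℝ) (η : ℝ) :
    (z + η • x) ⬝ᵥ ((V + Matrix.vecMulVec x x)⁻¹ *ᵥ (z + η • x))
      = z ⬝ᵥ (V⁻¹ *ᵥ z) + (2 * η * (x ⬝ᵥ (V⁻¹ *ᵥ z)) + η ^ 2 * (x ⬝ᵥ (V⁻¹ *ᵥ x))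
        - (x ⬝ᵥ (V⁻¹ *ᵥ z)) ^ 2) / (1 + x ⬝ᵥ (V⁻¹ *ᵥ x)) := by
  set v := x ⬝ᵥ (V⁻¹ *ᵥ x) with hv
  set s := x ⬝ᵥ (V⁻¹ *ᵥ z) with hs
  have hv0 : 0 ≤ v := posDef_dotProduct_nonneg hV.inv x
  have h1v : 1 + v ≠ 0 := by positivity
  have hsymm : z ⬝ᵥ (V⁻¹ *ᵥ x) = s := posDef_dotProduct_comm hV.inv z x
  -- The candidate given by the Sherman-Morrison formula; it is verified by applying the updated
  -- matrix to it.
  set w := V⁻¹ *ᵥ (z + η • x) - ((s + η * v) / (1 + v)) • (V⁻¹ *ᵥ x) with hw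
  have hVw : (V + Matrix.vecMulVec x x) *ᵥ w = z + η • x := by
    have hxw : x ⬝ᵥ w = (s + η * v) / (1 + v) := by
      rw [hw, dotProduct_sub, Matrix.mulVec_add, dotProduct_add, Matrix.mulVec_smul,
        dotProduct_smul, dotProduct_smul, ← hv, ← hs]
      simp only [smul_eq_mul]
      field_simp
      ring
    rw [add_vecMulVec_mulVec, hxw, hw, Matrix.mulVec_sub, mulVec_inv_mulVec hV,
      Matrix.mulVec_smul, mulVec_inv_mulVec hV]
    abel
  have hinv : (V + Matrix.vecMulVec x x)⁻¹ *ᵥ (z + η • x) = w := by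
    rw [← hVw, inv_mulVec_mulVec (posDef_add_vecMulVec hV x)]
  rw [hinv, hw, dotProduct_sub, Matrix.mulVec_add, Matrix.mulVec_smul]
  simp only [add_dotProduct, dotProduct_add, smul_dotProduct, dotProduct_smul, smul_eq_mul, hsymm,
    ← hv, ← hs]
  field_simp
  ring

/-- The Cauchy-Schwarz inequality for a positive definite form and its inverse. -/
theorem abs_dotProduct_le_sqrt_mul_sqrt (hV : V.PosDef) (x y : Fin d → ℝ) :
    |x ⬝ᵥ y| ≤ √(x ⬝ᵥ (V⁻¹ *ᵥ x)) * √(y ⬝ᵥ (V *ᵥ y)) := by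
  set v := x ⬝ᵥ (V⁻¹ *ᵥ x) with hv
  rcases eq_or_ne x 0 with rfl | hx
  · rw [zero_dotProduct, abs_zero]
    positivity
  have hv0 : 0 < v := posDef_dotProduct_pos hV.inv hx
  rw [← Real.sqrt_mul hv0.le]
  refine Real.abs_le_sqrt ?_
  -- The form is evaluated at `y` minus its projection, with respect to V, onto the line spanned by
  -- V⁻¹x.
  have h := posDef_dotProduct_nonneg hV (y - ((x ⬝ᵥ y) / v) • (V⁻¹ *ᵥ x))
  rw [Matrix.mulVec_sub, Matrix.mulVec_smul, mulVec_inv_mulVec hV, sub_dotProduct,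
    dotProduct_sub, dotProduct_sub, smul_dotProduct, smul_dotProduct, dotProduct_smul,
    dotProduct_smul, dotProduct_comm (V⁻¹ *ᵥ x) (V *ᵥ y), ← posDef_dotProduct_comm hV _ y,
    dotProduct_comm (V⁻¹ *ᵥ x) x, ← hv, dotProduct_comm y x] at h
  rw [show (V *ᵥ y) ⬝ᵥ (V⁻¹ *ᵥ x) = x ⬝ᵥ y by
    rw [dotProduct_comm, posDef_dotProduct_comm hV, mulVec_inv_mulVec hV, dotProduct_comm]] at h
  simp only [smul_eq_mul] at h
  have e : v * (y ⬝ᵥ (V *ᵥ y) - x ⬝ᵥ y / v * (x ⬝ᵥ y)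
      - (x ⬝ᵥ y / v * (x ⬝ᵥ y) - x ⬝ᵥ y / v * (x ⬝ᵥ y / v * v)))
      = v * (y ⬝ᵥ (V *ᵥ y)) - (x ⬝ᵥ y) ^ 2 := by
    field_simp
    ring
  have := mul_nonneg hv0.le h
  linarith

/-- AM-GM for the eigenvalues, obtained by multiplying the inequalities λ/D ≤ exp(λ/D - 1): the
exponents sum to trace/D - d ≤ 0. -/
theorem det_le_pow_of_trace_le (hV : V.PosDef) {D : ℝ} (hD : 0 < D) (h : V.trace ≤ d * D) :
    V.det ≤ D ^ d := by
  have hH := hV.isHermitian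
  have htr : ∑ i, hH.eigenvalues i ≤ d * D := by
    have := hH.trace_eq_sum_eigenvalues
    simp only [RCLike.ofReal_real_eq_id, id_eq] at this
    linarith
  have hdet : V.det = ∏ i, hH.eigenvalues i := by
    have := hH.det_eq_prod_eigenvalues
    simpa using this
  have h1 : ∏ i, hH.eigenvalues i / D ≤ 1 := by
    calc ∏ i, hH.eigenvalues i / D ≤ ∏ i, Real.exp (hH.eigenvalues i / D - 1) := by
          refine Finset.prod_le_prod (fun i _ => ?_) fun i _ => ?_
          · exact div_nonneg (hV.posSemidef.eigenvalues_nonneg i) hD.le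
          · have := Real.add_one_le_exp (hH.eigenvalues i / D - 1)
            linarith
      _ = Real.exp ((∑ i, hH.eigenvalues i) / D - d) := by
          rw [← Real.exp_sum, Finset.sum_sub_distrib, Finset.sum_div]
          simp
      _ ≤ 1 := by
          rw [Real.exp_le_one_iff, sub_nonpos, div_le_iff₀ hD]
          exact htr
  rw [hdet]
  rw [Finset.prod_div_distrib, Finset.prod_const, Finset.card_univ, Fintype.card_fin,
    div_le_one (by positivity)] at h1
  exact h1

theorem trace_mul_vecMulVec (x : Fin d → ℝ) :
    (V * Matrix.vecMulVec x x).trace = x ⬝ᵥ (V *ᵥ x) := by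
  rw [Matrix.mul_vecMulVec, Matrix.trace_vecMulVec, dotProduct_comm]

end LinearAlgebra

/-! ### Measurability of determinants, inverses and products. -/

section MeasurableMatrix

variable {d : ℕ} {S : Type*} [MeasurableSpace S]

theorem measurable_det {M : S → Matrix (Fin d) (Fin d) ℝ} (hM : ∀ i j, Measurable fun s => M s i j) :
    Measurable fun s => (M s).det := by
  simp_rw [Matrix.det_apply]
  exact Finset.measurable_sum _ fun σ _ =>
    (Finset.measurable_prod _ fun i _ => hM _ _).const_smul _

/-- An entry of the inverse is a minor of the adjugate times the inverted determinant, so everything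
reduces to determinants. -/
theorem measurable_inv_apply {M : S → Matrix (Fin d) (Fin d) ℝ}
    (hM : ∀ i j, Measurable fun s => M s i j) (i j : Fin d) :
    Measurable fun s => (M s)⁻¹ i j := by
  simp_rw [Matrix.inv_def, Matrix.smul_apply, Ring.inverse_eq_inv, Matrix.adjugate_apply]
  refine (measurable_det hM).inv.smul (measurable_det fun k l => ?_)
  by_cases h : k = j
  · subst h; simp
  · simp only [Matrix.updateRow_ne h]
    exact hM k l

theorem measurable_dotProduct {u v : S → Fin d → ℝ} (hu : ∀ i, Measurable fun s => u s i)
    (hv : ∀ i, Measurable fun s => v s i) : Measurable fun s => u s ⬝ᵥ v s :=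
  Finset.measurable_sum _ fun i _ => (hu i).mul (hv i)

theorem measurable_mulVec_apply {M : S → Matrix (Fin d) (Fin d) ℝ} {v : S → Fin d → ℝ}
    (hM : ∀ i j, Measurable fun s => M s i j) (hv : ∀ i, Measurable fun s => v s i) (i : Fin d) :
    Measurable fun s => (M s *ᵥ v s) i :=
  measurable_dotProduct (hM i) hv

end MeasurableMatrix

/-! ### Gaussian integrals and one step of the method of mixtures. -/

theorem lintegral_exp_mul_gaussianReal (μ : ℝ) (v : ℝ≥0) (t : ℝ) :
    ∫⁻ x, ENNReal.ofReal (Real.exp (x * t)) ∂(gaussianReal μ v)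
      = ENNReal.ofReal (Real.exp (μ * t + v * t ^ 2 / 2)) := by
  have h := congrFun (mgf_fun_id_gaussianReal (μ := μ) (v := v)) t
  rw [← h, mgf, ← ofReal_integral_eq_lintegral_ofReal]
  · simp_rw [mul_comm t]
  · simpa [mul_comm] using integrable_exp_mul_gaussianReal (μ := μ) (v := v) t
  · exact ae_of_all _ fun _ => (Real.exp_pos _).le

/-- Completing the square: tilting by exp(r²x²/2) turns the density into a constant times that of a
Gaussian with mean s/r² and variance v/r². The integral is finite because r² times the original
variance is v/(1 + v) < 1. -/
theorem lintegral_exp_sq_gaussianReal {r v s : ℝ} (hr : 0 < r) (hv : 0 < v) :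
    ∫⁻ x, ENNReal.ofReal (Real.exp (r ^ 2 * x ^ 2 / 2))
        ∂(gaussianReal (s / (r ^ 2 * (1 + v))) (Real.toNNReal (v / (r ^ 2 * (1 + v)))))
      = ENNReal.ofReal (√(1 + v) * Real.exp (s ^ 2 / (2 * r ^ 2 * (1 + v)))) := by
  have hw : 0 < v / (r ^ 2 * (1 + v)) := by positivity
  have hw2 : 0 < v / r ^ 2 := by positivity
  have hw' : Real.toNNReal (v / (r ^ 2 * (1 + v))) ≠ 0 := (Real.toNNReal_pos.2 hw).ne'
  have hw2' : Real.toNNReal (v / r ^ 2) ≠ 0 := (Real.toNNReal_pos.2 hw2).ne'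
  rw [gaussianReal_of_var_ne_zero _ hw', lintegral_withDensity_eq_lintegral_mul _ (by fun_prop)
    (by fun_prop)]
  have hpt : ∀ x : ℝ, (gaussianPDF (s / (r ^ 2 * (1 + v))) (Real.toNNReal (v / (r ^ 2 * (1 + v))))
      * fun x => ENNReal.ofReal (Real.exp (r ^ 2 * x ^ 2 / 2))) x
      = ENNReal.ofReal (√(1 + v) * Real.exp (s ^ 2 / (2 * r ^ 2 * (1 + v))))
        * gaussianPDF (s / r ^ 2) (Real.toNNReal (v / r ^ 2)) x := by
    intro x
    rw [Pi.mul_apply, gaussianPDF, gaussianPDF, ← ENNReal.ofReal_mul (gaussianPDFReal_nonneg _ _ _),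
      ← ENNReal.ofReal_mul (by positivity)]
    congr 1
    rw [gaussianPDFReal, gaussianPDFReal, Real.coe_toNNReal _ hw.le, Real.coe_toNNReal _ hw2.le]
    have hsq : (√(2 * Real.pi * (v / (r ^ 2 * (1 + v)))))⁻¹
        = √(1 + v) * (√(2 * Real.pi * (v / r ^ 2)))⁻¹ := by
      have : 2 * Real.pi * (v / r ^ 2) = (1 + v) * (2 * Real.pi * (v / (r ^ 2 * (1 + v)))) := by
        field_simp
      rw [this, Real.sqrt_mul (x := 1 + v) (by positivity)]
      have h1 : 0 < √(1 + v) := Real.sqrt_pos.2 (by positivity)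
      rw [mul_inv, ← mul_assoc, mul_inv_cancel₀ h1.ne', one_mul]
    have hexp : Real.exp (-(x - s / (r ^ 2 * (1 + v))) ^ 2 / (2 * (v / (r ^ 2 * (1 + v)))))
          * Real.exp (r ^ 2 * x ^ 2 / 2)
        = Real.exp (s ^ 2 / (2 * r ^ 2 * (1 + v)))
          * Real.exp (-(x - s / r ^ 2) ^ 2 / (2 * (v / r ^ 2))) := by
      rw [← Real.exp_add, ← Real.exp_add]
      congr 1
      field_simp
      ring
    rw [hsq, mul_assoc, hexp]
    ring
  simp_rw [hpt]
  rw [lintegral_const_mul _ (by fun_prop), lintegral_gaussianPDF_eq_one _ hw2', mul_one]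

/-- One step of the method of mixtures. -/
theorem lintegral_exp_quadratic_le {μ : Measure ℝ} [SFinite μ] {X : ℝ → ℝ} (hX : Measurable X)
    {r : ℝ≥0} (hr : 0 < r) (h : HasSubgaussianMGF X (r ^ 2) μ) {v s : ℝ} (hv : 0 ≤ v) :
    ∫⁻ y, ENNReal.ofReal (Real.exp ((2 * X y * s + X y ^ 2 * v - s ^ 2) / (1 + v)
      / (2 * (r : ℝ) ^ 2))) ∂μ ≤ ENNReal.ofReal √(1 + v) := by
  have hr0 : (0 : ℝ) < r := hr
  -- For v = 0 the exponent is linear in X, and the sub-Gaussian bound at s/r² is enough.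
  rcases hv.eq_or_lt with rfl | hv
  · have h1 := lintegral_exp_mul_le h (s / (r : ℝ) ^ 2)
    have h2 : ∀ y, ENNReal.ofReal (Real.exp ((2 * X y * s + X y ^ 2 * 0 - s ^ 2) / (1 + 0)
        / (2 * (r : ℝ) ^ 2))) = ENNReal.ofReal (Real.exp (-(s ^ 2 / (2 * (r : ℝ) ^ 2)))) *
          ENNReal.ofReal (Real.exp (s / (r : ℝ) ^ 2 * X y)) := fun y => by
      rw [← ENNReal.ofReal_mul (Real.exp_pos _).le, ← Real.exp_add]
      congr 2
      field_simp
      ring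
    simp_rw [h2]
    rw [lintegral_const_mul _ (by fun_prop)]
    refine (mul_le_mul_right h1 _).trans ?_
    rw [← ENNReal.ofReal_mul (Real.exp_pos _).le, ← Real.exp_add]
    refine ENNReal.ofReal_le_ofReal ?_
    rw [add_zero, Real.sqrt_one, Real.exp_le_one_iff]
    refine le_of_eq ?_
    push_cast
    field_simp
    ring
  -- Mean `M` and variance `w` are chosen so that the Gaussian moment generating function at X
  -- reproduces the part of the exponent that is quadratic and linear in X. After interchanging the
  -- integrals, X occurs only linearly and sub-Gaussianity applies.
  · set w := Real.toNNReal (v / ((r : ℝ) ^ 2 * (1 + v))) with hw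
    set M := s / ((r : ℝ) ^ 2 * (1 + v)) with hM
    have hwc : (w : ℝ) = v / ((r : ℝ) ^ 2 * (1 + v)) := Real.coe_toNNReal _ (by positivity)
    have h2 : ∀ y, ENNReal.ofReal (Real.exp ((2 * X y * s + X y ^ 2 * v - s ^ 2) / (1 + v)
        / (2 * (r : ℝ) ^ 2))) = ENNReal.ofReal (Real.exp (-(s ^ 2 / (2 * (r : ℝ) ^ 2 * (1 + v))))) *
          ∫⁻ x, ENNReal.ofReal (Real.exp (x * X y)) ∂(gaussianReal M w) := fun y => by
      rw [lintegral_exp_mul_gaussianReal, ← ENNReal.ofReal_mul (Real.exp_pos _).le, ← Real.exp_add,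
        hwc, hM]
      congr 2
      field_simp
      ring
    simp_rw [h2]
    have hmeas : Measurable fun p : ℝ × ℝ => ENNReal.ofReal (Real.exp (p.2 * X p.1)) := by fun_prop
    rw [lintegral_const_mul _ hmeas.lintegral_prod_right',
      lintegral_lintegral_swap hmeas.aemeasurable]
    have h3 : ∫⁻ x, ∫⁻ y, ENNReal.ofReal (Real.exp (x * X y)) ∂μ ∂(gaussianReal M w)
        ≤ ENNReal.ofReal (√(1 + v) * Real.exp (s ^ 2 / (2 * (r : ℝ) ^ 2 * (1 + v)))) := by
      rw [← lintegral_exp_sq_gaussianReal hr0 hv]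
      refine lintegral_mono fun x => ?_
      simpa using lintegral_exp_mul_le h x
    refine (mul_le_mul_right h3 _).trans ?_
    rw [← ENNReal.ofReal_mul (Real.exp_pos _).le, mul_left_comm, ← Real.exp_add, neg_add_cancel,
      Real.exp_zero, mul_one]

/-! ### The self-normalised process of ridge regression. -/

section Linear

variable {C A : Type*} {d n m : ℕ} {X : A → EuclideanSpace ℝ (Fin d)} {κ : ℝ}

/-- The design matrix with regularisation `κ`. -/
noncomputable def ridge (X : A → EuclideanSpace ℝ (Fin d)) (κ : ℝ) (h : Hist C A n) :
    Matrix (Fin d) (Fin d) ℝ :=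
  κ • (1 : Matrix (Fin d) (Fin d) ℝ)
    + ∑ s : Fin n, Matrix.vecMulVec (X (h.1 s).2.1).ofLp (X (h.1 s).2.1).ofLp

/-- The vector `∑ (y - ⟨θ, x⟩) x - θ`. -/
noncomputable def residual (X : A → EuclideanSpace ℝ (Fin d)) (h : Hist C A n)
    (θ : EuclideanSpace ℝ (Fin d)) : Fin d → ℝ :=
  -θ.ofLp + ∑ s : Fin n, ((h.1 s).2.2 - linMean X θ (h.1 s).2.1) • (X (h.1 s).2.1).ofLp

/-- The quadratic form of the inverse of the design matrix at the residual. -/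
noncomputable def residualForm (X : A → EuclideanSpace ℝ (Fin d)) (κ : ℝ) (h : Hist C A n)
    (θ : EuclideanSpace ℝ (Fin d)) : ℝ :=
  residual X h θ ⬝ᵥ ((ridge X κ h)⁻¹ *ᵥ residual X h θ)

theorem designMatrix_eq_ridge (h : Hist C A n) : designMatrix X h = ridge X 1 h := by
  rw [designMatrix, ridge, one_smul]

theorem posDef_ridge (hκ : 0 < κ) (h : Hist C A n) : (ridge X κ h).PosDef :=
  (Matrix.PosDef.one.smul hκ).add_posSemidef
    (Matrix.posSemidef_sum _ fun _ _ => posSemidef_vecMulVec _)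

theorem residualForm_nonneg (hκ : 0 < κ) (h : Hist C A n) (θ : EuclideanSpace ℝ (Fin d)) :
    0 ≤ residualForm X κ h θ :=
  posDef_dotProduct_nonneg (posDef_ridge hκ h).inv _

theorem linMean_eq (θ : EuclideanSpace ℝ (Fin d)) (a : A) :
    linMean X θ a = (X a).ofLp ⬝ᵥ θ.ofLp := by
  rw [linMean, EuclideanSpace.inner_eq_star_dotProduct]
  simp

theorem norm_sq_eq_dotProduct (x : EuclideanSpace ℝ (Fin d)) : ‖x‖ ^ 2 = x.ofLp ⬝ᵥ x.ofLp := by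
  rw [← real_inner_self_eq_norm_sq, EuclideanSpace.inner_eq_star_dotProduct]
  simp

theorem sum_vecMulVec_mulVec (x : Fin n → Fin d → ℝ) (z : Fin d → ℝ) :
    (∑ s, Matrix.vecMulVec (x s) (x s)) *ᵥ z = ∑ s, (x s ⬝ᵥ z) • x s := by
  rw [Matrix.sum_mulVec]
  refine Finset.sum_congr rfl fun s _ => ?_
  rw [Matrix.vecMulVec_mulVec]
  simp

/-- Vθ equals θ plus the noiseless data sum; the summand -θ in `residual` is thus the bias caused by
the regularisation. -/
theorem thetaHat_sub (h : Hist C A n) (θ : EuclideanSpace ℝ (Fin d)) :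
    thetaHat X h - θ.ofLp = (designMatrix X h)⁻¹ *ᵥ residual X h θ := by
  have hV : (designMatrix X h).PosDef := by
    rw [designMatrix_eq_ridge]; exact posDef_ridge one_pos h
  have h1 : designMatrix X h *ᵥ θ.ofLp
      = θ.ofLp + ∑ s : Fin n, linMean X θ (h.1 s).2.1 • (X (h.1 s).2.1).ofLp := by
    rw [designMatrix, Matrix.add_mulVec, Matrix.one_mulVec, sum_vecMulVec_mulVec]
    simp_rw [linMean_eq]
  have h2 : residual X h θ = ∑ s : Fin n, (h.1 s).2.2 • (X (h.1 s).2.1).ofLp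
      - designMatrix X h *ᵥ θ.ofLp := by
    rw [h1, residual]
    simp_rw [sub_smul]
    rw [Finset.sum_sub_distrib]
    abel
  rw [h2, Matrix.mulVec_sub, inv_mulVec_mulVec hV, thetaHat]

theorem quadratic_sub_thetaHat (h : Hist C A n) (θ : EuclideanSpace ℝ (Fin d)) :
    (θ.ofLp - thetaHat X h) ⬝ᵥ (designMatrix X h *ᵥ (θ.ofLp - thetaHat X h))
      = residualForm X 1 h θ := by
  have hV : (designMatrix X h).PosDef := by
    rw [designMatrix_eq_ridge]; exact posDef_ridge one_pos h
  rw [← neg_sub (thetaHat X h), Matrix.mulVec_neg, neg_dotProduct_neg, thetaHat_sub,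
    mulVec_inv_mulVec hV, dotProduct_comm, residualForm, designMatrix_eq_ridge]

section Measurability

variable [MeasurableSpace C] [MeasurableSpace A]

theorem measurable_feature (hX : Measurable X) (i : Fin d) : Measurable fun a => (X a).ofLp i :=
  (EuclideanSpace.proj (𝕜 := ℝ) i).continuous.measurable.comp hX

theorem measurable_linMean (hX : Measurable X) :
    Measurable (Function.uncurry (linMean X)) :=
  measurable_fst.inner (hX.comp measurable_snd)

theorem measurable_ridge_apply (hX : Measurable X) (κ : ℝ) (i j : Fin d) :
    Measurable fun h : Hist C A n => ridge X κ h i j := by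
  simp only [ridge, Matrix.add_apply, Matrix.sum_apply, Matrix.vecMulVec_apply]
  refine measurable_const.add (Finset.measurable_sum _ fun s _ => ?_)
  have ha : Measurable fun h : Hist C A n => (h.1 s).2.1 := by fun_prop
  exact ((measurable_feature hX i).comp ha).mul ((measurable_feature hX j).comp ha)

theorem measurable_residual_apply (hX : Measurable X) (i : Fin d) :
    Measurable fun p : Hist C A n × EuclideanSpace ℝ (Fin d) => residual X p.1 p.2 i := by
  simp only [residual, Pi.add_apply, Pi.neg_apply, Finset.sum_apply, Pi.smul_apply, smul_eq_mul]
  have hθ : Measurable fun p : Hist C A n × EuclideanSpace ℝ (Fin d) => p.2.ofLp i :=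
    (EuclideanSpace.proj (𝕜 := ℝ) i).continuous.measurable.comp measurable_snd
  refine hθ.neg.add (Finset.measurable_sum _ fun s _ => ?_)
  have ha : Measurable fun p : Hist C A n × EuclideanSpace ℝ (Fin d) => (p.1.1 s).2.1 := by
    fun_prop
  have hy : Measurable fun p : Hist C A n × EuclideanSpace ℝ (Fin d) => (p.1.1 s).2.2 := by
    fun_prop
  exact (hy.sub ((measurable_linMean hX).comp (measurable_snd.prodMk ha))).mul
    ((measurable_feature hX i).comp ha)

theorem measurable_residualForm (hX : Measurable X) (κ : ℝ) :
    Measurable fun p : Hist C A n × EuclideanSpace ℝ (Fin d) => residualForm X κ p.1 p.2 :=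
  measurable_dotProduct (measurable_residual_apply hX) (measurable_mulVec_apply
    (measurable_inv_apply fun i j => (measurable_ridge_apply hX κ i j).comp measurable_fst)
    (measurable_residual_apply hX))

end Measurability

/-- The self-normalised exponential process of the method of mixtures. -/
noncomputable def mixture (X : A → EuclideanSpace ℝ (Fin d)) (κ : ℝ) (r : ℝ≥0) (h : Hist C A n)
    (θ : EuclideanSpace ℝ (Fin d)) : ℝ :=
  Real.exp (residualForm X κ h θ / (2 * (r : ℝ) ^ 2)) / √(ridge X κ h).det

theorem mixture_nonneg (r : ℝ≥0) (h : Hist C A n) (θ : EuclideanSpace ℝ (Fin d)) :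
    0 ≤ mixture X κ r h θ := by unfold mixture; positivity

variable {Ω : Type*} [MeasurableSpace Ω] [MeasurableSpace C] [MeasurableSpace A]
  {P : Measure Ω} [IsProbabilityMeasure P]
  {q : Measure (EuclideanSpace ℝ (Fin d))} {ν : Kernel (EuclideanSpace ℝ (Fin d) × A) ℝ}
  [IsMarkovKernel ν] {R : Run Ω C A (EuclideanSpace ℝ (Fin d)) m}

omit [MeasurableSpace Ω] [MeasurableSpace C] [MeasurableSpace A] in
theorem ridge_succ (ω : Ω) :
    ridge X κ (R.hist (n + 1) ω) = ridge X κ (R.hist n ω)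
      + Matrix.vecMulVec (X (R.act n ω)).ofLp (X (R.act n ω)).ofLp := by
  rw [ridge, Fin.sum_univ_castSucc, ← add_assoc]; rfl

omit [MeasurableSpace Ω] [MeasurableSpace C] [MeasurableSpace A] in
theorem residual_succ (ω : Ω) (θ : EuclideanSpace ℝ (Fin d)) :
    residual X (R.hist (n + 1) ω) θ = residual X (R.hist n ω) θ
      + (R.rew n ω - linMean X θ (R.act n ω)) • (X (R.act n ω)).ofLp := by
  rw [residual, Fin.sum_univ_castSucc, ← add_assoc]; rfl

/-- The scalars that describe one step of the mixture process. -/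
noncomputable def stepVar (X : A → EuclideanSpace ℝ (Fin d)) (κ : ℝ) (h : Hist C A n) (a : A) : ℝ :=
  (X a).ofLp ⬝ᵥ ((ridge X κ h)⁻¹ *ᵥ (X a).ofLp)

/-- The scalar product of the residual with the next feature vector. -/
noncomputable def stepCov (X : A → EuclideanSpace ℝ (Fin d)) (κ : ℝ) (h : Hist C A n)
    (θ : EuclideanSpace ℝ (Fin d)) (a : A) : ℝ :=
  (X a).ofLp ⬝ᵥ ((ridge X κ h)⁻¹ *ᵥ residual X h θ)

/-- The value of the mixture process after one more round. -/
noncomputable def mixtureStep (X : A → EuclideanSpace ℝ (Fin d)) (κ : ℝ) (r : ℝ≥0) (h : Hist C A n)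
    (θ : EuclideanSpace ℝ (Fin d)) (a : A) (y : ℝ) : ℝ :=
  mixture X κ r h θ * (√(1 + stepVar X κ h a))⁻¹
    * Real.exp ((2 * (y - linMean X θ a) * stepCov X κ h θ a
        + (y - linMean X θ a) ^ 2 * stepVar X κ h a - stepCov X κ h θ a ^ 2)
          / (1 + stepVar X κ h a) / (2 * (r : ℝ) ^ 2))

omit [MeasurableSpace Ω] [MeasurableSpace C] [MeasurableSpace A] in
-- A round is a rank-one update: the quadratic form gains the exponent of `mixtureStep`, and the
-- determinant the factor 1 + `stepVar`.
theorem mixture_succ (hκ : 0 < κ) (r : ℝ≥0) (ω : Ω) (θ : EuclideanSpace ℝ (Fin d)) :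
    mixture X κ r (R.hist (n + 1) ω) θ
      = mixtureStep X κ r (R.hist n ω) θ (R.act n ω) (R.rew n ω) := by
  have hV := posDef_ridge (X := X) hκ (R.hist n ω)
  rw [mixtureStep, mixture, mixture, residualForm, ridge_succ, residual_succ,
    inv_quadratic_add_vecMulVec hV, det_add_vecMulVec hV, Real.sqrt_mul hV.det_pos.le, add_div,
    Real.exp_add]
  simp only [residualForm, stepVar, stepCov]
  rw [div_eq_mul_inv, mul_inv]
  ring

theorem measurable_stepVar (hX : Measurable X) (κ : ℝ) :
    Measurable fun p : Hist C A n × A => stepVar X κ p.1 p.2 :=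
  measurable_dotProduct (fun i => (measurable_feature hX i).comp measurable_snd)
    (measurable_mulVec_apply
      (measurable_inv_apply fun i j => (measurable_ridge_apply hX κ i j).comp measurable_fst)
      (fun i => (measurable_feature hX i).comp measurable_snd))

theorem measurable_stepCov (hX : Measurable X) (κ : ℝ) :
    Measurable fun p : Hist C A n × EuclideanSpace ℝ (Fin d) × A =>
      stepCov X κ p.1 p.2.1 p.2.2 := by
  have h1 : Measurable fun p : Hist C A n × EuclideanSpace ℝ (Fin d) × A => p.2.2 :=
    measurable_snd.comp measurable_snd
  have h2 : Measurable fun p : Hist C A n × EuclideanSpace ℝ (Fin d) × A => (p.1, p.2.1) :=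
    measurable_fst.prodMk (measurable_fst.comp measurable_snd)
  exact measurable_dotProduct (fun i => (measurable_feature hX i).comp h1)
    (measurable_mulVec_apply
      (measurable_inv_apply fun i j => (measurable_ridge_apply hX κ i j).comp measurable_fst)
      (fun i => (measurable_residual_apply hX i).comp h2))

theorem measurable_mixture (hX : Measurable X) (κ : ℝ) (r : ℝ≥0) :
    Measurable fun p : Hist C A n × EuclideanSpace ℝ (Fin d) => mixture X κ r p.1 p.2 :=
  (Real.measurable_exp.comp ((measurable_residualForm hX κ).div_const _)).div
    ((measurable_det fun i j => (measurable_ridge_apply hX κ i j).comp measurable_fst).sqrt)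

theorem measurable_stepFormula {α : Type*} [MeasurableSpace α] {M v c l : α → ℝ}
    (hM : Measurable M) (hv : Measurable v) (hc : Measurable c) (hl : Measurable l) (ρ : ℝ) :
    Measurable fun p => M p * (√(1 + v p))⁻¹
      * Real.exp ((2 * l p * c p + l p ^ 2 * v p - c p ^ 2) / (1 + v p) / ρ) := by
  fun_prop

theorem measurable_mixtureStep (hX : Measurable X) (κ : ℝ) (r : ℝ≥0) :
    Measurable fun p : (Hist C A n × EuclideanSpace ℝ (Fin d) × A) × ℝ =>
      mixtureStep X κ r p.1.1 p.1.2.1 p.1.2.2 p.2 := by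
  have m1 : Measurable fun p : (Hist C A n × EuclideanSpace ℝ (Fin d) × A) × ℝ => p.1.1 :=
    measurable_fst.comp measurable_fst
  have m2 : Measurable fun p : (Hist C A n × EuclideanSpace ℝ (Fin d) × A) × ℝ => p.1.2.1 :=
    measurable_fst.comp (measurable_snd.comp measurable_fst)
  have m3 : Measurable fun p : (Hist C A n × EuclideanSpace ℝ (Fin d) × A) × ℝ => p.1.2.2 :=
    measurable_snd.comp (measurable_snd.comp measurable_fst)
  have mv : Measurable fun p : (Hist C A n × EuclideanSpace ℝ (Fin d) × A) × ℝ =>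
      stepVar X κ p.1.1 p.1.2.2 := (measurable_stepVar hX κ).comp (m1.prodMk m3)
  have mc : Measurable fun p : (Hist C A n × EuclideanSpace ℝ (Fin d) × A) × ℝ =>
      stepCov X κ p.1.1 p.1.2.1 p.1.2.2 := (measurable_stepCov hX κ).comp measurable_fst
  have ml : Measurable fun p : (Hist C A n × EuclideanSpace ℝ (Fin d) × A) × ℝ =>
      p.2 - linMean X p.1.2.1 p.1.2.2 :=
    measurable_snd.sub ((measurable_linMean hX).comp (m2.prodMk m3))
  have mm : Measurable fun p : (Hist C A n × EuclideanSpace ℝ (Fin d) × A) × ℝ =>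
      mixture X κ r p.1.1 p.1.2.1 :=
    Measurable.comp (g := fun p : Hist C A n × EuclideanSpace ℝ (Fin d) => mixture X κ r p.1 p.2)
      (f := fun p : (Hist C A n × EuclideanSpace ℝ (Fin d) × A) × ℝ => (p.1.1, p.1.2.1))
      (measurable_mixture hX κ r) (m1.prodMk m2)
  exact measurable_stepFormula mm mv mc ml _

omit [MeasurableSpace C] [MeasurableSpace A] in
theorem stepVar_nonneg (hκ : 0 < κ) (h : Hist C A n) (a : A) : 0 ≤ stepVar X κ h a :=
  posDef_dotProduct_nonneg (posDef_ridge hκ h).inv _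

omit [MeasurableSpace C] [MeasurableSpace A] in
-- The factor √(1 + v) lost in the Gaussian step is exactly the growth of √det, so the mixture is a
-- supermartingale.
theorem lintegral_mixtureStep_le (hκ : 0 < κ) {r : ℝ≥0} (hr : 0 < r) {μ : Measure ℝ} [SFinite μ]
    (h : Hist C A n) {θ : EuclideanSpace ℝ (Fin d)} {a : A}
    (hμ : HasSubgaussianMGF (fun y => y - linMean X θ a) (r ^ 2) μ) :
    ∫⁻ y, ENNReal.ofReal (mixtureStep X κ r h θ a y) ∂μ ≤ ENNReal.ofReal (mixture X κ r h θ) := by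
  have hv0 := stepVar_nonneg (X := X) hκ h a
  have h0 : 0 ≤ mixture X κ r h θ * (√(1 + stepVar X κ h a))⁻¹ :=
    mul_nonneg (mixture_nonneg _ _ _) (by positivity)
  simp_rw [mixtureStep, ENNReal.ofReal_mul h0]
  rw [lintegral_const_mul _ (by fun_prop)]
  refine (mul_le_mul_right (lintegral_exp_quadratic_le (by fun_prop) hr hμ hv0) _).trans ?_
  rw [← ENNReal.ofReal_mul h0, mul_assoc,
    inv_mul_cancel₀ (Real.sqrt_pos.2 (by positivity)).ne', mul_one]

theorem lintegral_mixture_succ_le (hX : Measurable X) (hκ : 0 < κ) {r : ℝ≥0} (hr : 0 < r)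
    {Θ : Set (EuclideanSpace ℝ (Fin d))} (hR : IsBanditRun P q ν R)
    (hΘ : ∀ᵐ ω ∂P, R.param ω ∈ Θ)
    (hν : ∀ θ ∈ Θ, ∀ a, HasSubgaussianMGF (fun y => y - linMean X θ a) (r ^ 2) (ν (θ, a)))
    (n : ℕ) :
    ∫⁻ ω, ENNReal.ofReal (mixture X κ r (R.hist (n + 1) ω) (R.param ω)) ∂P
      ≤ ∫⁻ ω, ENNReal.ofReal (mixture X κ r (R.hist n ω) (R.param ω)) ∂P := by
  simp_rw [mixture_succ hκ]
  have e := lintegral_of_hasCondDistrib (hR.law_rew n)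
    (measurable_mixtureStep (n := n) hX κ r).ennreal_ofReal
  simp only [Kernel.prodMkLeft_apply] at e
  rw [e]
  refine lintegral_mono_ae ?_
  filter_upwards [hΘ] with ω hω
  exact lintegral_mixtureStep_le hκ hr _ (hν _ hω _)

omit [MeasurableSpace C] [MeasurableSpace A] in
-- Without data the design is κ times the identity and the residual is -θ. The bias therefore enters
-- the process through its starting value.
theorem mixture_zero_le (hκ : 0 < κ) {r : ℝ≥0} (h : Hist C A 0) {S : ℝ}
    {θ : EuclideanSpace ℝ (Fin d)} (hθ : ‖θ‖ ≤ S) :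
    mixture X κ r h θ ≤ Real.exp (S ^ 2 / κ / (2 * (r : ℝ) ^ 2)) / √(κ ^ d) := by
  have h1 : ridge X κ h = κ • (1 : Matrix (Fin d) (Fin d) ℝ) := by simp [ridge]
  have h2 : residual X h θ = -θ.ofLp := by simp [residual]
  have h3 : (κ • (1 : Matrix (Fin d) (Fin d) ℝ))⁻¹ *ᵥ (-θ.ofLp) = κ⁻¹ • (-θ.ofLp) := by
    have hV := posDef_ridge (X := X) hκ h
    rw [h1] at hV
    have := inv_mulVec_mulVec hV (κ⁻¹ • (-θ.ofLp))
    rwa [Matrix.smul_mulVec, Matrix.one_mulVec, smul_smul, mul_inv_cancel₀ hκ.ne', one_smul] at this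
  have h4 : ‖θ‖ ^ 2 ≤ S ^ 2 := pow_le_pow_left₀ (norm_nonneg _) hθ 2
  rw [mixture, residualForm, h1, h2, h3, Matrix.det_smul, Matrix.det_one, mul_one, Fintype.card_fin,
    dotProduct_smul, neg_dotProduct_neg, ← norm_sq_eq_dotProduct, smul_eq_mul]
  gcongr
  rw [inv_mul_eq_div]
  gcongr

theorem lintegral_mixture_le (hX : Measurable X) (hκ : 0 < κ) {r : ℝ≥0} (hr : 0 < r)
    {Θ : Set (EuclideanSpace ℝ (Fin d))} {S : ℝ} (hS : ∀ θ ∈ Θ, ‖θ‖ ≤ S)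
    (hR : IsBanditRun P q ν R) (hΘ : ∀ᵐ ω ∂P, R.param ω ∈ Θ)
    (hν : ∀ θ ∈ Θ, ∀ a, HasSubgaussianMGF (fun y => y - linMean X θ a) (r ^ 2) (ν (θ, a)))
    (n : ℕ) :
    ∫⁻ ω, ENNReal.ofReal (mixture X κ r (R.hist n ω) (R.param ω)) ∂P
      ≤ ENNReal.ofReal (Real.exp (S ^ 2 / κ / (2 * (r : ℝ) ^ 2)) / √(κ ^ d)) := by
  induction n with
  | zero =>
    calc _ ≤ ∫⁻ _ω, ENNReal.ofReal (Real.exp (S ^ 2 / κ / (2 * (r : ℝ) ^ 2)) / √(κ ^ d)) ∂P := by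
          refine lintegral_mono_ae ?_
          filter_upwards [hΘ] with ω hω
          exact ENNReal.ofReal_le_ofReal (mixture_zero_le hκ _ (hS _ hω))
      _ = _ := by simp
  | succ n ih => exact (lintegral_mixture_succ_le hX hκ hr hR hΘ hν n).trans ih

end Linear

/-! ### The confidence ellipsoid and its excess. -/

section Linear

variable {C A : Type*} {d n m : ℕ} {X : A → EuclideanSpace ℝ (Fin d)} {T : ℕ} {r S L : ℝ}

/-- The upper confidence bound is attained on the boundary of the ellipsoid. -/
theorem linU_eq (hβ : 0 ≤ sqrtBeta d T r S L n) (h : Hist C A n) (a : A) :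
    linU X T r S L n h a = linMuHat X n h a + sqrtBeta d T r S L n * √(stepVar X 1 h a) := by
  set β := sqrtBeta d T r S L n with hβdef
  have hV : (designMatrix X h).PosDef := by
    rw [designMatrix_eq_ridge]; exact posDef_ridge one_pos h
  set V := designMatrix X h with hVdef
  set x : Fin d → ℝ := (X a).ofLp with hx
  have hv : stepVar X 1 h a = x ⬝ᵥ (V⁻¹ *ᵥ x) := by rw [stepVar, hVdef, designMatrix_eq_ridge]
  rw [hv]
  set v := x ⬝ᵥ (V⁻¹ *ᵥ x) with hvdef
  have hv0 : 0 ≤ v := posDef_dotProduct_nonneg hV.inv x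
  refine IsGreatest.csSup_eq ⟨?_, ?_⟩
  -- The Lagrange multiplier solution. For v = 0 division by zero returns the centre of the
  -- ellipsoid, which is then also a maximiser.
  · refine ⟨thetaHat X h + (β / √v) • (V⁻¹ *ᵥ x), ?_, ?_⟩
    · change √(_ ⬝ᵥ (V *ᵥ _)) ≤ β
      rw [add_sub_cancel_left, Matrix.mulVec_smul, mulVec_inv_mulVec hV, smul_dotProduct,
        dotProduct_smul, dotProduct_comm, ← hvdef]
      simp only [smul_eq_mul]
      rcases hv0.eq_or_lt with h0 | h0
      · rw [← h0]; simpa using hβ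
      · refine le_of_eq ?_
        have hs := Real.sqrt_pos.2 h0
        have : β / √v * (β / √v * v) = β ^ 2 := by
          have e := Real.sq_sqrt hv0
          field_simp
          rw [e]
        rw [this, Real.sqrt_sq hβ]
    · simp only []
      rw [dotProduct_add, dotProduct_smul, ← hvdef, linMuHat, smul_eq_mul]
      congr 1
      rcases hv0.eq_or_lt with h0 | h0
      · rw [← h0]; simp
      · have hs := Real.sqrt_pos.2 h0
        have e := Real.sq_sqrt hv0
        rw [div_mul_eq_mul_div, div_eq_iff hs.ne', mul_assoc, ← sq, e]
  · rintro _ ⟨ρ, hρ, rfl⟩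
    change √(_ ⬝ᵥ (V *ᵥ _)) ≤ β at hρ
    have h1 := (le_abs_self _).trans (abs_dotProduct_le_sqrt_mul_sqrt hV x (ρ - thetaHat X h))
    rw [dotProduct_sub] at h1
    have h2 : √v * √((ρ - thetaHat X h) ⬝ᵥ (V *ᵥ (ρ - thetaHat X h))) ≤ √v * β := by gcongr
    rw [linMuHat]
    simp only []
    linarith

theorem radius_lin (hβ : 0 ≤ sqrtBeta d T r S L n) (h : Hist C A n) (a : A) :
    radius (linMuHat X) (linU X T r S L) h a = sqrtBeta d T r S L n * √(stepVar X 1 h a) := by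
  rw [radius, linU_eq hβ, add_sub_cancel_left]

/-- The relative amount by which the parameter leaves the confidence ellipsoid. -/
noncomputable def linExcess (X : A → EuclideanSpace ℝ (Fin d)) (T : ℕ) (r S L : ℝ)
    (p : Hist C A n × EuclideanSpace ℝ (Fin d)) : ℝ :=
  max 0 (√(residualForm X 1 p.1 p.2) / sqrtBeta d T r S L n - 1)

theorem linExcess_nonneg (p : Hist C A n × EuclideanSpace ℝ (Fin d)) :
    0 ≤ linExcess X T r S L p := le_max_left _ _

/-- Cauchy-Schwarz for V bounds the error by √Q · √(x·V⁻¹x); inflating the ellipsoid by 1 + excess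
brings it to the parameter. -/
theorem abs_linMean_sub_le (hβ : 0 ≤ sqrtBeta d T r S L n) (h : Hist C A n)
    (θ : EuclideanSpace ℝ (Fin d)) (a : A)
    (hr : 0 < radius (linMuHat X) (linU X T r S L) h a) :
    |linMean X θ a - linMuHat X n h a|
      ≤ (1 + linExcess X T r S L (h, θ)) * radius (linMuHat X) (linU X T r S L) h a := by
  have hV : (designMatrix X h).PosDef := by
    rw [designMatrix_eq_ridge]; exact posDef_ridge one_pos h
  rw [radius_lin hβ] at hr ⊢
  have hβ0 : 0 < sqrtBeta d T r S L n := by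
    refine hβ.lt_of_ne fun h0 => ?_
    rw [← h0, zero_mul] at hr
    exact lt_irrefl _ hr
  have h1 := abs_dotProduct_le_sqrt_mul_sqrt hV (X a).ofLp (θ.ofLp - thetaHat X h)
  rw [quadratic_sub_thetaHat, dotProduct_sub, ← linMean_eq] at h1
  have h2 : √(residualForm X 1 h θ)
      ≤ (1 + linExcess X T r S L (h, θ)) * sqrtBeta d T r S L n := by
    rw [← div_le_iff₀ hβ0]
    have : √(residualForm X 1 h θ) / sqrtBeta d T r S L n - 1 ≤ linExcess X T r S L (h, θ) :=
      le_max_right _ _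
    linarith
  have h3 : (X a).ofLp ⬝ᵥ ((designMatrix X h)⁻¹ *ᵥ (X a).ofLp) = stepVar X 1 h a := by
    rw [stepVar, designMatrix_eq_ridge]
  rw [h3] at h1
  calc |linMean X θ a - linMuHat X n h a| ≤ _ := h1
    _ ≤ √(stepVar X 1 h a) * ((1 + linExcess X T r S L (h, θ)) * sqrtBeta d T r S L n) := by gcongr
    _ = _ := by ring

/-- An exponential bound for the excess. -/
theorem sqrt_div_sub_one_le_exp {Q b c : ℝ} (hQ : 0 ≤ Q) (hb : 0 < b) (hc : 0 < c) (hr : 0 < r)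
    (hS : 0 ≤ S) :
    max 0 (√Q / (r * √b + S) - 1)
      ≤ Real.exp (-1) / (c * b) * Real.exp (-(c * b) / 2)
        * Real.exp ((c * Q - c * S ^ 2) / (2 * r ^ 2)) := by
  refine max_le (by positivity) ?_
  have hsb : 0 < √b := Real.sqrt_pos.2 hb
  set B := r * √b + S with hB
  have hB0 : 0 < B := by positivity
  -- Dropping the cross term separates S², which later cancels the starting value of the mixture.
  have hB2 : r ^ 2 * b + S ^ 2 ≤ B ^ 2 := by
    have e := Real.sq_sqrt hb.le
    have : B ^ 2 = r ^ 2 * √b ^ 2 + S ^ 2 + 2 * r * √b * S := by rw [hB]; ring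
    rw [this, e]
    have : 0 ≤ 2 * r * √b * S := by positivity
    linarith
  set w := √Q / B - 1 with hw
  have hQw : Q = B ^ 2 * (1 + w) ^ 2 := by
    have : √Q = B * (1 + w) := by rw [hw]; field_simp; ring
    rw [← Real.sq_sqrt hQ, this]; ring
  rcases le_or_gt w 0 with hw0 | hw0
  · exact hw0.trans (by positivity)
  -- Uses (1 + w)² - 1 ≥ 2w together with B² ≥ r² b.
  have h1 : c * b * w ≤ (c * Q - c * B ^ 2) / (2 * r ^ 2) := by
    rw [le_div_iff₀ (by positivity), hQw]
    have h3 : b * r ^ 2 ≤ B ^ 2 := by nlinarith [sq_nonneg S]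
    have h2 : c * (w * (b * r ^ 2)) ≤ c * (w * B ^ 2) := by gcongr
    nlinarith [mul_nonneg hc.le (mul_nonneg (sq_nonneg w) (sq_nonneg B))]
  -- The inequality z ≤ exp(z - 1) is the source of the constant exp(-1).
  have h2 : c * b * w ≤ Real.exp (c * b * w - 1) := by
    have := Real.add_one_le_exp (c * b * w - 1)
    linarith
  have h3 : Real.exp (c * b * w - 1) ≤ Real.exp (-1) * Real.exp (-(c * b) / 2)
        * Real.exp ((c * Q - c * S ^ 2) / (2 * r ^ 2)) := by
    rw [← Real.exp_add, ← Real.exp_add, Real.exp_le_exp]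
    have h4 : (c * Q - c * B ^ 2) / (2 * r ^ 2)
        ≤ -(c * b) / 2 + (c * Q - c * S ^ 2) / (2 * r ^ 2) := by
      rw [div_add_div _ _ two_ne_zero (by positivity), div_le_div_iff₀ (by positivity) (by positivity)]
      have := mul_le_mul_of_nonneg_left hB2 (show 0 ≤ c * (4 * r ^ 2) by positivity)
      nlinarith
    linarith
  rw [div_mul_eq_mul_div, div_mul_eq_mul_div, le_div_iff₀ (by positivity)]
  calc w * (c * b) = c * b * w := by ring
    _ ≤ _ := h2.trans h3

theorem trace_ridge_one (h : Hist C A n) :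
    (ridge X 1 h).trace = d + ∑ s : Fin n, ‖X (h.1 s).2.1‖ ^ 2 := by
  rw [ridge, one_smul, Matrix.trace_add, Matrix.trace_one, Matrix.trace_sum, Fintype.card_fin]
  simp_rw [Matrix.trace_vecMulVec, norm_sq_eq_dotProduct]

/-- The sum is the trace of V⁻¹(V - 1), that is, d minus the nonnegative trace of V⁻¹. -/
theorem sum_stepVar_le (h : Hist C A n) : ∑ s : Fin n, stepVar X 1 h (h.1 s).2.1 ≤ d := by
  have hV := posDef_ridge (X := X) one_pos h
  have h1 : ∑ s : Fin n, stepVar X 1 h (h.1 s).2.1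
      = ((ridge X 1 h)⁻¹ * (ridge X 1 h - 1)).trace := by
    rw [show ridge X 1 h - 1
      = ∑ s : Fin n, Matrix.vecMulVec (X (h.1 s).2.1).ofLp (X (h.1 s).2.1).ofLp by
        rw [ridge, one_smul, add_sub_cancel_left], Matrix.mul_sum, Matrix.trace_sum]
    exact Finset.sum_congr rfl fun s _ => (trace_mul_vecMulVec _).symm
  rw [h1, mul_sub, Matrix.nonsing_inv_mul _ (posDef_isUnit_det hV), mul_one, Matrix.trace_sub,
    Matrix.trace_one, Fintype.card_fin]
  have := hV.inv.posSemidef.trace_nonneg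
  linarith

theorem residualForm_zero (h : Hist C A 0) (θ : EuclideanSpace ℝ (Fin d)) :
    residualForm X 1 h θ = ‖θ‖ ^ 2 := by
  have h1 : ridge X 1 h = 1 := by simp [ridge]
  have h2 : residual X h θ = -θ.ofLp := by simp [residual]
  rw [residualForm, h1, h2, inv_one, Matrix.one_mulVec, neg_dotProduct_neg, norm_sq_eq_dotProduct]

theorem stepVar_zero (h : Hist C A 0) (a : A) : stepVar X 1 h a = ‖X a‖ ^ 2 := by
  have h1 : ridge X 1 h = 1 := by simp [ridge]
  rw [stepVar, h1, inv_one, Matrix.one_mulVec, norm_sq_eq_dotProduct]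

/-- Before any data the residual is -θ, which the summand S of the width covers. -/
theorem linExcess_zero (hr : 0 ≤ r) {θ : EuclideanSpace ℝ (Fin d)} (hθ : ‖θ‖ ≤ S)
    (h : Hist C A 0) : linExcess X T r S L (h, θ) = 0 := by
  rw [linExcess, residualForm_zero, Real.sqrt_sq (norm_nonneg _)]
  have h1 : ‖θ‖ ≤ sqrtBeta d T r S L 0 := by
    rw [sqrtBeta]
    have : 0 ≤ r * √(d * Real.log ((T : ℝ) ^ 2 * (1 + (0 : ℕ) * L))) := by positivity
    linarith
  have h2 := div_le_one_of_le₀ h1 ((norm_nonneg _).trans h1)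
  exact max_eq_left (by linarith)

variable [MeasurableSpace C] [MeasurableSpace A]

theorem measurable_linExcess (hX : Measurable X) :
    Measurable (linExcess X T r S L : Hist C A n × EuclideanSpace ℝ (Fin d) → ℝ) :=
  measurable_const.max ((((measurable_residualForm hX 1).sqrt).div_const _).sub_const _)

theorem measurable_radius_lin (hX : Measurable X) (hβ : 0 ≤ sqrtBeta d T r S L n) :
    Measurable fun p : Hist C A n × A => radius (linMuHat X) (linU X T r S L) p.1 p.2 := by
  simp_rw [radius_lin hβ]
  exact (measurable_stepVar hX 1).sqrt.const_mul _

end Linear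

/-! ### The expected excess of the ellipsoid. -/

section ExpectedExcess

variable {C A : Type*} {d n m : ℕ} {X : A → EuclideanSpace ℝ (Fin d)} {T : ℕ} {S L : ℝ}
  {Ω : Type*} [MeasurableSpace Ω] [MeasurableSpace C] [MeasurableSpace A]
  {P : Measure Ω} [IsProbabilityMeasure P]
  {q : Measure (EuclideanSpace ℝ (Fin d))} {ν : Kernel (EuclideanSpace ℝ (Fin d) × A) ℝ}
  [IsMarkovKernel ν] {R : Run Ω C A (EuclideanSpace ℝ (Fin d)) m}
  {Θ : Set (EuclideanSpace ℝ (Fin d))} {r : ℝ≥0}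

theorem lintegral_const_mul_mixture_le (hX : Measurable X) {κ : ℝ} (hκ : 0 < κ) (hr : 0 < r)
    (hS : ∀ θ ∈ Θ, ‖θ‖ ≤ S)
    (hR : IsBanditRun P q ν R) (hΘ : ∀ᵐ ω ∂P, R.param ω ∈ Θ)
    (hν : ∀ θ ∈ Θ, ∀ a, HasSubgaussianMGF (fun y => y - linMean X θ a) (r ^ 2) (ν (θ, a)))
    {a : ℝ} (ha : 0 ≤ a) (n : ℕ) :
    ∫⁻ ω, ENNReal.ofReal (a * Real.exp (-(S ^ 2 / κ / (2 * (r : ℝ) ^ 2)))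
        * mixture X κ r (R.hist n ω) (R.param ω)) ∂P ≤ ENNReal.ofReal (a / √(κ ^ d)) := by
  have h0 : 0 ≤ a * Real.exp (-(S ^ 2 / κ / (2 * (r : ℝ) ^ 2))) := by positivity
  have hm : Measurable fun ω => ENNReal.ofReal (mixture X κ r (R.hist n ω) (R.param ω)) :=
    (Measurable.comp (g := fun p : Hist C A n × EuclideanSpace ℝ (Fin d) => mixture X κ r p.1 p.2)
      (f := fun ω => (R.hist n ω, R.param ω)) (measurable_mixture hX κ r)
      ((hR.measurable_hist n).prodMk hR.measurable_param)).ennreal_ofReal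
  simp_rw [ENNReal.ofReal_mul h0]
  rw [lintegral_const_mul _ hm]
  refine (mul_le_mul_right (lintegral_mixture_le hX hκ hr hS hR hΘ hν n) _).trans ?_
  rw [← ENNReal.ofReal_mul h0]
  refine ENNReal.ofReal_le_ofReal (le_of_eq ?_)
  rw [mul_assoc, mul_div_assoc', ← Real.exp_add, neg_add_cancel, Real.exp_zero, mul_one_div]

omit [MeasurableSpace C] [MeasurableSpace A] in
-- The regularisation κ of the mixture may differ from the 1 of the algorithm as long as the two
-- forms are proportional. The condition 1/κ ≤ c lets c S² pay for S²/κ, the starting value of the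
-- mixture.
theorem linExcess_le_mixture (hr : 0 < r) (hS0 : 0 ≤ S) {b c κ : ℝ}
    (hb : b = d * Real.log ((T : ℝ) ^ 2 * (1 + n * L))) (hb0 : 0 < b) (hκ : 0 < κ) (hc : 0 < c)
    (hcκ : 1 / κ ≤ c) (h : Hist C A n) (θ : EuclideanSpace ℝ (Fin d))
    (hQ : c * residualForm X 1 h θ = residualForm X κ h θ) :
    linExcess X T r S L (h, θ) ≤ Real.exp (-1) / (c * b) * Real.exp (-(c * b) / 2)
      * √(ridge X κ h).det * Real.exp (-(S ^ 2 / κ / (2 * (r : ℝ) ^ 2))) * mixture X κ r h θ := by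
  have h1 := sqrt_div_sub_one_le_exp (c := c) (r := r) (S := S)
    (residualForm_nonneg (X := X) one_pos h θ) hb0 hc hr hS0
  have h2 : √(ridge X κ h).det ≠ 0 := (Real.sqrt_pos.2 (posDef_ridge hκ _).det_pos).ne'
  rw [linExcess, sqrtBeta, ← hb]
  refine h1.trans ?_
  have h3 : Real.exp ((c * residualForm X 1 h θ - c * S ^ 2) / (2 * (r : ℝ) ^ 2))
      ≤ Real.exp (-(S ^ 2 / κ / (2 * (r : ℝ) ^ 2)))
        * Real.exp (residualForm X κ h θ / (2 * (r : ℝ) ^ 2)) := by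
    rw [← Real.exp_add, hQ, ← neg_div, ← add_div]
    have : S ^ 2 / κ ≤ c * S ^ 2 := by
      rw [div_eq_mul_one_div, mul_comm]
      gcongr
    gcongr
    linarith
  calc _ ≤ Real.exp (-1) / (c * b) * Real.exp (-(c * b) / 2)
        * (Real.exp (-(S ^ 2 / κ / (2 * (r : ℝ) ^ 2)))
        * Real.exp (residualForm X κ h θ / (2 * (r : ℝ) ^ 2))) := by gcongr
    _ = _ := by rw [mixture]; field_simp

theorem lintegral_linExcess_le (hX : Measurable X) (hr : 0 < r) (hS0 : 0 ≤ S)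
    (hS : ∀ θ ∈ Θ, ‖θ‖ ≤ S) (hR : IsBanditRun P q ν R) (hΘ : ∀ᵐ ω ∂P, R.param ω ∈ Θ)
    (hν : ∀ θ ∈ Θ, ∀ a, HasSubgaussianMGF (fun y => y - linMean X θ a) (r ^ 2) (ν (θ, a)))
    {b D : ℝ} (hb : b = d * Real.log ((T : ℝ) ^ 2 * (1 + n * L))) (hb0 : 0 < b)
    (hD : ∀ᵐ ω ∂P, (ridge X 1 (R.hist n ω)).det ≤ D ^ d) :
    ∫⁻ ω, ENNReal.ofReal (linExcess X T r S L (R.hist n ω, R.param ω)) ∂P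
      ≤ ENNReal.ofReal (Real.exp (-1) / b * Real.exp (-b / 2) * √(D ^ d)) := by
  have ha : 0 ≤ Real.exp (-1) / b * Real.exp (-b / 2) * √(D ^ d) := by positivity
  have h := lintegral_const_mul_mixture_le hX one_pos hr hS hR hΘ hν ha n
  rw [one_pow, Real.sqrt_one, div_one (_ * _ : ℝ)] at h
  refine le_trans (lintegral_mono_ae ?_) h
  filter_upwards [hD] with ω hω
  refine ENNReal.ofReal_le_ofReal ?_
  have h1 := linExcess_le_mixture (X := X) (T := T) (L := L) hr hS0 hb hb0 one_pos one_pos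
    (by norm_num) (R.hist n ω) (R.param ω) (one_mul _)
  refine h1.trans ?_
  rw [one_mul]
  have := mixture_nonneg (X := X) (κ := 1) r (R.hist n ω) (R.param ω)
  gcongr

section OneDimensional

variable {X : A → EuclideanSpace ℝ (Fin 1)} {q : Measure (EuclideanSpace ℝ (Fin 1))}
  {ν : Kernel (EuclideanSpace ℝ (Fin 1) × A) ℝ} [IsMarkovKernel ν]
  {R : Run Ω C A (EuclideanSpace ℝ (Fin 1)) m} {Θ : Set (EuclideanSpace ℝ (Fin 1))}

omit [MeasurableSpace C] [MeasurableSpace A] in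
theorem det_ridge_fin_one (κ : ℝ) (h : Hist C A n) :
    (ridge X κ h).det = κ + ∑ s : Fin n, ‖X (h.1 s).2.1‖ ^ 2 := by
  rw [Matrix.det_fin_one, ridge, Matrix.add_apply, Matrix.sum_apply]
  simp [Matrix.vecMulVec_apply, norm_sq_eq_dotProduct, dotProduct]

omit [MeasurableSpace C] [MeasurableSpace A] in
-- In dimension one the inverse is a scalar, so forms with different κ are proportional; this
-- provides the factor c.
theorem det_mul_residualForm_fin_one {κ : ℝ} (hκ : 0 < κ) (h : Hist C A n)
    (θ : EuclideanSpace ℝ (Fin 1)) :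
    (ridge X κ h).det * residualForm X κ h θ = residual X h θ 0 ^ 2 := by
  have hV := posDef_ridge (X := X) hκ h
  have h1 := congrFun (mulVec_inv_mulVec hV (residual X h θ)) 0
  have h2 : residualForm X κ h θ
      = residual X h θ 0 * ((ridge X κ h)⁻¹ *ᵥ residual X h θ) 0 := by
    rw [residualForm]; simp [dotProduct]
  rw [Matrix.mulVec, dotProduct, Fin.sum_univ_one] at h1
  rw [h2, Matrix.det_fin_one, mul_left_comm, h1, sq]

/-- In dimension one, two mixtures at different scales improve the bound for large designs. -/
theorem lintegral_linExcess_fin_one_le (hX : Measurable X) (hr : 0 < r) (hS0 : 0 ≤ S)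
    (hS : ∀ θ ∈ Θ, ‖θ‖ ≤ S) (hR : IsBanditRun P q ν R) (hΘ : ∀ᵐ ω ∂P, R.param ω ∈ Θ)
    (hν : ∀ θ ∈ Θ, ∀ a, HasSubgaussianMGF (fun y => y - linMean X θ a) (r ^ 2) (ν (θ, a)))
    {b D M κ c : ℝ} (hb : b = (1 : ℕ) * Real.log ((T : ℝ) ^ 2 * (1 + n * L))) (hb0 : 0 < b)
    (hM : 0 ≤ M) (hκ : 1 ≤ κ) (hc : c = (1 + M) / (κ + M))
    (hD : ∀ ω, ∑ s : Fin n, ‖X ((R.hist n ω).1 s).2.1‖ ^ 2 ≤ D) :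
    ∫⁻ ω, ENNReal.ofReal (linExcess X T r S L (R.hist n ω, R.param ω)) ∂P
      ≤ ENNReal.ofReal (Real.exp (-1) / b * Real.exp (-b / 2) * √(1 + M)
        + Real.exp (-1) / (c * b) * Real.exp (-(c * b) / 2) * √(κ + D) / √κ) := by
  have hκ0 : 0 < κ := by linarith
  have hc0 : 0 < c := by rw [hc]; positivity
  set a₁ := Real.exp (-1) / b * Real.exp (-b / 2) * √(1 + M) with ha₁
  set a₂ := Real.exp (-1) / (c * b) * Real.exp (-(c * b) / 2) * √(κ + D) with ha₂
  have ha₁0 : 0 ≤ a₁ := by positivity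
  have ha₂0 : 0 ≤ a₂ := by positivity
  have i₁ := lintegral_const_mul_mixture_le hX one_pos hr hS hR hΘ hν ha₁0 n
  have i₂ := lintegral_const_mul_mixture_le hX hκ0 hr hS hR hΘ hν ha₂0 n
  rw [one_pow, Real.sqrt_one, div_one (_ * _ : ℝ)] at i₁
  rw [pow_one] at i₂
  rw [ENNReal.ofReal_add ha₁0 (by positivity)]
  have hm : ∀ κ : ℝ, Measurable fun ω => mixture X κ r (R.hist n ω) (R.param ω) := fun κ =>
    Measurable.comp (g := fun p : Hist C A n × EuclideanSpace ℝ (Fin 1) => mixture X κ r p.1 p.2)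
      (f := fun ω => (R.hist n ω, R.param ω)) (measurable_mixture hX κ r)
      ((hR.measurable_hist n).prodMk hR.measurable_param)
  refine le_trans ?_ (add_le_add i₁ i₂)
  rw [← lintegral_add_left ((hm 1).const_mul _).ennreal_ofReal]
  refine lintegral_mono fun ω => ?_
  have m₁ := mixture_nonneg (X := X) (κ := 1) r (R.hist n ω) (R.param ω)
  have m₂ := mixture_nonneg (X := X) (κ := κ) r (R.hist n ω) (R.param ω)
  rw [← ENNReal.ofReal_add (by positivity) (by positivity)]
  refine ENNReal.ofReal_le_ofReal ?_
  set g := ∑ s : Fin n, ‖X ((R.hist n ω).1 s).2.1‖ ^ 2 with hg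
  have hg0 : 0 ≤ g := Finset.sum_nonneg fun _ _ => sq_nonneg _
  -- For a small design κ = 1 is used, with determinant at most 1 + M. For a large one κ is used,
  -- whose starting value 1/√κ offsets the larger determinant.
  rcases le_or_gt g M with hgM | hgM
  · have h1 := linExcess_le_mixture (X := X) (T := T) (L := L) hr hS0 hb hb0 one_pos one_pos
      (by norm_num) (R.hist n ω) (R.param ω) (one_mul _)
    refine h1.trans ?_
    rw [one_mul, det_ridge_fin_one, ← hg]
    refine le_trans ?_ (le_add_of_nonneg_right (by positivity))
    rw [ha₁]
    gcongr
  · have hg1 : 0 < κ + g := by positivity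
    -- As κ ≥ 1, the quotient (1 + g)/(κ + g) increases with g, so its value at M is a lower bound.
    have hcg : c ≤ (1 + g) / (κ + g) := by
      rw [hc, div_le_div_iff₀ (by positivity) hg1]
      nlinarith
    have hκg : 1 / κ ≤ (1 + g) / (κ + g) := by
      rw [div_le_div_iff₀ hκ0 hg1]
      nlinarith
    have e₁ := det_mul_residualForm_fin_one (X := X) one_pos (R.hist n ω) (R.param ω)
    have e₂ := det_mul_residualForm_fin_one (X := X) hκ0 (R.hist n ω) (R.param ω)
    rw [det_ridge_fin_one, ← hg] at e₁ e₂
    have h1 := linExcess_le_mixture (X := X) (T := T) (L := L) hr hS0 hb hb0 hκ0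
      (c := (1 + g) / (κ + g)) (by positivity) hκg (R.hist n ω) (R.param ω)
      (by rw [div_mul_eq_mul_div, e₁, ← e₂, mul_div_cancel_left₀ _ hg1.ne'])
    refine h1.trans ?_
    rw [det_ridge_fin_one, ← hg]
    refine le_trans ?_ (le_add_of_nonneg_left (by positivity))
    rw [ha₂]
    have := hD ω
    gcongr

end OneDimensional

end ExpectedExcess

/-! ### Numerical bounds of the excess. -/

section Numerics

theorem exp_neg_one_le : Real.exp (-1) ≤ 0.368 := by
  rw [Real.exp_neg]
  have h := Real.exp_one_gt_d9
  calc (Real.exp 1)⁻¹ ≤ (2.7182818283 : ℝ)⁻¹ := by gcongr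
    _ ≤ _ := by norm_num

theorem exp_half_le : Real.exp (1 / 2) ≤ 1.65 := by
  have h : Real.exp (1 / 2) * Real.exp (1 / 2) = Real.exp 1 := by
    rw [← Real.exp_add]; norm_num
  have := Real.exp_one_lt_d9
  nlinarith [Real.exp_pos (1 / 2)]

/-- With b = d log w, exp(-b/2) is w^(-d/2): the width competes with the determinant bound D^d
factor by factor. -/
theorem exp_neg_log_mul_sqrt_pow {w D : ℝ} (hw : 0 < w) (d : ℕ) :
    Real.exp (-(d * Real.log w) / 2) * √(D ^ d) = √((D / w) ^ d) := by
  have h : Real.exp (-(d * Real.log w) / 2) = √((1 / w) ^ d) := by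
    rw [Real.exp_half, ← mul_neg, ← Real.log_inv, Real.exp_nat_mul, Real.exp_log (by positivity),
      one_div]
  rw [h, ← Real.sqrt_mul (by positivity), ← mul_pow]
  congr 2
  ring

theorem sub_one_div_le_log {t : ℝ} (ht : 0 < t) : (t - 1) / t ≤ Real.log t := by
  have := Real.one_sub_inv_le_log_of_pos ht
  rwa [sub_div, div_self ht.ne', one_div]

theorem log_sq_mul {t y : ℝ} (ht : 0 < t) (hy : 0 ≤ y) :
    Real.log (t ^ 2 * (1 + y)) = 2 * Real.log t + Real.log (1 + y) := by
  rw [Real.log_mul (by positivity) (by positivity), Real.log_pow]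
  norm_num

variable {d : ℕ} {t y b D : ℝ}

/-- Dimension at least two: the bound of the excess for a design with `D ≤ 2 t (1 + y)`. -/
theorem excess_bound_of_le (hd : 2 ≤ d) (ht : 2 ≤ t) (hy : 0 ≤ y)
    (hb : b = d * Real.log (t ^ 2 * (1 + y))) (hD0 : 0 ≤ D) (hD : D ≤ 2 * t * (1 + y)) :
    Real.exp (-1) / b * Real.exp (-b / 2) * √(D ^ d) ≤ 1 / (2 * (t - 1)) := by
  have ht0 : 0 < t := by linarith
  have ht1 : 0 < t - 1 := by linarith
  have hw : 0 < t ^ 2 * (1 + y) := by positivity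
  have hq : D / (t ^ 2 * (1 + y)) ≤ 2 / t := by
    rw [div_le_div_iff₀ hw ht0]
    nlinarith
  have hq1 : 2 / t ≤ 1 := (div_le_one ht0).2 ht
  have hq0 : 0 ≤ D / (t ^ 2 * (1 + y)) := by positivity
  have hs : √((D / (t ^ 2 * (1 + y))) ^ d) ≤ 2 / t := by
    rw [Real.sqrt_le_left (by positivity)]
    calc (D / (t ^ 2 * (1 + y))) ^ d ≤ (D / (t ^ 2 * (1 + y))) ^ 2 :=
          pow_le_pow_of_le_one hq0 (hq.trans hq1) hd
      _ ≤ _ := by gcongr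
  have hl : 2 * ((t - 1) / t) ≤ Real.log (t ^ 2 * (1 + y)) := by
    rw [log_sq_mul ht0 hy]
    have := sub_one_div_le_log ht0
    have := Real.log_nonneg (by linarith : 1 ≤ 1 + y)
    linarith
  have hu : 0 < (t - 1) / t := by positivity
  have hb4 : 4 * ((t - 1) / t) ≤ b := by
    have hd' : (2 : ℝ) ≤ d := by exact_mod_cast hd
    rw [hb]
    nlinarith
  have hb0 : 0 < b := by linarith
  rw [mul_assoc, hb, exp_neg_log_mul_sqrt_pow hw, ← hb]
  calc Real.exp (-1) / b * √((D / (t ^ 2 * (1 + y))) ^ d)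
      ≤ 1 / (4 * ((t - 1) / t)) * (2 / t) := by
        have := exp_neg_one_le
        gcongr
        linarith
    _ = _ := by field_simp; norm_num

/-- Dimension at least two: the bound of the excess for large actions. -/
theorem excess_bound_of_large (hd : 2 ≤ d) (ht : 2 ≤ t) (hy : 4 * t ≤ y)
    (hb : b = d * Real.log (t ^ 2 * (1 + y))) (hD0 : 0 ≤ D)
    (hD : D ≤ 1 + 4 * (t - 1) ^ 2 * (Real.log (t ^ 2 * (1 + y)) / Real.log (t ^ 2))) :
    Real.exp (-1) / b * Real.exp (-b / 2) * √(D ^ d) ≤ 1 / (2 * (t - 1)) := by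
  have ht0 : 0 < t := by linarith
  have ht1 : 0 < t - 1 := by linarith
  have hy0 : 0 ≤ y := by linarith
  have hw : 0 < t ^ 2 * (1 + y) := by positivity
  have hl2 : Real.log (t ^ 2) = 2 * Real.log t := by rw [Real.log_pow]; norm_num
  have hlt := sub_one_div_le_log ht0
  have hu : 0 < (t - 1) / t := by positivity
  -- Here y ≥ 8, so the tangent of the logarithm at 9 is sharp enough.
  have hly : Real.log (1 + y) ≤ (y - 3) / 2 := by
    have h9 : Real.log 9 ≤ 2.2 := by
      rw [show (9 : ℝ) = 3 ^ 2 by norm_num, Real.log_pow]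
      have : Real.log 3 ≤ 1.1 := by
        rw [Real.log_le_iff_le_exp (by norm_num)]
        have h1 := Real.exp_one_gt_d9
        have h2 := Real.add_one_le_exp (0.1 + 0.005 : ℝ)
        have h3 : Real.exp (1.1 : ℝ) = Real.exp 1 * Real.exp 0.1 := by
          rw [← Real.exp_add]; norm_num
        have h4 := Real.quadratic_le_exp_of_nonneg (by norm_num : (0 : ℝ) ≤ 0.1)
        rw [h3]
        nlinarith
      norm_num
      linarith
    have h1 := Real.log_le_sub_one_of_pos (x := (1 + y) / 9) (by positivity)
    rw [Real.log_div (by positivity) (by norm_num)] at h1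
    linarith
  have hly1 : 1 ≤ Real.log (1 + y) := by
    rw [Real.le_log_iff_exp_le (by positivity)]
    have := Real.exp_one_lt_d9
    linarith
  set ℓ := Real.log (t ^ 2 * (1 + y)) with hℓ
  have hℓe : ℓ = 2 * Real.log t + Real.log (1 + y) := log_sq_mul ht0 hy0
  have hlog : 0 < Real.log t := hu.trans_le hlt
  have hℓ1 : 1 ≤ ℓ := by linarith
  have hinv : ((t - 1) / Real.log t) ≤ t := by
    rw [div_le_iff₀ hlog]
    rw [div_le_iff₀ ht0] at hlt
    linarith
  have hD1 : D ≤ 1 + 2 * (t - 1) * t * ℓ := by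
    refine hD.trans ?_
    rw [hl2]
    have : 4 * (t - 1) ^ 2 * (ℓ / (2 * Real.log t))
        = 2 * (t - 1) * ((t - 1) / Real.log t) * ℓ := by field_simp; norm_num
    rw [this]
    gcongr
  have hD2 : D ≤ t ^ 2 * (1 + y) := by
    refine hD.trans ?_
    rw [hl2, hℓe, add_div, div_self (by positivity)]
    have : 4 * (t - 1) ^ 2 * (1 + Real.log (1 + y) / (2 * Real.log t))
        = 4 * (t - 1) ^ 2 + 2 * (t - 1) * ((t - 1) / Real.log t) * Real.log (1 + y) := by
      field_simp; ring
    rw [this]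
    have h2 : 2 * (t - 1) * ((t - 1) / Real.log t) * Real.log (1 + y)
        ≤ 2 * t * t * ((y - 3) / 2) := by
      gcongr
      linarith
    nlinarith
  have hq0 : 0 ≤ D / (t ^ 2 * (1 + y)) := by positivity
  have hs : √((D / (t ^ 2 * (1 + y))) ^ d) ≤ D / (t ^ 2 * (1 + y)) := by
    rw [Real.sqrt_le_left hq0]
    exact pow_le_pow_of_le_one hq0 ((div_le_one hw).2 hD2) hd
  have hb2 : 2 * ℓ ≤ b := by
    have hd' : (2 : ℝ) ≤ d := by exact_mod_cast hd
    rw [hb]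
    nlinarith
  have hb0 : 0 < b := by linarith
  have hb' : -b / 2 = -(d * Real.log (t ^ 2 * (1 + y))) / 2 := by rw [hb]
  rw [mul_assoc, hb', exp_neg_log_mul_sqrt_pow hw]
  calc Real.exp (-1) / b * √((D / (t ^ 2 * (1 + y))) ^ d)
      ≤ 1 / (2 * ℓ) * ((1 + 2 * (t - 1) * t * ℓ) / (t ^ 2 * (4 * t))) := by
        have := exp_neg_one_le
        have : D / (t ^ 2 * (1 + y)) ≤ (1 + 2 * (t - 1) * t * ℓ) / (t ^ 2 * (4 * t)) := by
          gcongr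
          linarith
        have := hs.trans this
        gcongr
        linarith
    _ ≤ _ := by
        rw [div_mul_div_comm, div_le_div_iff₀ (by positivity) (by positivity)]
        have h1 : (t - 1) * (1 + 2 * (t - 1) * t * ℓ) ≤ t * (t * ℓ + 2 * (t - 1) * t * ℓ) := by
          gcongr
          · linarith
          · nlinarith
        nlinarith [mul_pos (mul_pos ht0 ht0) (by linarith : 0 < ℓ), mul_pos ht0 ht0]

/-- Dimension one, small logarithm. -/
theorem excess_bound_fin_one_of_lt {L : ℝ} {n : ℕ} (hn : 1 ≤ n) (ht : 2 ≤ t) (hL : 0 ≤ L)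
    (hb : b = (1 : ℕ) * Real.log (t ^ 2 * (1 + n * L))) (hb4 : b < 4)
    (hD : D ≤ 1 + n * L ^ 2) :
    Real.exp (-1) / b * Real.exp (-b / 2) * √(D ^ 1) ≤ 1 / (2 * (t - 1)) := by
  have ht0 : 0 < t := by linarith
  have ht1 : 0 < t - 1 := by linarith
  have hn' : (1 : ℝ) ≤ n := by exact_mod_cast hn
  have hy : 0 ≤ n * L := by positivity
  have hw : 0 < t ^ 2 * (1 + n * L) := by positivity
  have hlt := sub_one_div_le_log ht0
  set u := (t - 1) / t with hu
  have hu0 : 0 < u := by positivity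
  have hu1 : u ≤ 1 := (div_le_one ht0).2 (by linarith)
  have hbe : b = 2 * Real.log t + Real.log (1 + n * L) := by
    rw [hb, log_sq_mul ht0 hy]; simp
  have hLn : Real.log (1 + L) ≤ Real.log (1 + n * L) :=
    Real.log_le_log (by positivity) (by nlinarith)
  have hL0 : 0 ≤ Real.log (1 + L) := Real.log_nonneg (by linarith)
  have hb0 : 0 < b := by linarith
  -- The maximum with 1 covers small L, where D need not be bounded by L(1 + nL).
  set N := max 1 L with hN
  have hN1 : 1 ≤ N := le_max_left _ _
  have hNL : L ≤ N := le_max_right _ _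
  have hq : D / (t ^ 2 * (1 + n * L)) ≤ N / t ^ 2 := by
    rw [div_le_div_iff₀ hw (by positivity)]
    have : D ≤ N * (1 + n * L) := by
      have : n * L * L ≤ n * L * N := by gcongr
      nlinarith
    nlinarith [mul_le_mul_of_nonneg_right this (sq_nonneg t)]
  have hs : √((D / (t ^ 2 * (1 + n * L))) ^ 1) ≤ √N / t := by
    rw [pow_one]
    refine (Real.sqrt_le_sqrt hq).trans (le_of_eq ?_)
    rw [Real.sqrt_div (by linarith), Real.sqrt_sq ht0.le]
  have key : 2 * u * √N ≤ Real.exp 1 * b := by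
    have he := Real.exp_one_gt_d9
    rcases le_or_gt (√N) (Real.exp 1) with h | h
    · have : u * √N ≤ u * Real.exp 1 := by gcongr
      nlinarith
    · have hNe : Real.exp 2 < N := by
        have := (Real.lt_sqrt (by positivity)).1 h
        rwa [← Real.exp_nat_mul, Nat.cast_ofNat, mul_one] at this
      have hNL : N = L := by
        refine max_eq_right (le_of_not_gt fun hlt => ?_)
        rw [hN, max_eq_left hlt.le] at hNe
        have := Real.one_lt_exp_iff.2 (by norm_num : (0 : ℝ) < 2)
        linarith
      rw [hNL] at hNe ⊢
      -- Now log(1 + L) lies between 2 and 3, the upper bound following from b < 4 and 2 log 2 > 1.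
      -- Hence √L ≤ 2e, whereas b ≥ 2u + 2 ≥ 4u.
      have h2 : 2 ≤ Real.log (1 + L) := by
        rw [Real.le_log_iff_exp_le (by positivity)]
        linarith
      have h3 : 1 + L < Real.exp 3 := by
        rw [← Real.log_lt_iff_lt_exp (by positivity)]
        have hl2 : Real.log 2 ≤ Real.log t := Real.log_le_log (by norm_num) ht
        have := Real.log_two_gt_d9
        linarith
      have h4 : √L ≤ 2 * Real.exp 1 := by
        rw [Real.sqrt_le_left (by positivity)]
        have he3 : Real.exp 3 = Real.exp 1 * Real.exp 1 ^ 2 := by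
          rw [← Real.exp_nat_mul, ← Real.exp_add]; norm_num
        have := Real.exp_one_lt_d9
        nlinarith [sq_nonneg (Real.exp 1)]
      have : u * √L ≤ u * (2 * Real.exp 1) := by gcongr
      nlinarith
  have hb' : -b / 2 = -((1 : ℕ) * Real.log (t ^ 2 * (1 + n * L))) / 2 := by rw [hb]
  rw [mul_assoc, hb', exp_neg_log_mul_sqrt_pow hw]
  calc Real.exp (-1) / b * √((D / (t ^ 2 * (1 + n * L))) ^ 1)
      ≤ Real.exp (-1) / b * (√N / t) := by gcongr
    _ ≤ _ := by
        rw [Real.exp_neg, ← one_div, div_div, div_mul_div_comm, one_mul,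
          div_le_div_iff₀ (by positivity) (by positivity)]
        have : u * t = t - 1 := by rw [hu]; field_simp
        rw [← this]
        nlinarith [mul_le_mul_of_nonneg_right key ht0.le]

/-- Dimension one, large logarithm. -/
theorem excess_bound_fin_one_of_le {L : ℝ} {n : ℕ} (hn : 1 ≤ n) (ht : 2 ≤ t) (hL : 0 ≤ L)
    (hb : b = (1 : ℕ) * Real.log (t ^ 2 * (1 + n * L))) (hb4 : 4 ≤ b) {M κ c : ℝ}
    (hM : M = n * L * b / 2) (hκ : κ = 1 + M / b) (hc : c = (1 + M) / (κ + M)) :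
    Real.exp (-1) / b * Real.exp (-b / 2) * √(1 + M)
      + Real.exp (-1) / (c * b) * Real.exp (-(c * b) / 2) * √(κ + n * L ^ 2) / √κ
      ≤ 1 / (2 * (t - 1)) := by
  have ht0 : 0 < t := by linarith
  have ht1 : 0 < t - 1 := by linarith
  have hn' : (1 : ℝ) ≤ n := by exact_mod_cast hn
  have hy : 0 ≤ n * L := by positivity
  have hb0 : 0 < b := by linarith
  have hw : 0 < t ^ 2 * (1 + n * L) := by positivity
  have hM0 : 0 ≤ M := by rw [hM]; positivity
  have hκ1 : 1 ≤ κ := by rw [hκ]; have : 0 ≤ M / b := by positivity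
                         linarith
  have hκ0 : 0 < κ := by linarith
  have hcb : b / (1 + b) ≤ c := by
    rw [hc, div_le_div_iff₀ (by positivity) (by positivity)]
    have : b * κ = b + M := by rw [hκ]; field_simp
    nlinarith
  have hc0 : 0 < c := lt_of_lt_of_le (by positivity) hcb
  have hcinv : 1 / (c * b) ≤ 5 / 4 / b := by
    rw [div_le_div_iff₀ (by positivity) hb0]
    have : 4 / 5 ≤ c := by
      refine le_trans ?_ hcb
      rw [div_le_div_iff₀ (by norm_num) (by positivity)]
      linarith
    nlinarith
  -- Lowering c from 1 reduces cb by at most 1, at the price of a factor exp(1/2).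
  have hcexp : Real.exp (-(c * b) / 2) ≤ Real.exp (-b / 2) * Real.exp (1 / 2) := by
    rw [← Real.exp_add, Real.exp_le_exp]
    have h1 : b / (1 + b) * b ≤ c * b := by gcongr
    have h2 : b - 1 ≤ b / (1 + b) * b := by
      rw [div_mul_eq_mul_div, le_div_iff₀ (by positivity)]
      nlinarith
    linarith
  -- The choice of M and κ gives κM = M + nL² · nb/4; this is where b ≥ 4 is needed.
  have hsq : √(κ + n * L ^ 2) / √κ ≤ √(1 + M) := by
    rw [← Real.sqrt_div (by positivity)]
    refine Real.sqrt_le_sqrt ?_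
    rw [div_le_iff₀ hκ0]
    have h1 : κ * M = M + M ^ 2 / b := by rw [hκ]; ring
    have h2 : M ^ 2 / b = (n * L ^ 2) * (n * b / 4) := by rw [hM]; field_simp; norm_num
    have h3 : 1 ≤ n * b / 4 := by nlinarith
    have h4 : (n * L ^ 2) * 1 ≤ (n * L ^ 2) * (n * b / 4) := by gcongr
    nlinarith
  have hE := exp_neg_log_mul_sqrt_pow (D := 1) hw 1
  rw [← hb, one_pow, Real.sqrt_one, mul_one, pow_one] at hE
  set ε := Real.exp (-b / 2) with hε
  have hε0 : 0 < ε := Real.exp_pos _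
  -- The value 2.3 works since 2.3² b ≤ 2b² for b ≥ 4; the final constant 0.368 · 3.0625 / 2.3 is
  -- about 0.49, below 1/2.
  have hfin : √(1 + M) * ε * 2.3 ≤ b / t := by
    rw [hE, ← Real.sqrt_mul (by positivity), ← le_div_iff₀ (by norm_num),
      Real.sqrt_le_left (by positivity), mul_one_div, div_le_iff₀ hw]
    have : (b / t / 2.3) ^ 2 * (t ^ 2 * (1 + n * L)) = b ^ 2 * (1 + n * L) / 5.29 := by
      field_simp; norm_num
    rw [this, hM, le_div_iff₀ (by norm_num)]
    have h1 : n * L * (5.29 * b) ≤ n * L * (2 * b ^ 2) :=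
      mul_le_mul_of_nonneg_left (by nlinarith) hy
    nlinarith
  have h1 := exp_neg_one_le
  have h2 := exp_half_le
  calc _ = Real.exp (-1) / b * ε * √(1 + M)
      + Real.exp (-1) * (1 / (c * b)) * Real.exp (-(c * b) / 2) * (√(κ + n * L ^ 2) / √κ) := by
        ring
    _ ≤ 0.368 / b * ε * √(1 + M) + 0.368 * (5 / 4 / b) * (ε * 1.65) * √(1 + M) := by
        have : Real.exp (-(c * b) / 2) ≤ ε * 1.65 := hcexp.trans (by gcongr)
        gcongr
    _ = (0.368 * 3.0625 / 2.3) * (√(1 + M) * ε * 2.3) / b := by ring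
    _ ≤ (0.368 * 3.0625 / 2.3) * (b / t) / b := by gcongr
    _ = (0.368 * 3.0625 / 2.3) / t := by field_simp
    _ ≤ 1 / (2 * t) := by
        rw [div_le_div_iff₀ ht0 (by positivity)]
        norm_num
        linarith
    _ ≤ _ := by gcongr; linarith

end Numerics

/-! ### The linear bandit. -/

section LinearRegret

variable {C A : Type*} {d n m : ℕ} {X : A → EuclideanSpace ℝ (Fin d)} {T : ℕ} {S L : ℝ}

theorem sqrtBeta_nonneg {r : ℝ} (hr : 0 ≤ r) (hS : 0 ≤ S) : 0 ≤ sqrtBeta d T r S L n := by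
  rw [sqrtBeta]; positivity

/-- The growth of the confidence width. -/
theorem sqrtBeta_sq_le {r : ℝ} (hr : 0 ≤ r) (hS : 0 ≤ S) (hL : 0 ≤ L) (hT : 2 ≤ T) :
    sqrtBeta d T r S L n ^ 2 ≤ Real.log ((T : ℝ) ^ 2 * (1 + n * L)) / Real.log ((T : ℝ) ^ 2)
      * sqrtBeta d T r S L 0 ^ 2 := by
  have hT' : (2 : ℝ) ≤ T := by exact_mod_cast hT
  have hy : 0 ≤ n * L := by positivity
  have h0 : 0 < Real.log ((T : ℝ) ^ 2) := Real.log_pos (by nlinarith)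
  set ℓ := Real.log ((T : ℝ) ^ 2 * (1 + n * L)) with hℓ
  set ℓ₀ := Real.log ((T : ℝ) ^ 2) with hℓ₀
  have hle : ℓ₀ ≤ ℓ := Real.log_le_log (by positivity) (by nlinarith)
  have h1 : 1 ≤ ℓ / ℓ₀ := (one_le_div h0).2 hle
  have hs : 1 ≤ √(ℓ / ℓ₀) := Real.one_le_sqrt.2 h1
  have hβ : sqrtBeta d T r S L n ≤ √(ℓ / ℓ₀) * sqrtBeta d T r S L 0 := by
    rw [sqrtBeta, sqrtBeta, ← hℓ, Nat.cast_zero, zero_mul, add_zero, mul_one, ← hℓ₀, mul_add,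
      mul_left_comm, ← Real.sqrt_mul (by positivity),
      show ℓ / ℓ₀ * (d * ℓ₀) = d * ℓ by field_simp]
    have : S ≤ √(ℓ / ℓ₀) * S := le_mul_of_one_le_left hS hs
    linarith
  calc sqrtBeta d T r S L n ^ 2 ≤ (√(ℓ / ℓ₀) * sqrtBeta d T r S L 0) ^ 2 :=
        pow_le_pow_left₀ (sqrtBeta_nonneg hr hS) hβ 2
    _ = _ := by rw [mul_pow, Real.sq_sqrt (by linarith)]

/-- Bounds on the radii before the first and before round `n` bound the size of the design. -/
theorem sum_norm_sq_le_of_radius {r rmin rmax : ℝ} (hr : 0 ≤ r) (hS : 0 ≤ S) (hL : 0 ≤ L)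
    (hT : 2 ≤ T) (hrmin : 0 < rmin) (h₀ : Hist C A 0) (h : Hist C A n)
    (hmax : ∀ a, radius (linMuHat X) (linU X T r S L) h₀ a ≤ rmax)
    (hmin : ∀ a, rmin ≤ radius (linMuHat X) (linU X T r S L) h a) :
    ∑ s : Fin n, ‖X (h.1 s).2.1‖ ^ 2
      ≤ d * ((rmax / rmin) ^ 2
        * (Real.log ((T : ℝ) ^ 2 * (1 + n * L)) / Real.log ((T : ℝ) ^ 2))) := by
  set ratio := Real.log ((T : ℝ) ^ 2 * (1 + n * L)) / Real.log ((T : ℝ) ^ 2) with hratio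
  set β := sqrtBeta d T r S L n with hβ
  set β₀ := sqrtBeta d T r S L 0 with hβ₀
  have hβn : 0 ≤ β := sqrtBeta_nonneg hr hS
  have hβ₀n : 0 ≤ β₀ := sqrtBeta_nonneg hr hS
  have hsq : β ^ 2 ≤ ratio * β₀ ^ 2 := sqrtBeta_sq_le hr hS hL hT
  -- In round 0 the design is the identity, so the radius is β₀‖X a‖, and `rmax` bounds all features
  -- at once.
  have h1 : ∀ a, β₀ ^ 2 * ‖X a‖ ^ 2 ≤ rmax ^ 2 := fun a => by
    have := hmax a
    rw [radius_lin hβ₀n, stepVar_zero, Real.sqrt_sq (norm_nonneg _)] at this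
    rw [← mul_pow]
    exact pow_le_pow_left₀ (by positivity) this 2
  have h2 : ∀ a, rmin ^ 2 ≤ β ^ 2 * stepVar X 1 h a := fun a => by
    have := hmin a
    rw [radius_lin hβn] at this
    have h3 := pow_le_pow_left₀ hrmin.le this 2
    rwa [mul_pow, Real.sq_sqrt (stepVar_nonneg one_pos h a)] at h3
  -- The values of `stepVar` at the actions played sum to at most d, so a lower bound on all radii
  -- limits n.
  have h3 : n * rmin ^ 2 ≤ β ^ 2 * d := by
    calc n * rmin ^ 2 = ∑ _s : Fin n, rmin ^ 2 := by simp
      _ ≤ ∑ s : Fin n, β ^ 2 * stepVar X 1 h (h.1 s).2.1 := Finset.sum_le_sum fun s _ => h2 _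
      _ = β ^ 2 * ∑ s : Fin n, stepVar X 1 h (h.1 s).2.1 := by rw [Finset.mul_sum]
      _ ≤ _ := mul_le_mul_of_nonneg_left (sum_stepVar_le h) (sq_nonneg β)
  have h4 : β₀ ^ 2 * ∑ s : Fin n, ‖X (h.1 s).2.1‖ ^ 2 ≤ n * rmax ^ 2 := by
    rw [Finset.mul_sum]
    calc _ ≤ ∑ _s : Fin n, rmax ^ 2 := Finset.sum_le_sum fun s _ => h1 _
      _ = _ := by simp
  rcases n.eq_zero_or_pos with hn | hn
  · subst hn
    have hT' : (2 : ℝ) ≤ T := by exact_mod_cast hT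
    have : 0 ≤ ratio := by
      rw [hratio, Nat.cast_zero, zero_mul, add_zero, mul_one]
      have : 0 ≤ Real.log ((T : ℝ) ^ 2) := Real.log_nonneg (by nlinarith)
      positivity
    rw [Finset.univ_eq_empty, Finset.sum_empty]
    positivity
  have hn' : (0 : ℝ) < n := by exact_mod_cast hn
  have hβ₀0 : 0 < β₀ ^ 2 := by
    refine (sq_nonneg β₀).lt_of_ne fun h0 => ?_
    rw [← h0, mul_zero] at hsq
    have : 0 < β ^ 2 * d := lt_of_lt_of_le (by positivity) h3
    have h5 : 0 ≤ (d : ℝ) := Nat.cast_nonneg d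
    nlinarith [sq_nonneg β]
  refine le_of_mul_le_mul_left (h4.trans ?_) hβ₀0
  have h5 : n * rmin ^ 2 ≤ ratio * β₀ ^ 2 * d := h3.trans (by gcongr)
  have h6 : (n : ℝ) ≤ ratio * β₀ ^ 2 * d / rmin ^ 2 := by
    rwa [le_div_iff₀ (by positivity)]
  calc n * rmax ^ 2 ≤ ratio * β₀ ^ 2 * d / rmin ^ 2 * rmax ^ 2 := by gcongr
    _ = _ := by ring

theorem det_ridge_le {D : ℝ} (hD : 1 ≤ D) (h : Hist C A n)
    (hs : ∑ s : Fin n, ‖X (h.1 s).2.1‖ ^ 2 ≤ d * (D - 1)) : (ridge X 1 h).det ≤ D ^ d :=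
  det_le_pow_of_trace_le (posDef_ridge one_pos h) (by linarith)
    (by rw [trace_ridge_one]; linarith)

theorem sum_norm_sq_le (hX : ∀ a, ‖X a‖ ≤ L) (h : Hist C A n) :
    ∑ s : Fin n, ‖X (h.1 s).2.1‖ ^ 2 ≤ n * L ^ 2 := by
  calc _ ≤ ∑ _s : Fin n, L ^ 2 :=
        Finset.sum_le_sum fun s _ => pow_le_pow_left₀ (norm_nonneg _) (hX _) 2
    _ = _ := by simp

/-- If the ratio of the radii is of the order of the horizon, all rounds but the first may be
bounded trivially. -/
theorem sum_regret_le_of_large_ratio {T m : ℕ} {reg rad : ℕ → ℝ} {ρ : ℝ} (hT : 1 ≤ T)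
    (hρ : 1 ≤ ρ) (hρT : 2 * ((T : ℝ) - 1) ≤ ρ) (h0 : reg 0 ≤ 2 * rad 0 + (1 + ρ) * (1 / √m))
    (hreg : ∀ n < T, reg n ≤ 2) (hrad : ∀ n < T, 0 ≤ rad n) :
    ∑ n ∈ Finset.range T, reg n
      ≤ 2 * ∑ n ∈ Finset.range T, rad n + ρ * (1 + 2 * T / √m) := by
  obtain ⟨k, rfl⟩ : ∃ k, T = k + 1 := ⟨T - 1, by omega⟩
  rw [Finset.sum_range_succ', Finset.sum_range_succ']
  have h1 : ∑ i ∈ Finset.range k, reg (i + 1) ≤ k * 2 := by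
    calc _ ≤ ∑ _i ∈ Finset.range k, (2 : ℝ) := Finset.sum_le_sum fun i hi =>
          hreg _ (by have := Finset.mem_range.1 hi; omega)
      _ = _ := by simp
  have h2 : 0 ≤ ∑ i ∈ Finset.range k, rad (i + 1) := Finset.sum_nonneg fun i hi =>
    hrad _ (by have := Finset.mem_range.1 hi; omega)
  push_cast at hρT ⊢
  have hm : 0 ≤ 1 / √(m : ℝ) := by positivity
  have h3 : (1 + ρ) * (1 / √m) ≤ ρ * (2 * (k + 1)) * (1 / √m) := by
    refine mul_le_mul_of_nonneg_right ?_ hm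
    have : (0 : ℝ) ≤ k := Nat.cast_nonneg k
    nlinarith
  have h4 : ρ * (1 + 2 * (k + 1) / √m) = ρ + ρ * (2 * (k + 1)) * (1 / √m) := by ring
  linarith

variable {Ω : Type*} [MeasurableSpace Ω] [MeasurableSpace C] [MeasurableSpace A]
  {P : Measure Ω} [IsProbabilityMeasure P]
  {q : Measure (EuclideanSpace ℝ (Fin d))} {ν : Kernel (EuclideanSpace ℝ (Fin d) × A) ℝ}
  [IsMarkovKernel ν] {R : Run Ω C A (EuclideanSpace ℝ (Fin d)) m}
  {Θ : Set (EuclideanSpace ℝ (Fin d))} {r : ℝ≥0}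

theorem log_horizon_pos (hT : 2 ≤ T) (hL : 0 ≤ L) :
    0 < Real.log ((T : ℝ) ^ 2 * (1 + n * L)) := by
  have hT' : (2 : ℝ) ≤ T := by exact_mod_cast hT
  have hy : 0 ≤ n * L := by positivity
  exact Real.log_pos (by nlinarith)

theorem lintegral_linExcess_fin_one_le_horizon {X : A → EuclideanSpace ℝ (Fin 1)}
    {q : Measure (EuclideanSpace ℝ (Fin 1))} {ν : Kernel (EuclideanSpace ℝ (Fin 1) × A) ℝ}
    [IsMarkovKernel ν] {R : Run Ω C A (EuclideanSpace ℝ (Fin 1)) m}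
    {Θ : Set (EuclideanSpace ℝ (Fin 1))}
    (hT : 2 ≤ T) (hn : 1 ≤ n) (hX : Measurable X) (hL0 : 0 ≤ L)
    (hL : ∀ a, ‖X a‖ ≤ L) (hr : 0 < r) (hS0 : 0 ≤ S)
    (hS : ∀ θ ∈ Θ, ‖θ‖ ≤ S) (hR : IsBanditRun P q ν R) (hΘ : ∀ᵐ ω ∂P, R.param ω ∈ Θ)
    (hν : ∀ θ ∈ Θ, ∀ a, HasSubgaussianMGF (fun y => y - linMean X θ a) (r ^ 2) (ν (θ, a))) :
    ∫⁻ ω, ENNReal.ofReal (linExcess X T r S L (R.hist n ω, R.param ω)) ∂P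
      ≤ ENNReal.ofReal (1 / (2 * ((T : ℝ) - 1))) := by
  have hT' : (2 : ℝ) ≤ T := by exact_mod_cast hT
  have hl := log_horizon_pos (n := n) hT hL0
  obtain ⟨b, hb⟩ : ∃ b : ℝ, b = (1 : ℕ) * Real.log ((T : ℝ) ^ 2 * (1 + n * L)) := ⟨_, rfl⟩
  have hb0 : 0 < b := by rw [hb]; positivity
  rcases lt_or_ge b 4 with hb4 | hb4
  · have hD1 : (1 : ℝ) ≤ 1 + n * L ^ 2 := by
      have : 0 ≤ n * L ^ 2 := by positivity
      linarith
    refine (lintegral_linExcess_le hX hr hS0 hS hR hΘ hν hb hb0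
      (ae_of_all _ fun ω => det_ridge_le hD1 (R.hist n ω) ?_)).trans
      (ENNReal.ofReal_le_ofReal
        (excess_bound_fin_one_of_lt hn hT' hL0 hb hb4 le_rfl))
    have := sum_norm_sq_le hL (R.hist n ω)
    simpa using this
  · obtain ⟨M, hM⟩ : ∃ M : ℝ, M = n * L * b / 2 := ⟨_, rfl⟩
    obtain ⟨κ, hκ⟩ : ∃ κ : ℝ, κ = 1 + M / b := ⟨_, rfl⟩
    have hM0 : 0 ≤ M := by rw [hM]; positivity
    have hκ1 : 1 ≤ κ := by
      have : 0 ≤ M / b := by positivity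
      linarith
    exact (lintegral_linExcess_fin_one_le hX hr hS0 hS hR hΘ hν hb hb0 hM0 hκ1 rfl
      fun ω => sum_norm_sq_le hL (R.hist n ω)).trans
      (ENNReal.ofReal_le_ofReal (excess_bound_fin_one_of_le hn hT' hL0 hb hb4 hM hκ rfl))

/-- In each round but the first the expected excess is at most `1 / (2 (T - 1))`. -/
theorem lintegral_linExcess_le_horizon {rmin rmax : ℝ} (hrmin : 0 < rmin) (hr' : rmin ≤ rmax)
    (hρ : rmax / rmin ≤ 2 * ((T : ℝ) - 1))
    (hT : 2 ≤ T) (hd : 1 ≤ d) (hn : 1 ≤ n) (hX : Measurable X) (hL0 : 0 ≤ L)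
    (hL : ∀ a, ‖X a‖ ≤ L) (hr : 0 < r) (hS0 : 0 ≤ S)
    (hS : ∀ θ ∈ Θ, ‖θ‖ ≤ S) (hR : IsBanditRun P q ν R) (hΘ : ∀ᵐ ω ∂P, R.param ω ∈ Θ)
    (hν : ∀ θ ∈ Θ, ∀ a, HasSubgaussianMGF (fun y => y - linMean X θ a) (r ^ 2) (ν (θ, a)))
    (hrad₀ : ∀ᵐ ω ∂P, ∀ a,
      radius (linMuHat X) (linU X T r S L) (R.hist 0 ω) a ∈ Set.Icc rmin rmax)
    (hrad : ∀ᵐ ω ∂P, ∀ a,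
      radius (linMuHat X) (linU X T r S L) (R.hist n ω) a ∈ Set.Icc rmin rmax) :
    ∫⁻ ω, ENNReal.ofReal (linExcess X T r S L (R.hist n ω, R.param ω)) ∂P
      ≤ ENNReal.ofReal (1 / (2 * ((T : ℝ) - 1))) := by
  rcases hd.eq_or_lt with rfl | hd2
  · exact lintegral_linExcess_fin_one_le_horizon hT hn hX hL0 hL hr hS0 hS hR hΘ hν
  have hT' : (2 : ℝ) ≤ T := by exact_mod_cast hT
  have hn' : (1 : ℝ) ≤ n := by exact_mod_cast hn
  have hd' : (2 : ℝ) ≤ d := by exact_mod_cast hd2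
  have hd0 : (0 : ℝ) < d := by linarith
  have hl := log_horizon_pos (n := n) hT hL0
  obtain ⟨b, hb⟩ : ∃ b : ℝ, b = d * Real.log ((T : ℝ) ^ 2 * (1 + n * L)) := ⟨_, rfl⟩
  have hb0 : 0 < b := by rw [hb]; positivity
  have hy : 0 ≤ n * L := by positivity
  -- Up to 2dT the trace bound through L gives D ≤ 2T(1 + nL). Beyond that the design is controlled
  -- through the radii, and nL ≥ 4T.
  rcases le_or_gt L (2 * d * T) with hLd | hLd
  · have hD1 : (1 : ℝ) ≤ 1 + n * L ^ 2 / d := by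
      have : 0 ≤ n * L ^ 2 / d := by positivity
      linarith
    refine (lintegral_linExcess_le hX hr hS0 hS hR hΘ hν hb hb0
      (ae_of_all _ fun ω => det_ridge_le hD1 (R.hist n ω) ?_)).trans
      (ENNReal.ofReal_le_ofReal (excess_bound_of_le hd2 hT' hy hb (by linarith) ?_))
    · have := sum_norm_sq_le hL (R.hist n ω)
      rwa [add_sub_cancel_left, mul_div_cancel₀ _ hd0.ne']
    · have h1 : n * L ^ 2 / d ≤ n * L * (2 * T) := by
        rw [div_le_iff₀ hd0]
        calc n * L ^ 2 = n * L * L := by ring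
          _ ≤ n * L * (2 * d * T) := by gcongr
          _ = _ := by ring
      nlinarith
  · obtain ⟨w, hw⟩ : ∃ w, w = Real.log ((T : ℝ) ^ 2 * (1 + n * L)) / Real.log ((T : ℝ) ^ 2) :=
      ⟨_, rfl⟩
    have hw0 : 0 ≤ w := by
      rw [hw]
      exact div_nonneg hl.le (Real.log_nonneg (by nlinarith))
    have hρ0 : 0 ≤ rmax / rmin := by
      have := hrmin.trans_le hr'
      positivity
    have hD1 : (1 : ℝ) ≤ 1 + 4 * ((T : ℝ) - 1) ^ 2 * w := by
      have : 0 ≤ 4 * ((T : ℝ) - 1) ^ 2 * w := by positivity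
      linarith
    refine (lintegral_linExcess_le hX hr hS0 hS hR hΘ hν hb hb0
      (D := 1 + 4 * ((T : ℝ) - 1) ^ 2 * w) ?_).trans
      (ENNReal.ofReal_le_ofReal
        (excess_bound_of_large hd2 hT' ?_ hb (by linarith) (by rw [hw])))
    · filter_upwards [hrad₀, hrad] with ω h₀ h
      refine det_ridge_le hD1 (R.hist n ω) ?_
      refine (sum_norm_sq_le_of_radius r.2 hS0 hL0 hT hrmin (R.hist 0 ω) (R.hist n ω)
        (fun a => (h₀ a).2) (fun a => (h a).1)).trans ?_
      rw [← hw, add_sub_cancel_left]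
      have : (rmax / rmin) ^ 2 ≤ (2 * ((T : ℝ) - 1)) ^ 2 := pow_le_pow_left₀ hρ0 hρ 2
      calc d * ((rmax / rmin) ^ 2 * w) ≤ d * ((2 * ((T : ℝ) - 1)) ^ 2 * w) := by gcongr
        _ = _ := by ring
    · have h1 : 2 * 2 * (T : ℝ) ≤ 2 * d * T := by gcongr
      nlinarith

theorem bayesRegret_linMean_le (hm : 1 ≤ m) (hT : 1 ≤ T) {rmin rmax : ℝ} (hrmin : 0 < rmin)
    (hr' : rmin ≤ rmax) {avail : C → Set A} (hX : Measurable X) (hr : 0 < r)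
    (hS : ∀ θ ∈ Θ, ‖θ‖ ≤ S) (hL : ∀ a, ‖X a‖ ≤ L)
    (hΘ1 : ∀ θ ∈ Θ, ∀ a, linMean X θ a ∈ Set.Icc (-1 : ℝ) 1)
    (hq : ∀ᵐ θ ∂q, θ ∈ Θ)
    (hν : ∀ θ ∈ Θ, ∀ a, HasSubgaussianMGF (fun y => y - linMean X θ a) (r ^ 2) (ν (θ, a)))
    {opt : ℕ → C → EuclideanSpace ℝ (Fin d) → A} (hopt : IsOptimal (linMean X) Θ avail opt)
    (hR : IsBanditRun P q ν R)
    (hTS : IsTSUCB P (linMean X) avail opt (linMuHat X) (linU X T r S L) 0 R)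
    (hrad : ∀ n, n < T → ∀ᵐ ω ∂P, ∀ a,
      radius (linMuHat X) (linU X T r S L) (R.hist n ω) a ∈ Set.Icc rmin rmax) :
    bayesRegret P (linMean X) opt R (Finset.range T)
      ≤ 2 * expRadius P (linMuHat X) (linU X T r S L) R (Finset.range T)
        + rmax / rmin * (1 + 2 * T / √m) := by
  have hΘ' : ∀ᵐ θ ∂(P.map R.param), θ ∈ Θ := by rwa [hR.law_param.map_eq]
  have hΘ : ∀ᵐ ω ∂P, R.param ω ∈ Θ := ae_of_ae_map hR.measurable_param.aemeasurable hΘ'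
  have hρ1 : 1 ≤ rmax / rmin := (one_le_div hrmin).2 hr'
  obtain ⟨ω₀, hω₀, hω₀r⟩ := (hΘ.and (hrad 0 hT)).exists
  have hS0 : 0 ≤ S := (norm_nonneg _).trans (hS _ hω₀)
  have hL0 : 0 ≤ L := (norm_nonneg _).trans (hL (R.act 0 ω₀))
  have hβ : ∀ n, 0 ≤ sqrtBeta d T r S L n := fun n => sqrtBeta_nonneg r.2 hS0
  -- In dimension zero all radii would vanish.
  have hd : 1 ≤ d := by
    by_contra hd
    obtain rfl : d = 0 := by omega
    have h1 := hrmin.trans_le (hω₀r (R.act 0 ω₀)).1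
    rw [radius_lin (hβ 0), stepVar_zero, Subsingleton.elim (X (R.act 0 ω₀)) 0] at h1
    simp at h1
  have hf : Measurable (Function.uncurry (linMean X)) := measurable_linMean hX
  have hexm : ∀ n, Measurable fun ω => linExcess X T r S L (R.hist n ω, R.param ω) := fun n =>
    Measurable.comp (g := (linExcess X T r S L : Hist C A n × EuclideanSpace ℝ (Fin d) → ℝ))
      (f := fun ω => (R.hist n ω, R.param ω)) (measurable_linExcess hX)
      ((hR.measurable_hist n).prodMk hR.measurable_param)
  have key : ∀ n, n < T → Integrable (fun ω => linExcess X T r S L (R.hist n ω, R.param ω)) P →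
      ∫ ω, (linMean X (R.param ω) (opt n (R.ctx n ω) (R.param ω))
        - linMean X (R.param ω) (R.act n ω)) ∂P
      ≤ 2 * ∫ ω, radius (linMuHat X) (linU X T r S L) (R.hist n ω) (R.act n ω) ∂P
        + (1 + rmax / rmin)
          * (1 / √m + ∫ ω, linExcess X T r S L (R.hist n ω, R.param ω) ∂P) := by
    intro n hn hi
    exact integral_regret_le hm hrmin hr' hf hopt (fun θ hθ a => abs_le.2 (hΘ1 θ hθ a)) hR hΘ'
      hTS n.zero_le (measurable_radius_lin hX (hβ n)) (hrad n hn) (measurable_linExcess hX)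
      linExcess_nonneg hi
      (fun h θ _ hrad a => abs_linMean_sub_le (hβ n) h θ a (hrmin.trans_le (hrad a).1))
  have hzero : (fun ω => linExcess X T r S L (R.hist 0 ω, R.param ω)) =ᵐ[P] fun _ => 0 := by
    filter_upwards [hΘ] with ω hω
    exact linExcess_zero r.2 (hS _ hω) _
  have hi0 : Integrable (fun ω => linExcess X T r S L (R.hist 0 ω, R.param ω)) P :=
    (integrable_congr hzero).2 (integrable_zero _ _ _)
  have hint0 : ∫ ω, linExcess X T r S L (R.hist 0 ω, R.param ω) ∂P = 0 := by
    rw [integral_congr_ae hzero, integral_zero]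
  -- A ratio of at least 2(T - 1) already pays the trivial regret 2 of every round after the first.
  rcases le_or_gt (2 * ((T : ℝ) - 1)) (rmax / rmin) with hρ | hρ
  · refine sum_regret_le_of_large_ratio hT hρ1 hρ ?_ (fun n _ => ?_) (fun n hn => ?_)
    · have := key 0 hT hi0
      rwa [hint0, add_zero] at this
    · have h1 := norm_integral_le_of_norm_le_const (μ := P) (C := 2)
          (f := fun ω => linMean X (R.param ω) (opt n (R.ctx n ω) (R.param ω))
            - linMean X (R.param ω) (R.act n ω)) (by
        filter_upwards [hΘ] with ω hω
        exact abs_sub_le_two (abs_le.2 (hΘ1 _ hω _)) (abs_le.2 (hΘ1 _ hω _)))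
      simp only [probReal_univ, mul_one] at h1
      exact (le_abs_self _).trans h1
    · refine integral_nonneg_of_ae ?_
      filter_upwards [hrad n hn] with ω hω
      exact hrmin.le.trans (hω _).1
  · have hT2 : 2 ≤ T := by
      by_contra h
      obtain rfl : T = 1 := by omega
      norm_num at hρ
      linarith
    have hT' : (2 : ℝ) ≤ T := by exact_mod_cast hT2
    have hT1 : 0 < (T : ℝ) - 1 := by linarith
    -- The excess of round 0 is zero, so only T - 1 rounds share the budget 1/2.
    refine sum_regret_le (x := fun n => if n = 0 then 0 else 1 / (2 * ((T : ℝ) - 1)))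
      hrmin hr' (by simp) (fun n hn => ?_) ?_
    · have hn := Finset.mem_range.1 hn
      rcases n.eq_zero_or_pos with rfl | hn0
      · have := key 0 hn hi0
        rw [hint0] at this
        simpa using this
      · obtain ⟨hi, hle⟩ := integrable_and_integral_le_of_lintegral_le (hexm n)
          (fun ω => linExcess_nonneg _) (by positivity)
          (lintegral_linExcess_le_horizon hrmin hr' hρ.le hT2 hd hn0 hX hL0 hL hr hS0 hS hR hΘ
            hν (hrad 0 hT) (hrad n hn))
        refine (key n hn hi).trans ?_
        rw [if_neg hn0.ne']
        have : 0 ≤ 1 + rmax / rmin := by linarith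
        gcongr
    · obtain ⟨k, rfl⟩ : ∃ k, T = k + 1 := ⟨T - 1, by omega⟩
      rw [Finset.sum_range_succ']
      simp only [Nat.add_eq_zero_iff, one_ne_zero, and_false, if_false, if_true, Finset.sum_const,
        Finset.card_range, nsmul_eq_mul, Nat.cast_add, Nat.cast_one, add_sub_cancel_right, add_zero]
      push_cast at hT1
      have : (k : ℝ) ≠ 0 := by rw [add_sub_cancel_right] at hT1; exact hT1.ne'
      field_simp
      norm_num

end LinearRegret

end TSUCB

theorem proposition1 (m : ℕ) (hm : 1 ≤ m) (T : ℕ) (hT : 1 ≤ T)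
    (rmin rmax : ℝ) (hrmin : 0 < rmin) (hr : rmin ≤ rmax)
    {Ω : Type*} [MeasurableSpace Ω] (P : Measure Ω) [IsProbabilityMeasure P] :
    -- the `K`-armed bandit; each arm is pulled once in the first `K` rounds
    (∀ (K : ℕ), K ≤ T →
      ∀ (q : Measure (Fin K → ℝ)) (ν : Kernel ((Fin K → ℝ) × Fin K) ℝ) [IsMarkovKernel ν],
      (∀ᵐ θ ∂q, ∀ a, θ a ∈ Set.Icc (0 : ℝ) 1) →
      (∀ θ : Fin K → ℝ, (∀ a, θ a ∈ Set.Icc (0 : ℝ) 1) → ∀ a,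
        (∀ᵐ y ∂(ν (θ, a)), y ∈ Set.Icc (0 : ℝ) 1) ∧ ∫ y, y ∂(ν (θ, a)) = θ a) →
      ∀ (opt : ℕ → Unit → (Fin K → ℝ) → Fin K),
      TSUCB.IsOptimal TSUCB.armMean {θ | ∀ a, θ a ∈ Set.Icc (0 : ℝ) 1}
        (fun _ => Set.univ) opt →
      ∀ (R : TSUCB.Run Ω Unit (Fin K) (Fin K → ℝ) m),
      TSUCB.IsBanditRun P q ν R →
      TSUCB.IsTSUCB P TSUCB.armMean (fun _ => Set.univ) opt TSUCB.armMuHat (TSUCB.armU T) K R →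
      (∀ᵐ ω ∂P, ∀ a, ∃! n, n < K ∧ R.act n ω = a) →
      (∀ n, K ≤ n → n < T → ∀ᵐ ω ∂P, ∀ a,
        TSUCB.radius TSUCB.armMuHat (TSUCB.armU T) (R.hist n ω) a ∈ Set.Icc rmin rmax) →
      TSUCB.bayesRegret P TSUCB.armMean opt R (Finset.Ico K T)
          ≤ 2 * TSUCB.expRadius P TSUCB.armMuHat (TSUCB.armU T) R (Finset.Ico K T)
            + rmax / rmin * (1 + 2 * T / √m) + 1 / (T : ℝ) ^ 2 ∧
      TSUCB.bayesRegret P TSUCB.armMean opt R (Finset.range T)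
          ≤ K + 2 * TSUCB.expRadius P TSUCB.armMuHat (TSUCB.armU T) R (Finset.Ico K T)
            + rmax / rmin * (1 + 2 * T / √m) + 1 / (T : ℝ) ^ 2) ∧
    -- the linear bandit
    (∀ (d : ℕ) {C : Type*} [MeasurableSpace C] {A : Type*} [MeasurableSpace A]
      (avail : C → Set A) (X : A → EuclideanSpace ℝ (Fin d)), Measurable X →
      ∀ (S L : ℝ) (r : ℝ≥0), S ≤ √d → 1 ≤ r →
      ∀ (Θ : Set (EuclideanSpace ℝ (Fin d))),
      (∀ θ ∈ Θ, ‖θ‖ ≤ S) → (∀ a, ‖X a‖ ≤ L) →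
      (∀ θ ∈ Θ, ∀ a, TSUCB.linMean X θ a ∈ Set.Icc (-1 : ℝ) 1) →
      ∀ (q : Measure (EuclideanSpace ℝ (Fin d)))
        (ν : Kernel (EuclideanSpace ℝ (Fin d) × A) ℝ) [IsMarkovKernel ν],
      (∀ᵐ θ ∂q, θ ∈ Θ) →
      (∀ θ ∈ Θ, ∀ a,
        HasSubgaussianMGF (fun y => y - TSUCB.linMean X θ a) (r ^ 2) (ν (θ, a))) →
      ∀ (opt : ℕ → C → EuclideanSpace ℝ (Fin d) → A),
      TSUCB.IsOptimal (TSUCB.linMean X) Θ avail opt →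
      ∀ (R : TSUCB.Run Ω C A (EuclideanSpace ℝ (Fin d)) m),
      TSUCB.IsBanditRun P q ν R →
      TSUCB.IsTSUCB P (TSUCB.linMean X) avail opt (TSUCB.linMuHat X) (TSUCB.linU X T r S L) 0 R →
      (∀ n, n < T → ∀ᵐ ω ∂P, ∀ a,
        TSUCB.radius (TSUCB.linMuHat X) (TSUCB.linU X T r S L) (R.hist n ω) a
          ∈ Set.Icc rmin rmax) →
      TSUCB.bayesRegret P (TSUCB.linMean X) opt R (Finset.range T)
          ≤ 2 * TSUCB.expRadius P (TSUCB.linMuHat X) (TSUCB.linU X T r S L) R (Finset.range T)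
            + rmax / rmin * (1 + 2 * T / √m) + 1 / (T : ℝ) ^ 2) := by
  have hT' : (0 : ℝ) ≤ 1 / (T : ℝ) ^ 2 := by positivity
  refine ⟨?_, ?_⟩
  · intro K hKT q ν _ hq hν opt hopt R hR hTS _ hrad
    have h1 := TSUCB.bayesRegret_armMean_le hm hrmin hr hKT hq hν hopt hR hTS hrad
    have h2 := TSUCB.bayesRegret_armMean_range_le (opt := opt) hKT hq hR
    constructor <;> linarith
  · intro d C _ A _ avail X hX S L r _ hr1 Θ hS hL hΘ1 q ν _ hq hν opt hopt R hR hTS hrad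
    have h1 := TSUCB.bayesRegret_linMean_le hm hT hrmin hr hX (zero_lt_one.trans_le hr1) hS hL hΘ1
      hq hν hopt hR hTS hrad
    linarith
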